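/- Let $d\ge 2$ be an integer and write $\mathbb{T}=\mathbb{R}/\mathbb{Z}$ for the circle. A map $f:\mathbb{T}\to\mathbb{T}$ is of class $C^{1+\mathrm{BV}}$ if it is $C^1$ and its derivative $Df$ (which is continuous) has bounded variation on $\mathbb{T}$; for an integer $r\ge 2$ and $0<\epsilon\le 1$ it is of class $C^{r+\epsilon}$ if it is $C^r$ and its $r$-th derivative is $\epsilon$-Hölder; $C^\omega$ means real analytic. A diffeomorphism of one of these classes is a homeomorphism $\phi$ of $\mathbb{T}$ such that $\phi$ and $\phi^{-1}$ are both of that class. Let $\mathcal{F}_d^{1+\mathrm{BV}}$ be the set of orientation preserving covering maps $h:\mathbb{T}\to\mathbb{T}$ of degree $d$ and of class $C^{1+\mathrm{BV}}$ that are local diffeomorphisms (so $Dh>0$ everywhere). For such $h$ let $\operatorname{Par}(h)$ be the set of parabolic periodic points, i.e. of the periodic points $p$ with $Dh^s(p)=1$, where $s$ is the period of $p$. Let $\mathcal{T}_d^*$ be the set of $h\in\mathcal{F}_d^{1+\mathrm{BV}}$ such that every periodic point $p$, of period $s$ say, has a neighborhood $U(p)$ with $Dh^s(x)>1$ for all $x\in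 U(p)\setminus\{p\}$. A map $g\in\mathcal{F}_d^{1+\mathrm{BV}}$ is called metrically expanding if $Dg(x)>1$ for all $x\in\mathbb{T}\setminus\operatorname{Par}(g)$. **Theorem.** Let $h\in\mathcal{T}_d^*$. Then $\operatorname{Par}(h)$ is finite, and there is a $C^{1+\mathrm{BV}}$ diffeomorphism $\phi$ of $\mathbb{T}$ such that $\phi\circ h\circ\phi^{-1}\in\mathcal{F}_d^{1+\mathrm{BV}}$ is metrically expanding. Moreover, if $h$ is of class $C^{r+\epsilon}$ for some integer $r\ge 2$ and some $0<\epsilon\le 1$ (respectively of class $C^\infty$, respectively of class $C^\omega$), then $\phi$ can be chosen to be a diffeomorphism of class $C^{r+\epsilon}$ (respectively $C^\infty$, respectively $C^\omega$). -/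

import Mathlib

open Set Filter Topology
open scoped NNReal ContDiff

namespace CircleExpanding

/-- `H : ℝ → ℝ` is a (continuous) lift of `f : ℝ/ℤ → ℝ/ℤ`. Two lifts of the same map differ by a
constant integer. -/
structure IsLift (H : ℝ → ℝ) (f : UnitAddCircle → UnitAddCircle) : Prop where
  continuous : Continuous H
  coe_eq : ∀ x : ℝ, ((H x : ℝ) : UnitAddCircle) = f (x : UnitAddCircle)

/-- `f` has degree `d`: it has a lift `H` with `H (x + 1) = H x + d`. -/
def HasDegree (f : UnitAddCircle → UnitAddCircle) (d : ℤ) : Prop :=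
  ∃ H : ℝ → ℝ, IsLift H f ∧ ∀ x : ℝ, H (x + 1) = H x + d

/-- The representative in `[-1/2, 1/2)` of a point of `ℝ/ℤ`. -/
noncomputable def signedRep (q : UnitAddCircle) : ℝ :=
  haveI : Fact ((0 : ℝ) < 1) := ⟨one_pos⟩
  (AddCircle.equivIco (1 : ℝ) (-1 / 2) q : ℝ)

/-- The derivative `Df(p)` of a circle map `f : ℝ/ℤ → ℝ/ℤ` with respect to the coordinate of `ℝ`,
namely the derivative at `t = 0` of the small real representative of `f (p + t) - f p`
(see `circleDeriv_coe` for its expression through a lift). -/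
noncomputable def circleDeriv (f : UnitAddCircle → UnitAddCircle) (p : UnitAddCircle) : ℝ :=
  deriv (fun t : ℝ => signedRep (f (p + (t : UnitAddCircle)) - f p)) 0

lemma signedRep_coe {u : ℝ} (hu : u ∈ Ico (-1 / 2 : ℝ) (1 / 2)) :
    signedRep (u : UnitAddCircle) = u := by
  have : Fact ((0 : ℝ) < 1) := ⟨one_pos⟩
  have h : u ∈ Ico (-1 / 2 : ℝ) (-1 / 2 + 1) := by
    norm_num at hu ⊢
    exact hu
  exact AddCircle.equivIco_coe_of_mem h

/-- The derivative of a circle map is the derivative of any of its lifts. -/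
theorem circleDeriv_coe {H : ℝ → ℝ} {f : UnitAddCircle → UnitAddCircle} (hH : IsLift H f) (x : ℝ) :
    circleDeriv f (x : UnitAddCircle) = deriv H x := by
  have hc : ContinuousAt (fun t : ℝ => H (x + t) - H x) 0 := by
    have := hH.continuous
    fun_prop
  have hmem : ∀ᶠ t : ℝ in 𝓝 0, H (x + t) - H x ∈ Ico (-1 / 2 : ℝ) (1 / 2) := by
    apply hc.eventually_mem
    apply Ico_mem_nhds <;> norm_num
  have heq : (fun t : ℝ => signedRep (f ((x : UnitAddCircle) + (t : UnitAddCircle))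
      - f (x : UnitAddCircle))) =ᶠ[𝓝 0] fun t : ℝ => H (x + t) - H x := by
    filter_upwards [hmem] with t ht
    rw [← AddCircle.coe_add, ← hH.coe_eq, ← hH.coe_eq, ← AddCircle.coe_sub, signedRep_coe ht]
  rw [circleDeriv, heq.deriv_eq, deriv_sub_const, deriv_comp_const_add, add_zero]

/-- `f` is of class `C^n`, where `n` is a natural number, `∞` or `ω` (real analytic). -/
def IsCn (n : ℕ∞ω) (f : UnitAddCircle → UnitAddCircle) : Prop :=
  ∃ H : ℝ → ℝ, IsLift H f ∧ ContDiff ℝ n H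

/-- `f` is of class `C^{1+BV}`: `Df` is continuous and of bounded variation on the circle. -/
def IsC1BV (f : UnitAddCircle → UnitAddCircle) : Prop :=
  IsCn 1 f ∧ BoundedVariationOn (fun x : ℝ => circleDeriv f (x : UnitAddCircle)) (Icc 0 1)

/-- `f` is of class `C^{r+ε}`: it is `C^r` and its `r`-th derivative is `ε`-Hölder. -/
def IsCrHolder (r : ℕ) (ε : ℝ≥0) (f : UnitAddCircle → UnitAddCircle) : Prop :=
  ∃ H : ℝ → ℝ, IsLift H f ∧ ContDiff ℝ r H ∧ ∃ K : ℝ≥0, HolderWith K ε (iteratedDeriv r H)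

/-- The class `F_d^{1+BV}` of orientation preserving, locally diffeomorphic covering maps of the
circle of degree `d` and of class `C^{1+BV}`. -/
structure IsCovering (d : ℕ) (h : UnitAddCircle → UnitAddCircle) : Prop where
  isCoveringMap : IsCoveringMap h
  hasDegree : HasDegree h d
  isC1BV : IsC1BV h
  deriv_pos : ∀ p, 0 < circleDeriv h p

/-- The set `Par(h)` of parabolic periodic points: the periodic points of multiplier `1`. -/
def Par (h : UnitAddCircle → UnitAddCircle) : Set UnitAddCircle :=
  {p | p ∈ Function.periodicPts h ∧ circleDeriv (h^[Function.minimalPeriod h p]) p = 1}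

/-- The class `T_d^*`: all periodic points are weakly expanding, i.e. if `p` is periodic of period
`s`, then `Dh^s > 1` on a punctured neighbourhood of `p`. -/
structure IsTStar (d : ℕ) (h : UnitAddCircle → UnitAddCircle) : Prop where
  isCovering : IsCovering d h
  weaklyExpanding : ∀ p ∈ Function.periodicPts h, ∃ U ∈ 𝓝 p, ∀ x ∈ U \ {p},
    1 < circleDeriv (h^[Function.minimalPeriod h p]) x

/-- The class `M_d^{1+BV}` of metrically expanding maps. -/
structure IsMetricallyExpanding (d : ℕ) (h : UnitAddCircle → UnitAddCircle) : Prop where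
  isCovering : IsCovering d h
  one_lt_deriv : ∀ x, x ∉ Par h → 1 < circleDeriv h x

/-- `φ` is a diffeomorphism of class `C`: both `φ` and `φ⁻¹` are of class `C`. -/
def IsDiffeoOfClass (C : (UnitAddCircle → UnitAddCircle) → Prop)
    (φ : UnitAddCircle ≃ₜ UnitAddCircle) : Prop :=
  C φ ∧ C φ.symm

end CircleExpanding

open CircleExpanding

/-!
Write `H` for a lift of `h` to the line, normalised to fix the origin. A continuous periodic density
`ρ > 0` defines a metric `ρ |dx|` on the circle, and if `ρ (H x) * H' x > ρ x` at every point that is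
not parabolic, then the primitive of `ρ`, divided by its increment over a period, is the lift of a
diffeomorphism `φ` that conjugates `h` to a metrically expanding map. It suffices to find an analytic
density `ψ` for which some iterate `H^[N]` has this property (`ExpandingLift.exists_density`): the
sum `∑ ψ (H^[k] x) * (H^[k])' x` over `k < N` then works for `H` (`exists_expandingChart`). This sum
involves only `H'`, its compositions with iterates of `H`, and analytic functions, so it is as regular
as `H'`, and one and the same `φ` serves all regularity classes.

The density `ψ` needs two facts about the derivatives of the iterates. They are bounded below by a
positive constant (`exists_pos_le_iterDeriv`), and they are large, for iterates of high order, at the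
points whose image is away from the parabolic points (`exists_le_iterDeriv_of_far`). A function `ψ`
that increases with the distance to the parabolic points near these, and is small elsewhere, then
satisfies the inequality: a point near a parabolic orbit either follows it, moving away and being
expanded a little, or leaves its neighbourhood and has been expanded a lot.

Both facts rest on the Denjoy distortion estimate `exists_distortionBound`: as `log H'` has bounded
variation, `H^[n]` has bounded distortion on intervals whose first `n` images do not overlap modulo
`ℤ`. The intervals in question are cylinders, bounded by consecutive preimages of integers; the
pullbacks of a cylinder along an orbit segment up to its first visit do not overlap. Weak expansion
at periodic points makes the equation `H^[n] x = x + l` have at most one solution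
(`eq_of_iterate_eq_add`), and together with bounded distortion it excludes wandering intervals
(`not_exists_homterval`), so cylinders shrink uniformly. One cylinder, of the word `1 0 ⋯ 0 1`, has
only expanding returns (`exists_expanding_cylinder`). For orbits that avoid it, long first returns to
a small cylinder expand as well (`exists_two_le_of_long_return`): such a return is close to a periodic
orbit avoiding a fixed interval, whose multiplier is large because the gap of the orbit around that
interval has disjoint pullbacks. Short returns are controlled by weak expansion and compactness. In
particular parabolic points have bounded period, so that there are finitely many of them.
-/

namespace CircleExpanding

/-! ### Iterates of a lift -/

/-- A lift `H` of a weakly expanding circle map of degree `d`, normalised so that it fixes `0`.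
The last field is the weak expansion along periodic orbits, read on the line: a point `x` projects
to a point of period dividing `s` exactly when `H^[s] x - x` is an integer. -/
structure ExpandingLift (d : ℕ) (H : ℝ → ℝ) : Prop where
  two_le : 2 ≤ d
  map_zero : H 0 = 0
  contDiff : ContDiff ℝ 1 H
  deriv_pos : ∀ x, 0 < deriv H x
  add_one : ∀ x, H (x + 1) = H x + d
  boundedVariation : BoundedVariationOn (deriv H) (Icc 0 1)
  expanding : ∀ s : ℕ, 1 ≤ s → ∀ (x : ℝ) (l : ℤ), H^[s] x = x + l →
    ∀ᶠ y in 𝓝[≠] x, 1 < deriv (H^[s]) y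

/-- The derivative of the `n`-th iterate of `H`. -/
noncomputable def iterDeriv (H : ℝ → ℝ) (n : ℕ) (x : ℝ) : ℝ := deriv (H^[n]) x

/-- The points of the line that project to parabolic periodic points. -/
def Parabolic (H : ℝ → ℝ) (x : ℝ) : Prop :=
  ∃ s : ℕ, 1 ≤ s ∧ ∃ l : ℤ, H^[s] x = x + l ∧ iterDeriv H s x = 1

namespace ExpandingLift

variable {d : ℕ} {H : ℝ → ℝ}

lemma continuous (hH : ExpandingLift d H) : Continuous H := hH.contDiff.continuous

lemma strictMono (hH : ExpandingLift d H) : StrictMono H :=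
  strictMono_of_deriv_pos hH.deriv_pos

lemma add_int (hH : ExpandingLift d H) (x : ℝ) (z : ℤ) : H (x + z) = H x + z * d := by
  induction z using Int.induction_on with
  | zero => simp
  | succ i ih =>
    push_cast at ih ⊢
    rw [← add_assoc, hH.add_one, ih]; ring
  | pred i ih =>
    have := hH.add_one (x + ((-(i : ℤ) - 1 : ℤ) : ℝ))
    push_cast at ih this ⊢
    rw [show x + (-(i : ℝ) - 1) + 1 = x + -(i : ℝ) by ring, ih] at this
    linarith

lemma iterate_add_int (hH : ExpandingLift d H) (n : ℕ) (x : ℝ) (z : ℤ) :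
    H^[n] (x + z) = H^[n] x + ((z * d ^ n : ℤ) : ℝ) := by
  induction n generalizing x z with
  | zero => simp
  | succ n ih =>
    have := ih (H x) (z * d)
    rw [Function.iterate_succ_apply, Function.iterate_succ_apply, hH.add_int]
    push_cast at this ⊢
    rw [this]; ring

lemma iterate_int (hH : ExpandingLift d H) (n : ℕ) (z : ℤ) :
    H^[n] (z : ℝ) = ((z * d ^ n : ℤ) : ℝ) := by
  have := hH.iterate_add_int n 0 z
  rwa [zero_add, Function.iterate_fixed hH.map_zero, zero_add] at this

lemma surjective (hH : ExpandingLift d H) : Function.Surjective H := by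
  have hd : (1 : ℝ) ≤ d := by exact_mod_cast le_trans one_le_two hH.two_le
  have h0 : ∀ z : ℤ, H z = z * d := fun z => by
    have := hH.add_int 0 z
    rwa [zero_add, hH.map_zero, zero_add] at this
  intro y
  have hN : ∃ N : ℕ, |y| ≤ N := exists_nat_ge _
  obtain ⟨N, hN⟩ := hN
  have h1 := h0 N
  have h2 := h0 (-N)
  push_cast at h1 h2
  have hN0 : (0 : ℝ) ≤ N := Nat.cast_nonneg _
  have hy := abs_le.1 hN
  have : y ∈ Icc (H (-N)) (H N) := by
    rw [h1, h2]
    constructor <;> nlinarith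
  obtain ⟨x, -, hx⟩ := intermediate_value_Icc (by linarith) hH.continuous.continuousOn this
  exact ⟨x, hx⟩

lemma contDiff_iterate (hH : ExpandingLift d H) (n : ℕ) : ContDiff ℝ 1 (H^[n]) := by
  induction n with
  | zero => exact contDiff_id
  | succ n ih => exact ih.comp hH.contDiff

lemma continuous_iterate (hH : ExpandingLift d H) (n : ℕ) : Continuous (H^[n]) :=
  hH.continuous.iterate n

lemma strictMono_iterate (hH : ExpandingLift d H) (n : ℕ) : StrictMono (H^[n]) :=
  hH.strictMono.iterate n

lemma exists_iterate_eq (hH : ExpandingLift d H) (n : ℕ) (y : ℝ) : ∃ x, H^[n] x = y :=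
  hH.surjective.iterate n y

lemma hasDerivAt_iterate (hH : ExpandingLift d H) (n : ℕ) (x : ℝ) :
    HasDerivAt (H^[n]) (iterDeriv H n x) x :=
  (((hH.contDiff_iterate n).differentiable one_ne_zero) x).hasDerivAt

@[simp] lemma iterDeriv_zero (x : ℝ) : iterDeriv H 0 x = 1 := by
  simp [iterDeriv]

lemma iterDeriv_one (x : ℝ) : iterDeriv H 1 x = deriv H x := by
  simp [iterDeriv]

lemma iterDeriv_add (hH : ExpandingLift d H) (m n : ℕ) (x : ℝ) :
    iterDeriv H (m + n) x = iterDeriv H m (H^[n] x) * iterDeriv H n x := by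
  have := (hH.hasDerivAt_iterate m (H^[n] x)).comp x (hH.hasDerivAt_iterate n x)
  rw [← Function.iterate_add] at this
  exact this.deriv

lemma iterDeriv_succ (hH : ExpandingLift d H) (n : ℕ) (x : ℝ) :
    iterDeriv H (n + 1) x = deriv H (H^[n] x) * iterDeriv H n x := by
  rw [add_comm n 1, hH.iterDeriv_add, iterDeriv_one]

lemma iterDeriv_eq_prod (hH : ExpandingLift d H) (n : ℕ) (x : ℝ) :
    iterDeriv H n x = ∏ k ∈ Finset.range n, deriv H (H^[k] x) := by
  induction n with
  | zero => simp
  | succ n ih => rw [hH.iterDeriv_succ, ih, Finset.prod_range_succ, mul_comm]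

lemma iterDeriv_pos (hH : ExpandingLift d H) (n : ℕ) (x : ℝ) : 0 < iterDeriv H n x := by
  rw [hH.iterDeriv_eq_prod]
  exact Finset.prod_pos fun k _ => hH.deriv_pos _

/-- Splitting the derivative along an orbit segment at an intermediate time. -/
lemma iterDeriv_split (hH : ExpandingLift d H) {k n : ℕ} (hk : k ≤ n) (x : ℝ) :
    iterDeriv H n x = iterDeriv H (n - k) (H^[k] x) * iterDeriv H k x := by
  conv_lhs => rw [← Nat.sub_add_cancel hk]
  exact hH.iterDeriv_add _ _ _

lemma iterate_split {k n : ℕ} (hk : k ≤ n) (x : ℝ) : H^[n] x = H^[n - k] (H^[k] x) := by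
  rw [← Function.iterate_add_apply, Nat.sub_add_cancel hk]

lemma continuous_iterDeriv (hH : ExpandingLift d H) (n : ℕ) : Continuous (iterDeriv H n) :=
  (hH.contDiff_iterate n).continuous_deriv le_rfl

lemma iterDeriv_add_int (hH : ExpandingLift d H) (n : ℕ) (x : ℝ) (z : ℤ) :
    iterDeriv H n (x + z) = iterDeriv H n x := by
  have : (fun y : ℝ => H^[n] (y + z)) = fun y => H^[n] y + ((z * d ^ n : ℤ) : ℝ) :=
    funext fun y => hH.iterate_add_int n y z
  have h2 : deriv (fun y : ℝ => H^[n] (y + z)) x = deriv (H^[n]) x := by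
    rw [this, deriv_add_const]
  rw [deriv_comp_add_const] at h2
  exact h2

lemma deriv_add_int (hH : ExpandingLift d H) (x : ℝ) (z : ℤ) :
    deriv H (x + z) = deriv H x := by
  simpa [iterDeriv_one] using hH.iterDeriv_add_int 1 x z

lemma exists_iterDeriv_eq_slope (hH : ExpandingLift d H) (n : ℕ) {a b : ℝ} (hab : a < b) :
    ∃ ξ ∈ Ioo a b, H^[n] b - H^[n] a = iterDeriv H n ξ * (b - a) := by
  obtain ⟨ξ, hξ, h⟩ := exists_hasDerivAt_eq_slope (H^[n]) (iterDeriv H n) hab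
    (hH.continuous_iterate n).continuousOn fun x _ => hH.hasDerivAt_iterate n x
  refine ⟨ξ, hξ, ?_⟩
  rw [h, div_mul_cancel₀]
  exact (sub_pos.2 hab).ne'

/-- A positive constant bounding below the derivative of a lift. -/
lemma exists_deriv_ge (hH : ExpandingLift d H) : ∃ m : ℝ, 0 < m ∧ m ≤ 1 ∧ ∀ x, m ≤ deriv H x := by
  obtain ⟨x₀, -, h₀⟩ := isCompact_Icc.exists_isMinOn (nonempty_Icc.2 (zero_le_one (α := ℝ)))
    (hH.contDiff.continuous_deriv le_rfl).continuousOn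
  refine ⟨min (deriv H x₀) 1, lt_min (hH.deriv_pos _) one_pos, min_le_right _ _, fun x => ?_⟩
  refine (min_le_left _ _).trans ?_
  have h1 := hH.deriv_add_int (Int.fract x) ⌊x⌋
  rw [Int.fract_add_floor] at h1
  rw [h1]
  exact h₀ ⟨Int.fract_nonneg _, (Int.fract_lt_one _).le⟩

lemma exists_deriv_le (hH : ExpandingLift d H) : ∃ M : ℝ, 1 ≤ M ∧ ∀ x, deriv H x ≤ M := by
  obtain ⟨x₀, -, h₀⟩ := isCompact_Icc.exists_isMaxOn (nonempty_Icc.2 (zero_le_one (α := ℝ)))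
    (hH.contDiff.continuous_deriv le_rfl).continuousOn
  refine ⟨max (deriv H x₀) 1, le_max_right _ _, fun x => le_trans ?_ (le_max_left _ _)⟩
  have h1 := hH.deriv_add_int (Int.fract x) ⌊x⌋
  rw [Int.fract_add_floor] at h1
  rw [h1]
  exact h₀ ⟨Int.fract_nonneg _, (Int.fract_lt_one _).le⟩

end ExpandingLift

/-! ### Bounded distortion -/

/-- The increments of a monotone function over finitely many non-overlapping subintervals of
`[A, B]` add up to at most its increment over `[A, B]`. -/
lemma sum_sub_le_of_disjoint_Ioo {ι : Type*} [DecidableEq ι] {w : ℝ → ℝ} {A : ℝ} (s : Finset ι)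
    (u v : ι → ℝ) (huv : ∀ i ∈ s, u i ≤ v i) (hA : ∀ i ∈ s, A ≤ u i)
    (hdisj : ∀ i ∈ s, ∀ j ∈ s, i ≠ j → Disjoint (Ioo (u i) (v i)) (Ioo (u j) (v j)))
    (B : ℝ) (hAB : A ≤ B) (hB : ∀ i ∈ s, v i ≤ B) (hw : MonotoneOn w (Icc A B)) :
    ∑ i ∈ s, (w (v i) - w (u i)) ≤ w B - w A := by
  induction s using Finset.induction_on_max_value u generalizing B with
  | empty => simpa using hw (left_mem_Icc.2 hAB) (right_mem_Icc.2 hAB) hAB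
  | insert a s ha hmax ih =>
    have huv' : ∀ i ∈ s, u i ≤ v i := fun i hi => huv i (Finset.mem_insert_of_mem hi)
    have hA' : ∀ i ∈ s, A ≤ u i := fun i hi => hA i (Finset.mem_insert_of_mem hi)
    have hdisj' : ∀ i ∈ s, ∀ j ∈ s, i ≠ j → Disjoint (Ioo (u i) (v i)) (Ioo (u j) (v j)) :=
      fun i hi j hj => hdisj i (Finset.mem_insert_of_mem hi) j (Finset.mem_insert_of_mem hj)
    have hau := huv a (Finset.mem_insert_self _ _)
    have hAa := hA a (Finset.mem_insert_self _ _)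
    have hBa := hB a (Finset.mem_insert_self _ _)
    rw [Finset.sum_insert ha]
    rcases hau.eq_or_lt with heq | hlt
    · rw [heq, sub_self, zero_add]
      exact ih huv' hA' hdisj' B hAB (fun i hi => hB i (Finset.mem_insert_of_mem hi)) hw
    · have h1 : ∀ i ∈ s, v i ≤ u a := by
        intro i hi
        by_contra! hcon
        have hne : i ≠ a := fun h => ha (h ▸ hi)
        have hd := hdisj i (Finset.mem_insert_of_mem hi) a (Finset.mem_insert_self _ _) hne
        obtain ⟨t, ht1, ht2⟩ := exists_between (lt_min hcon hlt)
        exact disjoint_left.1 hd ⟨(hmax i hi).trans_lt ht1, ht2.trans_le (min_le_left _ _)⟩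
          ⟨ht1, ht2.trans_le (min_le_right _ _)⟩
      have h2 := ih huv' hA' hdisj' (u a) hAa h1
        (hw.mono (Icc_subset_Icc le_rfl (hau.trans hBa)))
      have h3 := hw ⟨hAa.trans hau, hBa⟩ (right_mem_Icc.2 hAB) hBa
      linarith

/-- `C` bounds the distortion of `H^[n]` on every interval `[a, b]` of which the images
`H^[k] (a, b)`, `k < n`, are pairwise disjoint modulo `ℤ`. -/
def DistortionBound (H : ℝ → ℝ) (C : ℝ) : Prop :=
  1 ≤ C ∧ ∀ (n : ℕ) (a b : ℝ), a ≤ b →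
    (∀ k < n, H^[k] b ≤ H^[k] a + 1) →
    (∀ i k : ℕ, i < k → k < n → ∀ z : ℤ, Disjoint (Ioo (H^[i] a) (H^[i] b))
      (Ioo (H^[k] a + z) (H^[k] b + z))) →
    ∀ x ∈ Icc a b, ∀ y ∈ Icc a b, iterDeriv H n x ≤ C * iterDeriv H n y

namespace ExpandingLift

variable {d : ℕ} {H : ℝ → ℝ}

lemma boundedVariationOn_log_deriv (hH : ExpandingLift d H) :
    BoundedVariationOn (fun x => Real.log (deriv H x)) (Icc 0 2) := by
  have h2 : BoundedVariationOn (deriv H) (Icc 0 2) := by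
    have h01 : eVariationOn (deriv H) (Icc 1 2) = eVariationOn (deriv H) (Icc 0 1) := by
      have h := eVariationOn.comp_eq_of_monotoneOn (deriv H) (t := Icc 0 1) (fun x : ℝ => x + 1)
        (fun a _ b _ hab => by simpa using hab)
      rw [show (fun x : ℝ => x + 1) '' Icc 0 1 = Icc 1 2 by
        rw [image_add_const_Icc]; norm_num] at h
      rw [← h]
      congr 1
      ext x
      simpa using hH.deriv_add_int x 1
    have h3 := eVariationOn.Icc_add_Icc (deriv H) (s := univ) (zero_le_one (α := ℝ))
      (one_le_two (α := ℝ)) (mem_univ _)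
    simp only [univ_inter] at h3
    rw [BoundedVariationOn, ← h3, h01]
    exact ENNReal.add_ne_top.2 ⟨hH.boundedVariation, hH.boundedVariation⟩
  obtain ⟨m, hm0, -, hm⟩ := hH.exists_deriv_ge
  have hlip : LipschitzOnWith (Real.toNNReal m⁻¹) Real.log (Ici m) := by
    refine Convex.lipschitzOnWith_of_nnnorm_deriv_le (fun x hx => ?_) (fun x hx => ?_)
      (convex_Ici m)
    · exact Real.differentiableAt_log (hm0.trans_le hx).ne'
    · rw [Real.deriv_log, ← NNReal.coe_le_coe, coe_nnnorm, Real.norm_eq_abs,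
        Real.coe_toNNReal _ (inv_nonneg.2 hm0.le), abs_inv, abs_of_pos (hm0.trans_le hx)]
      exact inv_anti₀ hm0 hx
  exact hlip.comp_boundedVariationOn (f := Real.log) (fun x _ => hm x) h2

/-- The Denjoy distortion estimate: since `log H'` has bounded variation on the circle, the iterate
`H^[n]` has uniformly bounded distortion on every interval whose first `n` images do not overlap
modulo `ℤ`. The variation is taken over `[0, 2]`, which contains an integer translate of every
interval of length at most one. -/
theorem exists_distortionBound (hH : ExpandingLift d H) : ∃ C : ℝ, DistortionBound H C := by
  classical
  set φ : ℝ → ℝ := fun x => Real.log (deriv H x) with hφ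
  have hbv := hH.boundedVariationOn_log_deriv
  set w : ℝ → ℝ := variationOnFromTo φ (Icc 0 2) 0 with hw
  have h0 : (0 : ℝ) ∈ Icc (0 : ℝ) 2 := by constructor <;> norm_num
  have hwm : MonotoneOn w (Icc 0 2) :=
    variationOnFromTo.monotoneOn hbv.locallyBoundedVariationOn h0
  have hinc : ∀ u ∈ Icc (0 : ℝ) 2, ∀ v ∈ Icc (0 : ℝ) 2, u ≤ v →
      |φ v - φ u| ≤ w v - w u := by
    intro u hu v hv huv
    have h := variationOnFromTo.edist_zero_of_eq_zero hbv.locallyBoundedVariationOn hu hv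
    have h1 : w v - w u = variationOnFromTo φ (Icc 0 2) u v := by
      have := variationOnFromTo.add hbv.locallyBoundedVariationOn h0 hu hv
      rw [hw]; linarith
    rw [h1, variationOnFromTo.eq_of_le _ _ huv, ← Real.dist_eq, dist_comm, dist_edist]
    exact ENNReal.toReal_mono (hbv.locallyBoundedVariationOn _ _ hu hv)
      (eVariationOn.edist_le φ ⟨hu, le_rfl, huv⟩ ⟨hv, huv, le_rfl⟩)
  have hφper : ∀ (x : ℝ) (z : ℤ), φ (x + z) = φ x := fun x z => by
    simp only [hφ, hH.deriv_add_int]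
  refine ⟨Real.exp (w 2 - w 0), ?_, ?_⟩
  · rw [Real.one_le_exp_iff]
    have := hwm h0 (show (2 : ℝ) ∈ Icc (0 : ℝ) 2 by constructor <;> norm_num) (by norm_num)
    linarith
  intro n a b hab hlen hdisj x hx y hy
  have hmono := fun k => (hH.strictMono_iterate k).monotone
  -- the images of `x` and `y` under the iterates, in increasing order and moved into `[0, 2]`
  set t : ℕ → ℤ := fun k => -⌊H^[k] a⌋ with ht
  set u : ℕ → ℝ := fun k => H^[k] (min x y) + t k with hu
  set v : ℕ → ℝ := fun k => H^[k] (max x y) + t k with hv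
  have hmin : a ≤ min x y := le_min hx.1 hy.1
  have hmax : max x y ≤ b := max_le hx.2 hy.2
  have hu0 : ∀ k, H^[k] a + t k ≤ u k := fun k => by
    have := hmono k hmin
    simp only [hu]; linarith
  have hvb : ∀ k, v k ≤ H^[k] b + t k := fun k => by
    have := hmono k hmax
    simp only [hv]; linarith
  have huv : ∀ k, u k ≤ v k := fun k => by
    have := hmono k (min_le_max (a := x) (b := y))
    simp only [hu, hv]; linarith
  have hA : ∀ k, 0 ≤ u k := fun k => by
    refine le_trans ?_ (hu0 k)
    simp only [ht]; push_cast
    linarith [Int.floor_le (H^[k] a)]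
  have hB : ∀ k < n, v k ≤ 2 := fun k hk => by
    refine (hvb k).trans ?_
    simp only [ht]; push_cast
    linarith [Int.lt_floor_add_one (H^[k] a), hlen k hk]
  have hd : ∀ i < n, ∀ k < n, i < k → Disjoint (Ioo (u i) (v i)) (Ioo (u k) (v k)) := by
    intro i hi k hk hik
    rw [disjoint_left]
    intro p hp hp'
    refine disjoint_left.1 (hdisj i k hik hk (t k - t i))
      (show p - (t i : ℝ) ∈ Ioo (H^[i] a) (H^[i] b) from ⟨?_, ?_⟩) ⟨?_, ?_⟩
    · linarith [hp.1, hu0 i]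
    · linarith [hp.2, hvb i]
    · push_cast
      linarith [hp'.1, hu0 k]
    · push_cast
      linarith [hp'.2, hvb k]
  have hsum : ∑ k ∈ Finset.range n, (w (v k) - w (u k)) ≤ w 2 - w 0 := by
    refine sum_sub_le_of_disjoint_Ioo _ u v (fun i _ => huv i) (fun i _ => hA i) ?_ 2 (by norm_num)
      (fun i hi => hB i (Finset.mem_range.1 hi)) hwm
    intro i hi j hj hij
    rw [Finset.mem_range] at hi hj
    rcases hij.lt_or_gt with h | h
    · exact hd i hi j hj h
    · exact (hd j hj i hi h).symm
  have hle : ∀ k ∈ Finset.range n, φ (H^[k] x) - φ (H^[k] y) ≤ w (v k) - w (u k) := by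
    intro k hk
    have hk := Finset.mem_range.1 hk
    have h := hinc (u k) ⟨hA k, (huv k).trans (hB k hk)⟩ (v k) ⟨(hA k).trans (huv k), hB k hk⟩
      (huv k)
    simp only [hu, hv, hφper] at h
    simp only [hu, hv]
    rcases le_total x y with hxy | hxy
    · rw [min_eq_left hxy, max_eq_right hxy] at h ⊢
      exact le_trans (by rw [abs_sub_comm]; exact le_abs_self _) h
    · rw [min_eq_right hxy, max_eq_left hxy] at h ⊢
      exact (le_abs_self _).trans h
  have hlog : ∀ p, Real.log (iterDeriv H n p) = ∑ k ∈ Finset.range n, φ (H^[k] p) := by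
    intro p
    rw [hH.iterDeriv_eq_prod, Real.log_prod fun k _ => (hH.deriv_pos _).ne']
  have hfin : Real.log (iterDeriv H n x) ≤ w 2 - w 0 + Real.log (iterDeriv H n y) := by
    have := (Finset.sum_le_sum hle).trans hsum
    rw [Finset.sum_sub_distrib, ← hlog, ← hlog] at this
    linarith
  rw [← Real.exp_log (hH.iterDeriv_pos n x), ← Real.exp_log (hH.iterDeriv_pos n y), ← Real.exp_add]
  exact Real.exp_le_exp.2 hfin

end ExpandingLift

/-! ### Periodic points -/

namespace ExpandingLift

variable {d : ℕ} {H : ℝ → ℝ}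

lemma sub_le_mul_of_iterDeriv_le (hH : ExpandingLift d H) (n : ℕ) {u v S : ℝ} (huv : u ≤ v)
    (hS : ∀ t ∈ Icc u v, iterDeriv H n t ≤ S) : H^[n] v - H^[n] u ≤ S * (v - u) := by
  rcases huv.eq_or_lt with rfl | h
  · simp
  · obtain ⟨ξ, hξ, he⟩ := hH.exists_iterDeriv_eq_slope n h
    rw [he]
    exact mul_le_mul_of_nonneg_right (hS ξ (Ioo_subset_Icc_self hξ)) (sub_nonneg.2 huv)

lemma mul_le_sub_of_le_iterDeriv (hH : ExpandingLift d H) (n : ℕ) {u v S : ℝ} (huv : u ≤ v)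
    (hS : ∀ t ∈ Icc u v, S ≤ iterDeriv H n t) : S * (v - u) ≤ H^[n] v - H^[n] u := by
  rcases huv.eq_or_lt with rfl | h
  · simp
  · obtain ⟨ξ, hξ, he⟩ := hH.exists_iterDeriv_eq_slope n h
    rw [he]
    exact mul_le_mul_of_nonneg_right (hS ξ (Ioo_subset_Icc_self hξ)) (sub_nonneg.2 huv)

lemma one_le_iterDeriv_of_periodic (hH : ExpandingLift d H) {n : ℕ} (hn : 1 ≤ n) {x : ℝ} {l : ℤ}
    (hx : H^[n] x = x + l) : 1 ≤ iterDeriv H n x := by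
  have h := (hH.continuous_iterDeriv n).continuousAt (x := x)
  refine ge_of_tendsto (h.tendsto.mono_left (nhdsWithin_le_nhds (s := {x}ᶜ))) ?_
  filter_upwards [hH.expanding n hn x l hx] with y hy using hy.le

/-- Around a periodic point, points of a punctured neighbourhood are pushed away from it. -/
lemma exists_pushed_away (hH : ExpandingLift d H) {n : ℕ} (hn : 1 ≤ n) {x : ℝ} {l : ℤ}
    (hx : H^[n] x = x + l) : ∃ δ > 0, (∀ y, x < y → y < x + δ → y + l < H^[n] y) ∧
      ∀ y, y < x → x - δ < y → H^[n] y < y + l := by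
  have h := hH.expanding n hn x l hx
  rw [eventually_nhdsWithin_iff, Metric.eventually_nhds_iff] at h
  obtain ⟨δ, hδ, h⟩ := h
  refine ⟨δ, hδ, fun y hxy hy => ?_, fun y hxy hy => ?_⟩
  · obtain ⟨ξ, hξ, he⟩ := hH.exists_iterDeriv_eq_slope n hxy
    have h1 : 1 < iterDeriv H n ξ := by
      refine h ?_ (show ξ ≠ x from hξ.1.ne')
      rw [Real.dist_eq, abs_lt]
      constructor <;> linarith [hξ.1, hξ.2]
    nlinarith
  · obtain ⟨ξ, hξ, he⟩ := hH.exists_iterDeriv_eq_slope n hxy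
    have h1 : 1 < iterDeriv H n ξ := by
      refine h ?_ (show ξ ≠ x from hξ.2.ne)
      rw [Real.dist_eq, abs_lt]
      constructor <;> linarith [hξ.1, hξ.2]
    nlinarith

/-- Two neighbouring solutions of `H^[n] x = x + l` cannot both be repelling, so there is at most
one solution. -/
lemma eq_of_iterate_eq_add (hH : ExpandingLift d H) {n : ℕ} (hn : 1 ≤ n) {x y : ℝ} {l : ℤ}
    (hx : H^[n] x = x + l) (hy : H^[n] y = y + l) : x = y := by
  wlog hxy : x < y generalizing x y
  · rcases (not_lt.1 hxy).eq_or_lt with h | h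
    · exact h.symm
    · exact (this hy hx h).symm
  exfalso
  have hc : Continuous fun t : ℝ => H^[n] t - t := (hH.continuous_iterate n).sub continuous_id
  obtain ⟨δ, hδ, h1, -⟩ := hH.exists_pushed_away hn hx
  have hyδ : x + δ ≤ y := by
    by_contra! hcon
    have := h1 y hxy hcon
    rw [hy] at this
    exact lt_irrefl _ this
  set Z : Set ℝ := Icc (x + δ) y ∩ {t | H^[n] t - t = l} with hZ
  have hZc : IsCompact Z := isCompact_Icc.inter_right (isClosed_eq hc continuous_const)
  obtain ⟨s, hs, hmin⟩ := hZc.exists_isLeast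
    ⟨y, ⟨hyδ, le_rfl⟩, show H^[n] y - y = l by rw [hy]; ring⟩
  have hsx : H^[n] s = s + l := by
    have : H^[n] s - s = l := hs.2
    linarith
  obtain ⟨η, hη, -, h2⟩ := hH.exists_pushed_away hn hsx
  -- just right of `x` the displacement exceeds `l`, just left of `s` it is smaller than `l`
  have hxs : x < s := by linarith [hs.1.1]
  obtain ⟨p, hp1, hp2⟩ := exists_between (max_lt (show s - η < s by linarith) hxs)
  have hp3 := h2 p hp2 ((le_max_left _ _).trans_lt hp1)
  have hxp : x < p := (le_max_right _ _).trans_lt hp1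
  obtain ⟨q, hq1, hq2⟩ := exists_between (lt_min hxp (show x < x + δ by linarith))
  have hq3 := h1 q hq1 (hq2.trans_le (min_le_right _ _))
  have hqp : q < p := hq2.trans_le (min_le_left _ _)
  obtain ⟨t, ht, htl⟩ := intermediate_value_Icc' hqp.le hc.continuousOn
    (show (l : ℝ) ∈ Icc (H^[n] p - p) (H^[n] q - q) by constructor <;> linarith)
  have htl : H^[n] t - t = l := htl
  have htδ : x + δ ≤ t := by
    by_contra! hcon
    have := h1 t (hq1.trans_le ht.1) hcon
    linarith
  have := hmin (show t ∈ Z from ⟨⟨htδ, by linarith [ht.2, hs.1.2]⟩, htl⟩)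
  linarith [ht.2]

lemma finite_periodic (hH : ExpandingLift d H) {n : ℕ} (hn : 1 ≤ n) :
    {x ∈ Ico (0 : ℝ) 1 | ∃ l : ℤ, H^[n] x = x + l}.Finite := by
  have : {x ∈ Ico (0 : ℝ) 1 | ∃ l : ℤ, H^[n] x = x + l} ⊆
      ⋃ l ∈ Icc (-1 : ℤ) (d ^ n), {x : ℝ | H^[n] x = x + l} := by
    rintro x ⟨⟨h0, h1⟩, l, hl⟩
    have ha := (hH.strictMono_iterate n).monotone h0
    have hb := hH.strictMono_iterate n h1
    have h00 := hH.iterate_int n 0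
    have h11 := hH.iterate_int n 1
    push_cast at h00 h11
    simp only [zero_mul] at h00
    rw [one_mul] at h11
    rw [h00] at ha
    rw [h11] at hb
    simp only [mem_iUnion]
    refine ⟨l, ⟨?_, ?_⟩, hl⟩
    · have : (-1 : ℝ) < l := by linarith
      have : (-1 : ℤ) < l := by exact_mod_cast this
      exact this.le
    · have : (l : ℝ) < d ^ n := by linarith
      have : l < (d : ℤ) ^ n := by exact_mod_cast this
      exact this.le
  refine Set.Finite.subset ((finite_Icc _ _).biUnion fun l _ => ?_) this
  exact Set.Subsingleton.finite fun x hx y hy => hH.eq_of_iterate_eq_add hn hx hy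

end ExpandingLift

/-! ### Cylinders -/

/-- The points `x` and `y` lie in the same cylinder of level `n`, that is, in the same interval
`[a, b)` bounded by consecutive preimages of integers under `H^[n]`. -/
def SameCyl (H : ℝ → ℝ) (n : ℕ) (x y : ℝ) : Prop := ⌊H^[n] x⌋ = ⌊H^[n] y⌋

/-- The points `x` and `y` lie in the same cylinder of level `n` modulo `ℤ`. -/
def SameCylMod (d : ℕ) (H : ℝ → ℝ) (n : ℕ) (x y : ℝ) : Prop :=
  ⌊H^[n] x⌋ ≡ ⌊H^[n] y⌋ [ZMOD (d : ℤ) ^ n]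

/-- The left endpoint of the cylinder of level `n` that contains `x`. -/
noncomputable def cylLo (H : ℝ → ℝ) (n : ℕ) (x : ℝ) : ℝ := Function.invFun (H^[n]) ⌊H^[n] x⌋

/-- The right endpoint of the cylinder of level `n` that contains `x`. -/
noncomputable def cylHi (H : ℝ → ℝ) (n : ℕ) (x : ℝ) : ℝ :=
  Function.invFun (H^[n]) (⌊H^[n] x⌋ + 1)

/-- The length of the cylinder of level `n` that contains `x`. -/
noncomputable def cylLen (H : ℝ → ℝ) (n : ℕ) (x : ℝ) : ℝ := cylHi H n x - cylLo H n x

namespace ExpandingLift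

variable {d : ℕ} {H : ℝ → ℝ}

lemma d_pos (hH : ExpandingLift d H) : (0 : ℤ) < d := by
  have := hH.two_le; omega

lemma iterate_cylLo (hH : ExpandingLift d H) (n : ℕ) (x : ℝ) :
    H^[n] (cylLo H n x) = ⌊H^[n] x⌋ :=
  Function.invFun_eq (hH.exists_iterate_eq n _)

lemma iterate_cylHi (hH : ExpandingLift d H) (n : ℕ) (x : ℝ) :
    H^[n] (cylHi H n x) = ⌊H^[n] x⌋ + 1 :=
  Function.invFun_eq (hH.exists_iterate_eq n _)

lemma sameCyl_iff (hH : ExpandingLift d H) {n : ℕ} {x y : ℝ} :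
    SameCyl H n y x ↔ y ∈ Ico (cylLo H n x) (cylHi H n x) := by
  rw [SameCyl, Int.floor_eq_iff, mem_Ico, ← hH.iterate_cylHi, ← hH.iterate_cylLo,
    (hH.strictMono_iterate n).le_iff_le, (hH.strictMono_iterate n).lt_iff_lt]

lemma cylLo_le (hH : ExpandingLift d H) (n : ℕ) (x : ℝ) : cylLo H n x ≤ x :=
  (hH.sameCyl_iff.1 (rfl : SameCyl H n x x)).1

lemma lt_cylHi (hH : ExpandingLift d H) (n : ℕ) (x : ℝ) : x < cylHi H n x :=
  (hH.sameCyl_iff.1 (rfl : SameCyl H n x x)).2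

lemma cylLen_pos (hH : ExpandingLift d H) (n : ℕ) (x : ℝ) : 0 < cylLen H n x :=
  sub_pos.2 ((hH.cylLo_le n x).trans_lt (hH.lt_cylHi n x))

lemma floor_iterate_add_int (hH : ExpandingLift d H) (n : ℕ) (x : ℝ) (z : ℤ) :
    ⌊H^[n] (x + z)⌋ = ⌊H^[n] x⌋ + z * d ^ n := by
  rw [hH.iterate_add_int, Int.floor_add_intCast]

/-- Integers behave under `H` as under multiplication by `d`, so that the cylinder of a lower level
is read off by integer division. -/
lemma floor_eq_floor_iterate_div (hH : ExpandingLift d H) (k : ℕ) (y : ℝ) :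
    ⌊y⌋ = ⌊H^[k] y⌋ / (d : ℤ) ^ k := by
  have hdk : (0 : ℤ) < (d : ℤ) ^ k := pow_pos hH.d_pos k
  have h1 := (hH.strictMono_iterate k).monotone (Int.floor_le y)
  have h2 := hH.strictMono_iterate k (Int.lt_floor_add_one y)
  have h3 := hH.iterate_int k (⌊y⌋ + 1)
  push_cast at h3
  rw [h3] at h2
  rw [hH.iterate_int] at h1
  symm
  rw [Int.ediv_eq_iff_of_pos hdk]
  constructor
  · rw [Int.le_floor]; push_cast at h1 ⊢; linarith
  · rw [Int.floor_lt]; push_cast; linarith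

lemma floor_iterate_eq_div (hH : ExpandingLift d H) {m n : ℕ} (hmn : m ≤ n) (x : ℝ) :
    ⌊H^[m] x⌋ = ⌊H^[n] x⌋ / (d : ℤ) ^ (n - m) := by
  rw [hH.floor_eq_floor_iterate_div (n - m) (H^[m] x), ← Function.iterate_add_apply,
    Nat.sub_add_cancel hmn]

lemma _root_.CircleExpanding.SameCyl.of_le (hH : ExpandingLift d H) {m n : ℕ} (hmn : m ≤ n)
    {x y : ℝ} (h : SameCyl H n x y) : SameCyl H m x y := by
  rw [SameCyl, hH.floor_iterate_eq_div hmn, hH.floor_iterate_eq_div hmn, h]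

lemma sameCyl_iterate {k n : ℕ} {x y : ℝ} :
    SameCyl H n (H^[k] x) (H^[k] y) ↔ SameCyl H (n + k) x y := by
  rw [SameCyl, SameCyl, Function.iterate_add_apply, Function.iterate_add_apply]

lemma sameCyl_add_int (hH : ExpandingLift d H) {n : ℕ} {x y : ℝ} (z : ℤ) :
    SameCyl H n (x + z) (y + z) ↔ SameCyl H n x y := by
  simp only [SameCyl, hH.floor_iterate_add_int, add_left_inj]

lemma cylLo_add_int (hH : ExpandingLift d H) (n : ℕ) (x : ℝ) (z : ℤ) :
    cylLo H n (x + z) = cylLo H n x + z := by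
  apply (hH.strictMono_iterate n).injective
  rw [hH.iterate_cylLo, hH.floor_iterate_add_int, hH.iterate_add_int, hH.iterate_cylLo]
  push_cast; ring

lemma cylHi_add_int (hH : ExpandingLift d H) (n : ℕ) (x : ℝ) (z : ℤ) :
    cylHi H n (x + z) = cylHi H n x + z := by
  apply (hH.strictMono_iterate n).injective
  rw [hH.iterate_cylHi, hH.floor_iterate_add_int, hH.iterate_add_int, hH.iterate_cylHi]
  push_cast; ring

lemma cylLen_add_int (hH : ExpandingLift d H) (n : ℕ) (x : ℝ) (z : ℤ) :
    cylLen H n (x + z) = cylLen H n x := by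
  rw [cylLen, cylLen, hH.cylLo_add_int, hH.cylHi_add_int]; ring

lemma _root_.CircleExpanding.SameCyl.cylLen_eq {n : ℕ} {x y : ℝ} (h : SameCyl H n x y) :
    cylLen H n x = cylLen H n y := by
  rw [SameCyl] at h
  simp only [cylLen, cylLo, cylHi, h]

lemma _root_.CircleExpanding.SameCylMod.refl (d : ℕ) (H : ℝ → ℝ) (n : ℕ) (x : ℝ) :
    SameCylMod d H n x x := Int.ModEq.refl _

lemma _root_.CircleExpanding.SameCylMod.symm {n : ℕ} {x y : ℝ} (h : SameCylMod d H n x y) :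
    SameCylMod d H n y x := Int.ModEq.symm h

lemma _root_.CircleExpanding.SameCylMod.trans {n : ℕ} {x y z : ℝ} (h : SameCylMod d H n x y)
    (h' : SameCylMod d H n y z) : SameCylMod d H n x z := Int.ModEq.trans h h'

lemma _root_.CircleExpanding.SameCyl.mod {n : ℕ} {x y : ℝ} (h : SameCyl H n x y) :
    SameCylMod d H n x y := by
  rw [SameCylMod, show ⌊H^[n] x⌋ = ⌊H^[n] y⌋ from h]

lemma sameCylMod_iff (hH : ExpandingLift d H) {n : ℕ} {x y : ℝ} :
    SameCylMod d H n x y ↔ ∃ z : ℤ, SameCyl H n x (y + z) := by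
  rw [SameCylMod, Int.modEq_comm, Int.modEq_iff_dvd]
  constructor
  · rintro ⟨z, hz⟩
    refine ⟨z, ?_⟩
    rw [SameCyl, hH.floor_iterate_add_int]
    linarith
  · rintro ⟨z, hz⟩
    rw [SameCyl, hH.floor_iterate_add_int] at hz
    exact ⟨z, by linarith⟩

lemma _root_.CircleExpanding.SameCylMod.of_le (hH : ExpandingLift d H) {m n : ℕ} (hmn : m ≤ n)
    {x y : ℝ} (h : SameCylMod d H n x y) : SameCylMod d H m x y := by
  obtain ⟨z, hz⟩ := hH.sameCylMod_iff.1 h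
  exact hH.sameCylMod_iff.2 ⟨z, hz.of_le hH hmn⟩

lemma _root_.CircleExpanding.SameCylMod.cylLen_eq (hH : ExpandingLift d H) {n : ℕ} {x y : ℝ}
    (h : SameCylMod d H n x y) : cylLen H n x = cylLen H n y := by
  obtain ⟨z, hz⟩ := hH.sameCylMod_iff.1 h
  rw [hz.cylLen_eq, hH.cylLen_add_int]

lemma cylLo_mono (hH : ExpandingLift d H) {m n : ℕ} (hmn : m ≤ n) (x : ℝ) :
    cylLo H m x ≤ cylLo H n x := by
  have h : SameCyl H n (cylLo H n x) x :=
    hH.sameCyl_iff.2 ⟨le_rfl, (hH.cylLo_le n x).trans_lt (hH.lt_cylHi n x)⟩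
  exact (hH.sameCyl_iff.1 (h.of_le hH hmn)).1

lemma cylHi_anti (hH : ExpandingLift d H) {m n : ℕ} (hmn : m ≤ n) (x : ℝ) :
    cylHi H n x ≤ cylHi H m x := by
  by_contra! hcon
  have h : SameCyl H n (cylHi H m x) x :=
    hH.sameCyl_iff.2 ⟨(hH.cylLo_le n x).trans (hH.lt_cylHi m x).le, hcon⟩
  exact lt_irrefl _ (hH.sameCyl_iff.1 (h.of_le hH hmn)).2

lemma cylLen_anti (hH : ExpandingLift d H) {m n : ℕ} (hmn : m ≤ n) (x : ℝ) :
    cylLen H n x ≤ cylLen H m x :=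
  sub_le_sub (hH.cylHi_anti hmn x) (hH.cylLo_mono hmn x)

lemma iterate_cylLo_add (hH : ExpandingLift d H) (n L : ℕ) (x : ℝ) :
    H^[n] (cylLo H (n + L) x) = cylLo H L (H^[n] x) := by
  apply (hH.strictMono_iterate L).injective
  rw [hH.iterate_cylLo, ← Function.iterate_add_apply, add_comm L n, hH.iterate_cylLo, add_comm n L,
    Function.iterate_add_apply]

lemma iterate_cylHi_add (hH : ExpandingLift d H) (n L : ℕ) (x : ℝ) :
    H^[n] (cylHi H (n + L) x) = cylHi H L (H^[n] x) := by
  apply (hH.strictMono_iterate L).injective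
  rw [hH.iterate_cylHi, ← Function.iterate_add_apply, add_comm L n, hH.iterate_cylHi, add_comm n L,
    Function.iterate_add_apply]

/-- An interval that some iterate maps into a unit interval was itself no longer than one. -/
lemma le_add_one_of_iterate (hH : ExpandingLift d H) (n : ℕ) {a b : ℝ}
    (h : H^[n] b ≤ H^[n] a + 1) : b ≤ a + 1 := by
  rw [← (hH.strictMono_iterate n).le_iff_le]
  refine h.trans ?_
  have := hH.iterate_add_int n a 1
  push_cast at this
  rw [this, one_mul]
  have hd : (1 : ℝ) ≤ d := by exact_mod_cast le_trans one_le_two hH.two_le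
  linarith [one_le_pow₀ hd (n := n)]

/-- If the orbit of `x` visits the cylinder of level `L` of `H^[n] x` at no time strictly between
`0` and `n`, then the pullbacks of that cylinder along the orbit are pairwise disjoint modulo `ℤ`,
so `H^[n]` has bounded distortion on the cylinder of level `n + L` of `x`. -/
lemma distortion_of_first_visit (hH : ExpandingLift d H) {C : ℝ} (hC : DistortionBound H C)
    (n L : ℕ) (x : ℝ) (hfirst : ∀ t, 0 < t → t < n → ¬ SameCylMod d H L (H^[t] x) (H^[n] x)) :
    ∀ y ∈ Icc (cylLo H (n + L) x) (cylHi H (n + L) x),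
      ∀ y' ∈ Icc (cylLo H (n + L) x) (cylHi H (n + L) x),
        iterDeriv H n y ≤ C * iterDeriv H n y' := by
  have hlo := hH.iterate_cylLo (n + L) x
  have hhi := hH.iterate_cylHi (n + L) x
  set a := cylLo H (n + L) x
  set b := cylHi H (n + L) x
  set j := ⌊H^[n + L] x⌋ with hj
  have hab : a ≤ b := by
    rw [← (hH.strictMono_iterate (n + L)).le_iff_le, hlo, hhi]; linarith
  have hfl : ∀ k ≤ n, ∀ u ∈ Ioo (H^[k] a) (H^[k] b), ⌊H^[n + L - k] u⌋ = j := by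
    intro k hk u hu
    have h1 := hH.strictMono_iterate (n + L - k) hu.1
    have h2 := hH.strictMono_iterate (n + L - k) hu.2
    rw [← Function.iterate_add_apply, Nat.sub_add_cancel (by omega)] at h1 h2
    rw [hlo] at h1
    rw [hhi] at h2
    exact Int.floor_eq_iff.2 ⟨h1.le, h2⟩
  refine hC.2 n a b hab (fun k hk => ?_) ?_
  · apply hH.le_add_one_of_iterate (n + L - k)
    rw [← Function.iterate_add_apply, ← Function.iterate_add_apply, Nat.sub_add_cancel (by omega),
      hlo, hhi]
  · intro i k hik hk z
    rw [disjoint_left]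
    intro u hu hu'
    have h1 := hfl i (by omega) u hu
    have h2 := hfl k hk.le (u - z) ⟨by linarith [hu'.1], by linarith [hu'.2]⟩
    have h3 := hH.floor_iterate_add_int (n + L - k) (u - z) z
    rw [sub_add_cancel, h2] at h3
    have h4 := hH.floor_iterate_eq_div (m := n + L - k) (n := n + L - i) (by omega) u
    rw [h3, h1] at h4
    -- the visit at time `n - k + i` contradicts the hypothesis
    refine hfirst (n - k + i) (by omega) (by omega) ?_
    rw [SameCylMod, ← Function.iterate_add_apply, ← Function.iterate_add_apply,
      hH.floor_iterate_eq_div (m := L + (n - k + i)) (n := n + L) (by omega), ← hj,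
      show n + L - (L + (n - k + i)) = n + L - i - (n + L - k) by omega, ← h4, add_comm L n, ← hj,
      show n + L - k = (n - k) + L by omega, pow_add, ← mul_assoc]
    exact (Int.modEq_iff_dvd.2 ⟨-(z * d ^ (n - k)), by ring⟩)

lemma cylLen_le_of_first_visit (hH : ExpandingLift d H) {C : ℝ} (hC : DistortionBound H C)
    (n L : ℕ) (x : ℝ) (hfirst : ∀ t, 0 < t → t < n → ¬ SameCylMod d H L (H^[t] x) (H^[n] x))
    {y : ℝ} (hy : y ∈ Icc (cylLo H (n + L) x) (cylHi H (n + L) x)) :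
    cylLen H L (H^[n] x) ≤ C * iterDeriv H n y * cylLen H (n + L) x := by
  rw [cylLen, ← hH.iterate_cylHi_add, ← hH.iterate_cylLo_add, cylLen]
  exact hH.sub_le_mul_of_iterDeriv_le n ((hH.cylLo_le _ x).trans (hH.lt_cylHi _ x).le)
    fun t ht => hH.distortion_of_first_visit hC n L x hfirst t ht y hy

end ExpandingLift

/-! ### Absence of wandering intervals -/

namespace ExpandingLift

variable {d : ℕ} {H : ℝ → ℝ}

/-- The pigeonhole principle for cylinders: some cylinder of level `M` is visited twice, first at a
time `i` and for the second time at a time `k`. -/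
lemma exists_first_return (hH : ExpandingLift d H) (M : ℕ) (a : ℝ) :
    ∃ i k : ℕ, i < k ∧ SameCylMod d H M (H^[i] a) (H^[k] a) ∧
      (∀ t, t < i → ¬ SameCylMod d H M (H^[t] a) (H^[i] a)) ∧
      ∀ t, i < t → t < k → ¬ SameCylMod d H M (H^[t] a) (H^[k] a) := by
  classical
  have hex : ∃ k, ∃ i < k, SameCylMod d H M (H^[i] a) (H^[k] a) := by
    have : NeZero (d ^ M) := ⟨pow_ne_zero _ (by have := hH.two_le; omega)⟩
    obtain ⟨i, k, hne, he⟩ := Finite.exists_ne_map_eq_of_infinite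
      fun k : ℕ => ((⌊H^[M] (H^[k] a)⌋ : ℤ) : ZMod (d ^ M))
    have he' := (ZMod.intCast_eq_intCast_iff _ _ _).1 he
    push_cast at he'
    rcases hne.lt_or_gt with h | h
    · exact ⟨k, i, h, he'⟩
    · exact ⟨i, k, h, he'.symm⟩
  obtain ⟨i, hik, hi⟩ := Nat.find_spec hex
  have hmin : ∀ t s, t < s → s < Nat.find hex → ¬ SameCylMod d H M (H^[t] a) (H^[s] a) :=
    fun t s hts hs h => Nat.find_min hex hs ⟨t, hts, h⟩
  exact ⟨i, Nat.find hex, hik, hi, fun t ht => hmin t i ht hik,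
    fun t ht htk h => hmin i t ht htk (hi.trans h.symm)⟩

/-- An interval `(A, B)` on which all cylinder codes agree with those of `a`, and which is maximal
with this property, has images that are pairwise disjoint modulo `ℤ`: otherwise its image under some
iterate is periodic, and then both of its endpoints solve `H^[s] x = x + l`. -/
lemma disjoint_of_sameCyl (hH : ExpandingLift d H) {a A B : ℝ} (hAB : A < B)
    (hsub : ∀ y ∈ Ioo A B, ∀ n, SameCyl H n y a) (hmax : ∀ y, (∀ n, SameCyl H n y a) → y ∈ Icc A B)
    {i k : ℕ} (hik : i < k) (z : ℤ) :
    Disjoint (Ioo (H^[i] A) (H^[i] B)) (Ioo (H^[k] A + z) (H^[k] B + z)) := by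
  rw [disjoint_left]
  intro u hu hu'
  have hpre : ∀ (m : ℕ) (p : ℝ), p ∈ Ioo (H^[m] A) (H^[m] B) → ∃ v ∈ Ioo A B, H^[m] v = p := by
    intro m p hp
    obtain ⟨v, rfl⟩ := hH.exists_iterate_eq m p
    exact ⟨v, ⟨(hH.strictMono_iterate m).lt_iff_lt.1 hp.1,
      (hH.strictMono_iterate m).lt_iff_lt.1 hp.2⟩, rfl⟩
  obtain ⟨v, hv, rfl⟩ := hpre i u hu
  obtain ⟨v', hv', hvv⟩ := hpre k (H^[i] v - z) ⟨by linarith [hu'.1], by linarith [hu'.2]⟩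
  have key : ∀ n, SameCyl H n (H^[i] a) (H^[k] a + z) := by
    intro n
    have h1 : SameCyl H n (H^[i] v) (H^[i] a) := sameCyl_iterate.2 (hsub v hv _)
    have h2 : SameCyl H n (H^[k] v' + z) (H^[k] a + z) :=
      (hH.sameCyl_add_int z).2 (sameCyl_iterate.2 (hsub v' hv' _))
    rw [show H^[k] v' + z = H^[i] v by rw [hvv]; ring] at h2
    exact h1.symm.trans h2
  -- each of the two image intervals is contained in the closure of the other
  have hcont : ∀ y ∈ Ioo A B, H^[k] y + z ∈ Icc (H^[i] A) (H^[i] B) := by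
    intro y hy
    obtain ⟨y', hy'⟩ := hH.exists_iterate_eq i (H^[k] y + z)
    have : y' ∈ Icc A B := by
      refine hmax y' fun n => ?_
      have h1 : SameCyl H n (H^[i] y') (H^[i] a) := by
        rw [hy']
        exact ((hH.sameCyl_add_int z).2 (sameCyl_iterate.2 (hsub y hy _))).trans (key n).symm
      exact (sameCyl_iterate.1 h1).of_le hH (Nat.le_add_right n i)
    rw [← hy']
    exact ⟨(hH.strictMono_iterate i).monotone this.1, (hH.strictMono_iterate i).monotone this.2⟩
  have hcont' : ∀ y ∈ Ioo A B, H^[i] y - z ∈ Icc (H^[k] A) (H^[k] B) := by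
    intro y hy
    obtain ⟨y', hy'⟩ := hH.exists_iterate_eq k (H^[i] y - z)
    have : y' ∈ Icc A B := by
      refine hmax y' fun n => ?_
      have h1 : SameCyl H n (H^[k] y') (H^[k] a) := by
        rw [hy']
        have h2 : SameCyl H n (H^[i] y) (H^[k] a + z) :=
          (sameCyl_iterate.2 (hsub y hy _)).trans (key n)
        rw [← hH.sameCyl_add_int z]
        rwa [sub_add_cancel]
      exact (sameCyl_iterate.1 h1).of_le hH (Nat.le_add_right n k)
    rw [← hy']
    exact ⟨(hH.strictMono_iterate k).monotone this.1, (hH.strictMono_iterate k).monotone this.2⟩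
  have hclos : closure (Ioo A B) = Icc A B := closure_Ioo hAB.ne
  have hcl : ∀ y ∈ Icc A B, H^[k] y + z ∈ Icc (H^[i] A) (H^[i] B) := by
    have hc : IsClosed {y : ℝ | H^[k] y + z ∈ Icc (H^[i] A) (H^[i] B)} :=
      isClosed_Icc.preimage ((hH.continuous_iterate k).add continuous_const)
    rw [← hclos]
    exact fun y hy => closure_minimal hcont hc hy
  have hcl' : ∀ y ∈ Icc A B, H^[i] y - z ∈ Icc (H^[k] A) (H^[k] B) := by
    have hc : IsClosed {y : ℝ | H^[i] y - z ∈ Icc (H^[k] A) (H^[k] B)} :=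
      isClosed_Icc.preimage ((hH.continuous_iterate i).sub continuous_const)
    rw [← hclos]
    exact fun y hy => closure_minimal hcont' hc hy
  have hA : H^[k] A + z = H^[i] A := by
    have h1 := (hcl A ⟨le_rfl, hAB.le⟩).1
    have h2 := (hcl' A ⟨le_rfl, hAB.le⟩).1
    linarith
  have hB : H^[k] B + z = H^[i] B := by
    have h1 := (hcl B ⟨hAB.le, le_rfl⟩).2
    have h2 := (hcl' B ⟨hAB.le, le_rfl⟩).2
    linarith
  have hper : ∀ y, H^[k] y + z = H^[i] y →
      H^[k - i] (H^[i] y) = H^[i] y + ((-z : ℤ) : ℝ) := by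
    intro y hy
    rw [← iterate_split hik.le, ← hy]
    push_cast; ring
  have := hH.eq_of_iterate_eq_add (by omega) (hper A hA) (hper B hB)
  exact hAB.ne ((hH.strictMono_iterate i).injective this)

/-- If `H^[n]` has distortion at most `K` on the cylinder of level `n + M` around a homterval
`(A, B)`, and the image of that cylinder is at least twice as long as the image of `(A, B)`, then
the cylinder exceeds `(A, B)` by a definite proportion. -/
lemma sub_le_of_two_mul_le (hH : ExpandingLift d H) {a A B K : ℝ} {n M : ℕ} (hAB : A < B)
    (hlo : cylLo H (n + M) a ≤ A) (hhi : B ≤ cylHi H (n + M) a)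
    (hdist : ∀ y ∈ Icc (cylLo H (n + M) a) (cylHi H (n + M) a),
      ∀ y' ∈ Icc (cylLo H (n + M) a) (cylHi H (n + M) a), iterDeriv H n y ≤ K * iterDeriv H n y')
    (h2 : 2 * (H^[n] B - H^[n] A) ≤ cylLen H M (H^[n] a)) :
    B - A ≤ K * (cylLen H (n + M) a - (B - A)) := by
  obtain ⟨ξ, hξ, he⟩ := hH.exists_iterDeriv_eq_slope n hAB
  have hξ' : ξ ∈ Icc (cylLo H (n + M) a) (cylHi H (n + M) a) :=
    ⟨hlo.trans hξ.1.le, hξ.2.le.trans hhi⟩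
  have h3 := hH.sub_le_mul_of_iterDeriv_le n (S := K * iterDeriv H n ξ) hlo fun t ht =>
    hdist t ⟨ht.1, ht.2.trans (hAB.le.trans hhi)⟩ ξ hξ'
  have h4 := hH.sub_le_mul_of_iterDeriv_le n (S := K * iterDeriv H n ξ) hhi fun t ht =>
    hdist t ⟨hlo.trans (hAB.le.trans ht.1), ht.2⟩ ξ hξ'
  rw [hH.iterate_cylLo_add] at h3
  rw [hH.iterate_cylHi_add] at h4
  rw [cylLen] at h2 ⊢
  have h5 : iterDeriv H n ξ * (B - A) ≤
      iterDeriv H n ξ * (K * (cylHi H (n + M) a - cylLo H (n + M) a - (B - A))) := by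
    nlinarith
  exact le_of_mul_le_mul_left h5 (hH.iterDeriv_pos n ξ)

/-- There are no homtervals, that is, nondegenerate intervals that lie in a single cylinder of every
level: the cylinders around a point shrink to it. The Denjoy argument compares
the first two visits of a homterval to a cylinder; the shorter one of the two visiting images fills
at most half of the cylinder, and bounded distortion carries this over to the original homterval,
uniformly in the level of the cylinder. -/
lemma not_exists_homterval (hH : ExpandingLift d H) {a A B : ℝ} (hAB : A < B)
    (hlo : Tendsto (fun n => cylLo H n a) atTop (𝓝 A))
    (hhi : Tendsto (fun n => cylHi H n a) atTop (𝓝 B)) : False := by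
  have hloA : ∀ n, cylLo H n a ≤ A := fun n =>
    Monotone.ge_of_tendsto (fun m n hmn => hH.cylLo_mono hmn a) hlo n
  have hhiB : ∀ n, B ≤ cylHi H n a := fun n =>
    Antitone.le_of_tendsto (fun m n hmn => hH.cylHi_anti hmn a) hhi n
  have hsub : ∀ y ∈ Ioo A B, ∀ n, SameCyl H n y a := fun y hy n =>
    hH.sameCyl_iff.2 ⟨(hloA n).trans hy.1.le, hy.2.trans_le (hhiB n)⟩
  have hmax : ∀ y, (∀ n, SameCyl H n y a) → y ∈ Icc A B := fun y hy =>
    ⟨le_of_tendsto' hlo fun n => (hH.sameCyl_iff.1 (hy n)).1,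
      ge_of_tendsto' hhi fun n => (hH.sameCyl_iff.1 (hy n)).2.le⟩
  obtain ⟨C, hC⟩ := hH.exists_distortionBound
  have hC1 := hC.1
  have key : ∀ M, B - A ≤ C * C * (cylLen H M a - (B - A)) := by
    intro M
    obtain ⟨i, k, hik, hcyl, hfi, hfk⟩ := hH.exists_first_return M a
    obtain ⟨z, hz⟩ := hH.sameCylMod_iff.1 hcyl
    have hdisj := hH.disjoint_of_sameCyl hAB hsub hmax hik z
    have himg : ∀ n, cylLo H M (H^[n] a) ≤ H^[n] A ∧ H^[n] B ≤ cylHi H M (H^[n] a) := by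
      intro n
      rw [← hH.iterate_cylLo_add, ← hH.iterate_cylHi_add]
      exact ⟨(hH.strictMono_iterate n).monotone (hloA _),
        (hH.strictMono_iterate n).monotone (hhiB _)⟩
    have hlt : ∀ n, H^[n] A < H^[n] B := fun n => hH.strictMono_iterate n hAB
    have hd1 : ∀ y ∈ Icc (cylLo H (i + M) a) (cylHi H (i + M) a),
        ∀ y' ∈ Icc (cylLo H (i + M) a) (cylHi H (i + M) a),
          iterDeriv H i y ≤ C * iterDeriv H i y' :=
      hH.distortion_of_first_visit hC i M a fun t _ ht => hfi t ht
    -- both images lie in the same cylinder and do not overlap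
    have hsum : (H^[i] B - H^[i] A) + (H^[k] B - H^[k] A) ≤ cylLen H M (H^[i] a) := by
      have h1 := himg i
      have h2 := himg k
      have hlo' : cylLo H M (H^[i] a) = cylLo H M (H^[k] a) + z := by
        rw [← hH.cylLo_add_int, cylLo, cylLo, show ⌊H^[M] (H^[i] a)⌋ = _ from hz]
      have hhi' : cylHi H M (H^[i] a) = cylHi H M (H^[k] a) + z := by
        rw [← hH.cylHi_add_int, cylHi, cylHi, show ⌊H^[M] (H^[i] a)⌋ = _ from hz]
      rw [cylLen]
      rcases le_or_gt (H^[i] B) (H^[k] A + z) with h | h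
      · linarith
      · rcases le_or_gt (H^[k] B + z) (H^[i] A) with h' | h'
        · linarith
        · exfalso
          obtain ⟨p, hp1, hp2⟩ := exists_between
            (show max (H^[i] A) (H^[k] A + z) < min (H^[i] B) (H^[k] B + z) from
              max_lt (lt_min (hlt i) h') (lt_min h (by linarith [hlt k])))
          exact disjoint_left.1 hdisj
            ⟨(le_max_left _ _).trans_lt hp1, hp2.trans_le (min_le_left _ _)⟩
            ⟨(le_max_right _ _).trans_lt hp1, hp2.trans_le (min_le_right _ _)⟩
    have hmono : ∀ T, 0 ≤ cylLen H M a - cylLen H (T + M) a := fun T =>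
      sub_nonneg.2 (hH.cylLen_anti (Nat.le_add_left M T) a)
    have hnn : ∀ n, 0 ≤ cylLen H n a - (B - A) := fun n => by
      rw [cylLen]; linarith [hloA n, hhiB n]
    rcases le_total (H^[k] B - H^[k] A) (H^[i] B - H^[i] A) with hle | hle
    · have h := hH.sub_le_of_two_mul_le (K := C * C) (n := k) (M := M) hAB (hloA _) (hhiB _) ?_ ?_
      · nlinarith [hmono k]
      · -- the distortion of `H^[k]` is composed from the two visits
        have hd2 := hH.distortion_of_first_visit hC (k - i) M (H^[i] a) fun t ht htk => by
          rw [← Function.iterate_add_apply, ← iterate_split hik.le]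
          exact hfk (t + i) (by omega) (by omega)
        have hin : ∀ y ∈ Icc (cylLo H (k + M) a) (cylHi H (k + M) a),
            y ∈ Icc (cylLo H (i + M) a) (cylHi H (i + M) a) ∧
            H^[i] y ∈ Icc (cylLo H (k - i + M) (H^[i] a)) (cylHi H (k - i + M) (H^[i] a)) := by
          intro y hy
          refine ⟨⟨(hH.cylLo_mono (by omega) a).trans hy.1,
            hy.2.trans (hH.cylHi_anti (by omega) a)⟩, ?_⟩
          rw [← hH.iterate_cylLo_add, ← hH.iterate_cylHi_add, show i + (k - i + M) = k + M by omega]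
          exact ⟨(hH.strictMono_iterate i).monotone hy.1, (hH.strictMono_iterate i).monotone hy.2⟩
        intro y hy y' hy'
        rw [hH.iterDeriv_split hik.le, hH.iterDeriv_split hik.le y']
        have e1 := hd2 _ (hin y hy).2 _ (hin y' hy').2
        have e2 := hd1 _ (hin y hy).1 _ (hin y' hy').1
        calc _ ≤ (C * iterDeriv H (k - i) (H^[i] y')) * (C * iterDeriv H i y') :=
              mul_le_mul e1 e2 (hH.iterDeriv_pos _ _).le
                (mul_nonneg (by linarith) (hH.iterDeriv_pos _ _).le)
          _ = _ := by ring
      · rw [← hcyl.cylLen_eq hH]; linarith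
    · have h := hH.sub_le_of_two_mul_le (K := C) (n := i) (M := M) hAB (hloA _) (hhiB _) hd1
        (by linarith)
      have h' : C * (cylLen H (i + M) a - (B - A)) ≤ C * C * (cylLen H M a - (B - A)) :=
        mul_le_mul (by nlinarith) (by linarith [hmono i]) (hnn _) (by nlinarith)
      linarith
  have hlim : Tendsto (fun M => C * C * (cylLen H M a - (B - A))) atTop (𝓝 (C * C * 0)) := by
    refine Tendsto.const_mul _ ?_
    have := (hhi.sub hlo).sub_const (B - A)
    rwa [sub_self] at this
  rw [mul_zero] at hlim
  have := ge_of_tendsto' hlim key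
  linarith

/-- Cylinders shrink uniformly. If they did not, a limit of long cylinders would be a homterval. -/
lemma exists_cylLen_le (hH : ExpandingLift d H) {ε : ℝ} (hε : 0 < ε) :
    ∃ n₀, ∀ n ≥ n₀, ∀ x, cylLen H n x ≤ ε := by
  by_contra! hcon
  have hlong : ∀ n, ∃ x, ε < cylLen H n x := fun n => by
    obtain ⟨m, hm, x, hx⟩ := hcon n
    exact ⟨x, hx.trans_le (hH.cylLen_anti hm x)⟩
  choose x hx using hlong
  set m : ℕ → ℝ := fun n => (cylLo H n (x n) + cylHi H n (x n)) / 2 with hm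
  obtain ⟨a, -, φ, hφ, hlim⟩ := isCompact_Icc.tendsto_subseq
    (fun n => (⟨Int.fract_nonneg (m n), (Int.fract_lt_one (m n)).le⟩ :
      Int.fract (m n) ∈ Icc (0 : ℝ) 1))
  have hcyl : ∀ n, ∀ y ∈ Ioo (a - ε / 4) (a + ε / 4), SameCyl H n y a := by
    intro n y hy
    have hev := (Metric.tendsto_atTop.1 hlim) (ε / 4) (by linarith)
    obtain ⟨N, hN⟩ := hev
    set k := φ (max N n)
    have hk : n ≤ k := (le_max_right N n).trans (hφ.id_le _)
    have hd := hN (max N n) (le_max_left _ _)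
    rw [Real.dist_eq, abs_lt] at hd
    have hd : -(ε / 4) < Int.fract (m k) - a ∧ Int.fract (m k) - a < ε / 4 := hd
    have hmem : ∀ p ∈ Ioo (a - ε / 4) (a + ε / 4), SameCyl H k (p + ⌊m k⌋) (x k) := by
      intro p hp
      have hxk := hx k
      rw [cylLen] at hxk
      have hmk : m k = (cylLo H k (x k) + cylHi H k (x k)) / 2 := rfl
      have hf := Int.fract_add_floor (m k)
      rw [hH.sameCyl_iff]
      constructor
      · linarith [hp.1, hd.2]
      · linarith [hp.2, hd.1]
    have := (hmem y hy).trans (hmem a ⟨by linarith, by linarith⟩).symm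
    exact ((hH.sameCyl_add_int _).1 this).of_le hH hk
  have hbd : ∀ n, cylLo H n a ≤ a - ε / 8 ∧ a + ε / 8 ≤ cylHi H n a := fun n =>
    ⟨(hH.sameCyl_iff.1 (hcyl n (a - ε / 8) ⟨by linarith, by linarith⟩)).1,
      (hH.sameCyl_iff.1 (hcyl n (a + ε / 8) ⟨by linarith, by linarith⟩)).2.le⟩
  have hlo := tendsto_atTop_ciSup (f := fun n => cylLo H n a)
    (fun m n hmn => hH.cylLo_mono hmn a) ⟨a - ε / 8, by rintro _ ⟨n, rfl⟩; exact (hbd n).1⟩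
  have hhi := tendsto_atTop_ciInf (f := fun n => cylHi H n a)
    (fun m n hmn => hH.cylHi_anti hmn a) ⟨a + ε / 8, by rintro _ ⟨n, rfl⟩; exact (hbd n).2⟩
  refine hH.not_exists_homterval ?_ hlo hhi
  have h1 := le_of_tendsto' hlo fun n => (hbd n).1
  have h2 := ge_of_tendsto' hhi fun n => (hbd n).2
  linarith

/-- Preimages of unit intervals under iterates of high order are uniformly small. -/
lemma exists_sub_le (hH : ExpandingLift d H) {ε : ℝ} (hε : 0 < ε) :
    ∃ n₀, ∀ n ≥ n₀, ∀ a b : ℝ, H^[n] b ≤ H^[n] a + 1 → b - a ≤ ε := by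
  obtain ⟨n₀, hn₀⟩ := hH.exists_cylLen_le (half_pos hε)
  refine ⟨n₀, fun n hn a b hab => ?_⟩
  -- `[a, b]` is covered by the cylinder of `a` and the next one to its right
  have h1 := hn₀ n hn a
  have h2 := hn₀ n hn (cylHi H n a)
  have hmid := hH.iterate_cylHi n a
  have hfl : ⌊H^[n] (cylHi H n a)⌋ = ⌊H^[n] a⌋ + 1 := by
    rw [hmid]; exact_mod_cast Int.floor_intCast _
  have h3 : cylLo H n (cylHi H n a) = cylHi H n a := by
    apply (hH.strictMono_iterate n).injective
    rw [hH.iterate_cylLo, hfl, hmid]; push_cast; rfl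
  have h4 : b ≤ cylHi H n (cylHi H n a) := by
    rw [← (hH.strictMono_iterate n).le_iff_le, hH.iterate_cylHi, hfl]
    push_cast
    linarith [Int.lt_floor_add_one (H^[n] a)]
  rw [cylLen] at h1 h2
  linarith [hH.cylLo_le n a]

end ExpandingLift

/-! ### Expansion of returns -/

namespace ExpandingLift

variable {d : ℕ} {H : ℝ → ℝ}

/-- If first returns to a set expand by a factor `μ ≥ 1`, then so do all returns. -/
lemma le_iterDeriv_of_first_return (hH : ExpandingLift d H) {P Q : ℝ → Prop} {μ : ℝ} (hμ : 1 ≤ μ)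
    (hfirst : ∀ (n : ℕ) (x : ℝ), 1 ≤ n → P x → P (H^[n] x) →
      (∀ t, 0 < t → t < n → ¬ P (H^[t] x)) → (∀ t ≤ n, Q (H^[t] x)) → μ ≤ iterDeriv H n x)
    (n : ℕ) (x : ℝ) (hn : 1 ≤ n) (hx : P x) (hnx : P (H^[n] x)) (hQ : ∀ t ≤ n, Q (H^[t] x)) :
    μ ≤ iterDeriv H n x := by
  induction n using Nat.strong_induction_on generalizing x with
  | _ n ih =>
    by_cases hex : ∃ t, 0 < t ∧ t < n ∧ P (H^[t] x)
    · obtain ⟨t, ht0, htn, ht⟩ := hex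
      rw [hH.iterDeriv_split htn.le]
      have h1 := ih t htn x ht0 hx ht fun s hs => hQ s (hs.trans htn.le)
      have h2 := ih (n - t) (by omega) (H^[t] x) (by omega) ht
        (by rwa [← iterate_split htn.le]) fun s hs => by
          rw [← Function.iterate_add_apply]
          exact hQ _ (by omega)
      nlinarith
    · push Not at hex
      exact hfirst n x hn hx hnx hex hQ

/-- There is a cylinder all of whose returns expand by a factor of at least two. In terms of base
`d` expansions it is the cylinder of the word `1 0 ⋯ 0 1`, with `r - 1` zeros: its first visit to
the cylinder `U₀` of the word `1` takes place at time `r`, with bounded distortion, and for large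
`r` this makes every pullback of length at least `r` small relative to it. -/
lemma exists_expanding_cylinder (hH : ExpandingLift d H) : ∃ (L : ℕ) (u : ℝ), ∀ (n : ℕ) (x : ℝ),
    1 ≤ n → SameCylMod d H L x u → SameCylMod d H L (H^[n] x) u → 2 ≤ iterDeriv H n x := by
  obtain ⟨C, hC⟩ := hH.exists_distortionBound
  have hC0 : 0 < C := zero_lt_one.trans_le hC.1
  obtain ⟨g, hg⟩ := hH.exists_iterate_eq 1 1
  have hg1 : ⌊H^[1] g⌋ = 1 := by rw [hg]; exact Int.floor_one
  have hc0 := hH.cylLen_pos 1 g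
  set c₀ := cylLen H 1 g with hc₀
  obtain ⟨n₀, hn₀⟩ := hH.exists_cylLen_le (ε := c₀ / (2 * C ^ 3)) (by positivity)
  set r := max n₀ 1 with hr
  have hr0 : n₀ ≤ r := le_max_left _ _
  have hr1 : 1 ≤ r := le_max_right _ _
  obtain ⟨u, hu⟩ := hH.exists_iterate_eq (r + 1) ((d ^ r + 1 : ℤ) : ℝ)
  have hu' : ⌊H^[r + 1] u⌋ = d ^ r + 1 := by rw [hu]; exact Int.floor_intCast _
  have hdpos := hH.d_pos
  have hd2 : (2 : ℤ) ≤ d := by exact_mod_cast hH.two_le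
  -- the digits of the points of the cylinder at the times `0`, `0 < k < r` and `r`
  have hdig : ∀ x, SameCylMod d H (r + 1) x u → ∀ k < r,
      ∃ z : ℤ, ⌊H^[1] (H^[k] x)⌋ = d ^ k + z * d ^ (k + 1) := by
    intro x hx k hk
    obtain ⟨z, hz⟩ := hH.sameCylMod_iff.1 hx
    rw [SameCyl, hH.floor_iterate_add_int, hu'] at hz
    refine ⟨z, ?_⟩
    rw [← Function.iterate_add_apply, hH.floor_iterate_eq_div (n := r + 1) (by omega), hz,
      Int.ediv_eq_iff_of_pos (pow_pos hdpos _)]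
    have e1 : (d : ℤ) ^ r = d ^ k * d ^ (r + 1 - (1 + k)) := by rw [← pow_add]; congr 1; omega
    have e2 : (d : ℤ) ^ (r + 1) = d ^ (k + 1) * d ^ (r + 1 - (1 + k)) := by
      rw [← pow_add]; congr 1; omega
    have e3 : (2 : ℤ) ≤ d ^ (r + 1 - (1 + k)) :=
      hd2.trans (le_self_pow₀ (by omega) (by omega))
    rw [e1, e2]
    constructor <;> nlinarith
  have hdig0 : ∀ x, SameCylMod d H (r + 1) x u → SameCylMod d H 1 x g := by
    intro x hx
    obtain ⟨z, hz⟩ := hdig x hx 0 (by omega)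
    rw [SameCylMod, hg1, show ⌊H^[1] x⌋ = _ from hz]
    exact (Int.modEq_iff_dvd.2 ⟨-z, by ring⟩)
  have hdigk : ∀ x, SameCylMod d H (r + 1) x u → ∀ k, 0 < k → k < r →
      ¬ SameCylMod d H 1 (H^[k] x) g := by
    intro x hx k hk0 hk h
    obtain ⟨z, hz⟩ := hdig x hx k hk
    rw [SameCylMod, hg1, hz, pow_one, Int.modEq_iff_dvd] at h
    have h1 : (d : ℤ) ∣ d ^ k + z * d ^ (k + 1) :=
      dvd_add (dvd_pow_self _ (by omega)) (Dvd.dvd.mul_left (dvd_pow_self _ (by omega)) _)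
    have := Int.le_of_dvd one_pos (by simpa using dvd_add h h1)
    omega
  have hdigr : ∀ x, SameCylMod d H (r + 1) x u → SameCylMod d H 1 (H^[r] x) g := by
    intro x hx
    obtain ⟨z, hz⟩ := hH.sameCylMod_iff.1 hx
    rw [SameCyl, hH.floor_iterate_add_int, hu'] at hz
    rw [SameCylMod, hg1, ← Function.iterate_add_apply, add_comm 1 r, hz]
    refine (Int.modEq_iff_dvd.2 ⟨-(d ^ (r - 1) + z * d ^ r), ?_⟩)
    obtain ⟨s, hs⟩ : ∃ s, r = s + 1 := ⟨r - 1, by omega⟩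
    rw [hs, Nat.add_sub_cancel]
    ring
  refine ⟨r + 1, u, fun n x hn hx hnx => ?_⟩
  refine hH.le_iterDeriv_of_first_return (P := fun x => SameCylMod d H (r + 1) x u)
    (Q := fun _ => True) one_le_two ?_ n x hn hx hnx fun _ _ => trivial
  intro n x hn hx hnx hfirst _
  have hrn : r ≤ n := by
    by_contra! hcon
    exact hdigk x hx n (by omega) hcon (hdig0 _ hnx)
  have h1 := hH.cylLen_le_of_first_visit hC n (r + 1) x
    (fun t ht htn h => hfirst t ht htn (h.trans hnx))
    ⟨hH.cylLo_le _ x, (hH.lt_cylHi _ x).le⟩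
  rw [(hnx.trans hx.symm).cylLen_eq hH] at h1
  have hfr : ∀ t, 0 < t → t < r → ¬ SameCylMod d H 1 (H^[t] x) (H^[r] x) :=
    fun t ht htr h => hdigk x hx t ht htr (h.trans (hdigr x hx))
  have h2 := hH.cylLen_le_of_first_visit hC r 1 x hfr
    ⟨hH.cylLo_le _ x, (hH.lt_cylHi _ x).le⟩
  rw [(hdigr x hx).cylLen_eq hH, ← hc₀] at h2
  -- compare the lengths of the pullback and of its image under `H^[r]`
  have h3 : iterDeriv H r x * cylLen H (n + (r + 1)) x ≤ C * cylLen H (n + 1) (H^[r] x) := by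
    have h := hH.mul_le_sub_of_le_iterDeriv r (S := iterDeriv H r x / C)
      ((hH.cylLo_le (r + (n + 1)) x).trans (hH.lt_cylHi _ x).le) fun t ht => by
        rw [div_le_iff₀ hC0, mul_comm]
        exact hH.distortion_of_first_visit hC r 1 x hfr x
            ⟨hH.cylLo_le _ x, (hH.lt_cylHi _ x).le⟩ t
            ⟨(hH.cylLo_mono (show r + 1 ≤ r + (n + 1) by omega) x).trans ht.1,
            ht.2.trans (hH.cylHi_anti (show r + 1 ≤ r + (n + 1) by omega) x)⟩
    rw [hH.iterate_cylLo_add, hH.iterate_cylHi_add, div_mul_eq_mul_div, div_le_iff₀ hC0] at h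
    rw [show n + (r + 1) = r + (n + 1) by omega]
    rw [cylLen, cylLen]
    linarith
  have h4 := hn₀ (n + 1) (by omega) (H^[r] x)
  rw [le_div_iff₀ (by positivity)] at h4
  have hS := hH.iterDeriv_pos r x
  have hDn := hH.iterDeriv_pos n x
  have h5 : c₀ ≤ C ^ 3 * iterDeriv H n x * cylLen H (n + 1) (H^[r] x) := by
    calc c₀ ≤ C * iterDeriv H r x * cylLen H (r + 1) x := h2
      _ ≤ C * iterDeriv H r x * (C * iterDeriv H n x * cylLen H (n + (r + 1)) x) :=
          mul_le_mul_of_nonneg_left h1 (by positivity)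
      _ = C ^ 2 * iterDeriv H n x * (iterDeriv H r x * cylLen H (n + (r + 1)) x) := by ring
      _ ≤ C ^ 2 * iterDeriv H n x * (C * cylLen H (n + 1) (H^[r] x)) :=
          mul_le_mul_of_nonneg_left h3 (by positivity)
      _ = _ := by ring
  by_contra! hcon
  have h6 := hH.cylLen_pos (n + 1) (H^[r] x)
  have : C ^ 3 * iterDeriv H n x * cylLen H (n + 1) (H^[r] x) <
      C ^ 3 * 2 * cylLen H (n + 1) (H^[r] x) := by gcongr
  nlinarith

/-! ### Periodic orbits -/

lemma iterate_mul_eq_add (hH : ExpandingLift d H) {n : ℕ} {q : ℝ} {l : ℤ} (hq : H^[n] q = q + l)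
    (j : ℕ) : ∃ z : ℤ, H^[n * j] q = q + z := by
  induction j with
  | zero => exact ⟨0, by simp⟩
  | succ j ih =>
    obtain ⟨z, hz⟩ := ih
    refine ⟨z + l * d ^ (n * j), ?_⟩
    rw [Nat.mul_succ, Function.iterate_add_apply, hq, hH.iterate_add_int, hz]
    push_cast; ring

lemma iterate_eq_iterate_mod_add (hH : ExpandingLift d H) {n : ℕ} {q : ℝ} {l : ℤ}
    (hq : H^[n] q = q + l) (k : ℕ) : ∃ z : ℤ, H^[k] q = H^[k % n] q + z := by
  obtain ⟨z, hz⟩ := hH.iterate_mul_eq_add hq (k / n)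
  refine ⟨z * d ^ (k % n), ?_⟩
  conv_lhs => rw [← Nat.mod_add_div k n]
  rw [Function.iterate_add_apply, hz, hH.iterate_add_int]

/-- The multiplier of a periodic orbit does not depend on the point of the orbit. -/
lemma iterDeriv_iterate_of_periodic (hH : ExpandingLift d H) {n : ℕ} {q : ℝ} {l : ℤ}
    (hq : H^[n] q = q + l) (k : ℕ) : iterDeriv H n (H^[k] q) = iterDeriv H n q := by
  have h1 := hH.iterDeriv_add n k q
  rw [add_comm, hH.iterDeriv_add, hq, hH.iterDeriv_add_int, mul_comm] at h1
  exact (mul_right_cancel₀ (hH.iterDeriv_pos k q).ne' h1).symm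

lemma iterDeriv_mul_of_periodic (hH : ExpandingLift d H) {n : ℕ} {q : ℝ} {l : ℤ}
    (hq : H^[n] q = q + l) (j : ℕ) : iterDeriv H (n * j) q = iterDeriv H n q ^ j := by
  induction j with
  | zero => simp
  | succ j ih =>
    rw [Nat.mul_succ, hH.iterDeriv_add, hq, hH.iterDeriv_add_int, ih, pow_succ]

lemma iterate_periodic_of_periodic (hH : ExpandingLift d H) {n : ℕ} {q : ℝ} {l : ℤ}
    (hq : H^[n] q = q + l) (k : ℕ) (z : ℤ) :
    ∃ l' : ℤ, H^[n] (H^[k] q + z) = (H^[k] q + z) + l' := by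
  refine ⟨l * d ^ k + z * d ^ n - z, ?_⟩
  rw [hH.iterate_add_int, ← Function.iterate_add_apply, add_comm n k, Function.iterate_add_apply,
    hq, hH.iterate_add_int]
  push_cast; ring

/-- The multiplier of a periodic point `q` of exact period `n` whose orbit avoids the interval
`(u₁, u₂)` modulo `ℤ` is bounded below by `(u₂ - u₁) / (C ε)`, where `ε` bounds the lengths of the
preimages of unit intervals under `H^[n]`. Indeed the pullbacks along the orbit of the gap of the
orbit that contains `(u₁, u₂)` have distinct points of the orbit as their left endpoints and contain
no point of the orbit, so they are disjoint. -/
lemma sub_le_mul_iterDeriv_of_periodic (hH : ExpandingLift d H) {C : ℝ} (hC : DistortionBound H C)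
    {n : ℕ} (hn : 1 ≤ n) {q : ℝ} {l : ℤ} (hq : H^[n] q = q + l)
    (hmin : ∀ k, 0 < k → k < n → ∀ z : ℤ, H^[k] q ≠ q + z) {u₁ u₂ ε : ℝ}
    (havoid : ∀ k < n, ∀ z : ℤ, H^[k] q + z ∉ Ioo u₁ u₂)
    (hε : ∀ a b : ℝ, H^[n] b ≤ H^[n] a + 1 → b - a ≤ ε) :
    u₂ - u₁ ≤ C * iterDeriv H n q * ε := by
  set f : ℕ → ℝ := fun k => H^[k] q + (⌊u₁ - H^[k] q⌋ : ℤ) with hf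
  have hne : (Finset.range n).Nonempty := ⟨0, Finset.mem_range.2 hn⟩
  obtain ⟨k₀, hk₀, hmax⟩ := Finset.exists_max_image (Finset.range n) f hne
  obtain ⟨k₁, hk₁, hmin1⟩ := Finset.exists_min_image (Finset.range n) f hne
  rw [Finset.mem_range] at hk₀ hk₁
  have hfle : ∀ k, f k ≤ u₁ := fun k => by
    have := Int.floor_le (u₁ - H^[k] q)
    simp only [hf]; linarith
  have hflt : ∀ k, u₁ < f k + 1 := fun k => by
    have := Int.lt_floor_add_one (u₁ - H^[k] q)
    simp only [hf]; linarith
  -- the endpoints of the gap containing `(u₁, u₂)`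
  set a := f k₀ with ha
  set b := f k₁ + 1 with hb
  have hau : a ≤ u₁ := hfle k₀
  have hbu : u₂ ≤ b := by
    by_contra! hcon
    refine havoid k₁ hk₁ (⌊u₁ - H^[k₁] q⌋ + 1) ⟨?_, ?_⟩
    · have := hflt k₁
      simp only [hf] at this
      push_cast; linarith
    · have : f k₁ + 1 < u₂ := hcon
      simp only [hf] at this
      push_cast; linarith
  have hba : b ≤ a + 1 := by linarith [hmin1 k₀ (Finset.mem_range.2 hk₀)]
  have hab : a < b := hau.trans_lt (hflt k₁)
  have hgap' : ∀ k < n, ∀ z : ℤ, H^[k] q + z ∉ Ioo a b := by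
    intro k hk z hz
    rcases le_or_gt z ⌊u₁ - H^[k] q⌋ with h | h
    · have h1 : (z : ℝ) ≤ (⌊u₁ - H^[k] q⌋ : ℤ) := by exact_mod_cast h
      have h2 := hmax k (Finset.mem_range.2 hk)
      simp only [hf] at h2
      linarith [hz.1]
    · have h1 : ((⌊u₁ - H^[k] q⌋ : ℤ) : ℝ) + 1 ≤ z := by exact_mod_cast h
      have h2 := hmin1 k (Finset.mem_range.2 hk)
      have h3 : f k = H^[k] q + (⌊u₁ - H^[k] q⌋ : ℤ) := rfl
      linarith [hz.2]
  have hgap : ∀ (k : ℕ) (z : ℤ), H^[k] q + z ∉ Ioo a b := by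
    intro k z
    obtain ⟨z', hz'⟩ := hH.iterate_eq_iterate_mod_add hq k
    rw [hz', add_assoc, ← Int.cast_add]
    exact hgap' _ (Nat.mod_lt _ hn) _
  obtain ⟨l', hl'⟩ : ∃ l' : ℤ, H^[n] a = a + l' :=
    hH.iterate_periodic_of_periodic hq k₀ ⌊u₁ - H^[k₀] q⌋
  have haeq : a = H^[k₀] q + (⌊u₁ - H^[k₀] q⌋ : ℤ) := rfl
  have hia : ∀ i : ℕ, ∃ z : ℤ, H^[i] a = H^[i + k₀] q + z := fun i =>
    ⟨_, by rw [haeq, hH.iterate_add_int, ← Function.iterate_add_apply]⟩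
  have hdist : ∀ i k : ℕ, i < k → k < n → ∀ z : ℤ, H^[i] a ≠ H^[k] a + z := by
    intro i k hik hk z h
    obtain ⟨z₁, h₁⟩ := hia i
    obtain ⟨z₂, h₂⟩ := hia k
    -- move both points forward to a time divisible by `n`
    have h3 : H^[i + k₀] q = H^[k + k₀] q + ((z₂ + z - z₁ : ℤ) : ℝ) := by
      push_cast; linarith
    obtain ⟨j, hj⟩ : ∃ j, i + k₀ + j = n * 2 := ⟨n * 2 - (i + k₀), by omega⟩
    have h4 : H^[j] (H^[i + k₀] q) =
        H^[j] (H^[k + k₀] q) + (((z₂ + z - z₁) * d ^ j : ℤ) : ℝ) := by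
      rw [h3, hH.iterate_add_int]
    obtain ⟨m, hm⟩ := hH.iterate_mul_eq_add hq 2
    rw [← Function.iterate_add_apply, ← Function.iterate_add_apply,
      show j + (i + k₀) = n * 2 by omega, show j + (k + k₀) = (k - i) + n * 2 by omega,
      Function.iterate_add_apply H (k - i), hm, hH.iterate_add_int] at h4
    refine hmin (k - i) (by omega) (by omega)
      (m - m * d ^ (k - i) - (z₂ + z - z₁) * d ^ j) ?_
    push_cast at h4 ⊢
    linarith
  obtain ⟨b₀, hb₀⟩ := hH.exists_iterate_eq n (b + l')
  have hab₀ : a < b₀ := by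
    rw [← (hH.strictMono_iterate n).lt_iff_lt, hb₀, hl']; linarith
  have hlen : H^[n] b₀ ≤ H^[n] a + 1 := by rw [hb₀, hl']; linarith
  have hno : ∀ i < n, ∀ (k : ℕ) (z : ℤ), H^[k] q + z ∉ Ioo (H^[i] a) (H^[i] b₀) := by
    intro i hi k z hz
    have h1 := hH.strictMono_iterate (n - i) hz.1
    have h2 := hH.strictMono_iterate (n - i) hz.2
    rw [← iterate_split hi.le, hl', hH.iterate_add_int, ← Function.iterate_add_apply] at h1
    rw [← iterate_split hi.le, hb₀, hH.iterate_add_int, ← Function.iterate_add_apply] at h2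
    refine hgap (n - i + k) (z * d ^ (n - i) - l') ⟨?_, ?_⟩ <;> push_cast at h1 h2 ⊢ <;> linarith
  have hDL := hC.2 n a b₀ hab₀.le
    (fun k hk => hH.le_add_one_of_iterate (n - k) (by
      rwa [← iterate_split hk.le, ← iterate_split hk.le])) (by
    intro i k hik hk z
    rw [disjoint_left]
    intro p hp hp'
    obtain ⟨z₁, h₁⟩ := hia i
    obtain ⟨z₂, h₂⟩ := hia k
    rcases lt_trichotomy (H^[i] a) (H^[k] a + z) with h | h | h
    · refine hno i (by omega) (k + k₀) (z₂ + z) ?_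
      have : H^[k + k₀] q + ((z₂ + z : ℤ) : ℝ) = H^[k] a + z := by push_cast; linarith
      rw [this]
      exact ⟨h, hp'.1.trans hp.2⟩
    · exact hdist i k hik hk z h
    · refine hno k hk (i + k₀) (z₁ - z) ?_
      have : H^[i + k₀] q + ((z₁ - z : ℤ) : ℝ) = H^[i] a - z := by push_cast; linarith
      rw [this]
      exact ⟨by linarith, by linarith [hp.1, hp'.2]⟩)
  have h1 := hH.sub_le_mul_of_iterDeriv_le n hab₀.le fun t ht => hDL t ht a ⟨le_rfl, hab₀.le⟩
  have h2 : iterDeriv H n a = iterDeriv H n q := by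
    rw [haeq, hH.iterDeriv_add_int, hH.iterDeriv_iterate_of_periodic hq]
  rw [hb₀, hl', h2] at h1
  have h3 := hε a b₀ hlen
  have hC0 : 0 < C := zero_lt_one.trans_le hC.1
  have hD := hH.iterDeriv_pos n q
  calc u₂ - u₁ ≤ C * iterDeriv H n q * (b₀ - a) := by linarith
    _ ≤ _ := mul_le_mul_of_nonneg_left h3 (by positivity)

/-- A first return of `x` to its cylinder of level `L` that avoids a fixed cylinder `U` and takes a
long time expands by a factor of at least two: the return branch has a periodic point in its
closure, whose orbit avoids the interior of `U`. -/
lemma exists_two_le_of_long_return (hH : ExpandingLift d H) (M : ℕ) (u : ℝ) :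
    ∃ n₁ : ℕ, 1 ≤ n₁ ∧ (∀ (n : ℕ) (q : ℝ) (l : ℤ), n₁ ≤ n → H^[n] q = q + l →
      (∀ k, 0 < k → k < n → ∀ z : ℤ, H^[k] q ≠ q + z) →
      (∀ k < n, ¬ SameCylMod d H M (H^[k] q) u) → 2 ≤ iterDeriv H n q) ∧
    ∀ L ≥ M, ∀ n ≥ n₁, ∀ x : ℝ, (∀ t ≤ n, ¬ SameCylMod d H M (H^[t] x) u) →
      SameCylMod d H L (H^[n] x) x →
      (∀ t, 0 < t → t < n → ¬ SameCylMod d H L (H^[t] x) (H^[n] x)) → 2 ≤ iterDeriv H n x := by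
  obtain ⟨C, hC⟩ := hH.exists_distortionBound
  have hC0 : 0 < C := zero_lt_one.trans_le hC.1
  have hU := hH.cylLen_pos M u
  obtain ⟨n₀, hn₀⟩ := hH.exists_sub_le (ε := cylLen H M u / (2 * C ^ 2)) (by positivity)
  have main : ∀ (n : ℕ) (q : ℝ) (l : ℤ), max n₀ 1 ≤ n → H^[n] q = q + l →
      (∀ k, 0 < k → k < n → ∀ z : ℤ, H^[k] q ≠ q + z) →
      (∀ k < n, ∀ z : ℤ, H^[k] q + z ∉ Ioo (cylLo H M u) (cylHi H M u)) →
      2 * C ≤ iterDeriv H n q := by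
    intro n q l hn hq hmin havoid
    have h := hH.sub_le_mul_iterDeriv_of_periodic hC ((le_max_right _ _).trans hn) hq hmin havoid
      (hn₀ n ((le_max_left _ _).trans hn))
    rw [← cylLen] at h
    by_contra! hcon
    have : C * iterDeriv H n q * (cylLen H M u / (2 * C ^ 2)) <
        C * (2 * C) * (cylLen H M u / (2 * C ^ 2)) := by gcongr
    rw [show C * (2 * C) * (cylLen H M u / (2 * C ^ 2)) = cylLen H M u by field_simp] at this
    linarith
  refine ⟨max n₀ 1, le_max_right _ _, ?_, ?_⟩
  · intro n q l hn hq hmin havoid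
    have := main n q l hn hq hmin fun k hk z hz => havoid k hk <| by
      have h : SameCyl H M (H^[k] q + z) u := hH.sameCyl_iff.2 ⟨hz.1.le, hz.2⟩
      exact (hH.sameCylMod_iff.2 ⟨z, h.symm⟩).symm
    linarith [hC.1]
  intro L hL n hn x havoid hret hfirst
  have hn1 : 1 ≤ n := (le_max_right _ _).trans hn
  obtain ⟨l, hl⟩ := hH.sameCylMod_iff.1 hret
  have hlo := hH.iterate_cylLo_add n L x
  have hhi := hH.iterate_cylHi_add n L x
  rw [show cylLo H L (H^[n] x) = cylLo H L x + l by
    rw [← hH.cylLo_add_int, cylLo, cylLo, show ⌊H^[L] (H^[n] x)⌋ = _ from hl]] at hlo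
  rw [show cylHi H L (H^[n] x) = cylHi H L x + l by
    rw [← hH.cylHi_add_int, cylHi, cylHi, show ⌊H^[L] (H^[n] x)⌋ = _ from hl]] at hhi
  have hloL := hH.cylLo_mono (Nat.le_add_left L n) x
  have hhiL := hH.cylHi_anti (Nat.le_add_left L n) x
  have hlox := hH.cylLo_le (n + L) x
  have hhix := hH.lt_cylHi (n + L) x
  have hDL := hH.distortion_of_first_visit hC n L x hfirst
  have hcyl : ∀ y ∈ Ico (cylLo H (n + L) x) (cylHi H (n + L) x), ∀ k ≤ n,
      SameCyl H L (H^[k] y) (H^[k] x) := fun y hy k hk =>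
    sameCyl_iterate.2 ((hH.sameCyl_iff.2 hy).of_le hH (by omega))
  set α := cylLo H (n + L) x
  set β := cylHi H (n + L) x
  have hαβ : α < β := hlox.trans_lt hhix
  obtain ⟨q, hqmem, hq⟩ := intermediate_value_Icc hαβ.le
    ((hH.continuous_iterate n).sub continuous_id).continuousOn
    (show (l : ℝ) ∈ Icc (H^[n] α - α) (H^[n] β - β) by constructor <;> linarith)
  have hq : H^[n] q = q + l := by
    have : H^[n] q - q = l := hq
    linarith
  have hqD := main n q l hn hq ?_ ?_
  · have := hDL q hqmem x ⟨hlox, hhix.le⟩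
    by_contra! hcon
    nlinarith
  · -- the period of `q` is exactly `n`
    intro k hk0 hk z hz
    rcases hqmem.2.lt_or_eq with hlt | heq
    · have h1 := (hcyl q ⟨hqmem.1, hlt⟩ k hk.le).mod (d := d)
      have h2 := (hcyl q ⟨hqmem.1, hlt⟩ 0 (Nat.zero_le _)).mod (d := d)
      refine hfirst k hk0 hk (h1.symm.trans ((?_ : SameCylMod d H L _ q).trans
        (h2.trans hret.symm)))
      rw [hz]
      exact hH.sameCylMod_iff.2 ⟨z, rfl⟩
    · -- if `q` is the right endpoint, points slightly to the left of it return too early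
      have hβ : β = cylHi H L x := by
        rw [← heq] at hhi ⊢
        linarith
      have hopen : IsOpen {y : ℝ | cylLo H L x + z < H^[k] y} :=
        isOpen_lt continuous_const (hH.continuous_iterate k)
      have hmem : q ∈ {y : ℝ | cylLo H L x + z < H^[k] y} := by
        rw [mem_ofPred_eq, hz]
        linarith [hH.cylLo_le L x, hH.lt_cylHi L x]
      have hqcl : q ∈ closure (Ico α β) := by rw [closure_Ico hαβ.ne]; exact hqmem
      obtain ⟨y, hy1, hy2⟩ := mem_closure_iff.1 hqcl _ hopen hmem
      have hy3 : H^[k] y < cylHi H L x + z := by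
        have := hH.strictMono_iterate k hy2.2
        rw [← heq, hz, heq, hβ] at this
        exact this
      have h1 : SameCyl H L (H^[k] y) (x + z) := by
        rw [hH.sameCyl_iff, hH.cylLo_add_int, hH.cylHi_add_int]
        exact ⟨hy1.le, hy3⟩
      exact hfirst k hk0 hk (((hcyl y hy2 k hk.le).mod (d := d)).symm.trans
        ((hH.sameCylMod_iff.2 ⟨z, h1⟩).trans hret.symm))
  · intro k hk z hz
    have hopen : IsOpen {y : ℝ | H^[k] y + z ∈ Ioo (cylLo H M u) (cylHi H M u)} :=
      isOpen_Ioo.preimage ((hH.continuous_iterate k).add continuous_const)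
    have hqcl : q ∈ closure (Ico α β) := by rw [closure_Ico hαβ.ne]; exact hqmem
    obtain ⟨y, hy1, hy2⟩ := mem_closure_iff.1 hqcl _ hopen hz
    have h1 : SameCyl H M (H^[k] y + z) u := hH.sameCyl_iff.2 ⟨hy1.1.le, hy1.2⟩
    have h2 : SameCylMod d H M (H^[k] y) u := (hH.sameCylMod_iff.2 ⟨z, h1.symm⟩).symm
    exact havoid k hk.le
      ((((hcyl y hy2 k hk.le).mod (d := d)).symm.of_le hH hL).trans h2)

end ExpandingLift

/-! ### Lower bounds for the derivatives of iterates -/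

namespace ExpandingLift

variable {d : ℕ} {H : ℝ → ℝ}

lemma _root_.CircleExpanding.SameCyl.abs_sub_le (hH : ExpandingLift d H) {n : ℕ} {x y : ℝ}
    (h : SameCyl H n x y) : |x - y| ≤ cylLen H n y := by
  have h1 := hH.sameCyl_iff.1 h
  have h2 := hH.cylLo_le n y
  have h3 := hH.lt_cylHi n y
  rw [cylLen, abs_le]
  constructor <;> linarith [h1.1, h1.2]

lemma exists_pos_le_cylLen (hH : ExpandingLift d H) (n : ℕ) : ∃ c > 0, ∀ x, c ≤ cylLen H n x := by
  obtain ⟨S, hS, hle⟩ := hH.exists_deriv_le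
  have hS0 : 0 < S := by linarith
  refine ⟨(S ^ n)⁻¹, by positivity, fun x => ?_⟩
  have h := hH.sub_le_mul_of_iterDeriv_le n (S := S ^ n)
    ((hH.cylLo_le n x).trans (hH.lt_cylHi n x).le) fun t _ => by
      rw [hH.iterDeriv_eq_prod]
      refine (Finset.prod_le_prod (fun k _ => (hH.deriv_pos _).le) fun k _ => hle _).trans ?_
      simp
  rw [hH.iterate_cylLo, hH.iterate_cylHi, add_sub_cancel_left, ← cylLen] at h
  rwa [inv_le_iff_one_le_mul₀' (by positivity)]

/-- A continuous function that is positive at the points of a compact set which return exactly at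
time `n` is bounded below at the points that almost return. -/
lemma exists_pos_le_of_close (hH : ExpandingLift d H) (n : ℕ) {K : Set ℝ} (hK : IsCompact K)
    {g : ℝ → ℝ} (hg : Continuous g) (h : ∀ x ∈ K, ∀ l : ℤ, H^[n] x = x + l → 0 < g x) :
    ∃ μ > 0, ∀ x ∈ K, ∀ l : ℤ, |H^[n] x - x - l| < μ → μ ≤ g x := by
  rcases K.eq_empty_or_nonempty with rfl | hne
  · exact ⟨1, one_pos, fun x hx => hx.elim⟩
  have hc : Continuous fun x : ℝ => ((H^[n] x - x : ℝ) : UnitAddCircle) :=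
    (AddCircle.continuous_mk' 1).comp ((hH.continuous_iterate n).sub continuous_id)
  obtain ⟨x₀, hx₀, hmin⟩ := hK.exists_isMinOn hne (hc.norm.max hg).continuousOn
  refine ⟨max ‖((H^[n] x₀ - x₀ : ℝ) : UnitAddCircle)‖ (g x₀), ?_, fun x hx l hl => ?_⟩
  · by_contra! hcon
    have h1 := (le_max_left _ _).trans hcon
    have h2 := (le_max_right _ _).trans hcon
    rw [UnitAddCircle.norm_eq] at h1
    have h3 := abs_nonpos_iff.1 h1
    exact absurd (h x₀ hx₀ (round (H^[n] x₀ - x₀)) (by linarith)) (not_lt.2 h2)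
  · have h1 : max ‖((H^[n] x₀ - x₀ : ℝ) : UnitAddCircle)‖ (g x₀) ≤
        max ‖((H^[n] x - x : ℝ) : UnitAddCircle)‖ (g x) := hmin hx
    rcases le_max_iff.1 h1 with h2 | h2
    · exfalso
      exact absurd (h2.trans (UnitAddCircle.norm_eq.trans_le (round_le _ l))) (not_le.2 hl)
    · exact h2

lemma _root_.CircleExpanding.exists_pos_le_of_lt {f : ℕ → ℝ} (hf : ∀ n, 0 < f n) (N : ℕ) :
    ∃ δ > 0, ∀ n < N, δ ≤ f n := by
  induction N with
  | zero => exact ⟨1, one_pos, fun n hn => absurd hn (Nat.not_lt_zero n)⟩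
  | succ N ih =>
    obtain ⟨δ, hδ, h⟩ := ih
    refine ⟨min δ (f N), lt_min hδ (hf N), fun n hn => ?_⟩
    rcases (Nat.lt_succ_iff.1 hn).lt_or_eq with h' | rfl
    · exact (min_le_left _ _).trans (h n h')
    · exact min_le_right _ _

lemma iterate_sub_add_int (hH : ExpandingLift d H) (n : ℕ) (x : ℝ) (l : ℤ) : ∃ l' : ℤ,
    H^[n] x - x - l = H^[n] (Int.fract x) - Int.fract x - l' := by
  have h := hH.iterate_add_int n (Int.fract x) ⌊x⌋
  rw [Int.fract_add_floor] at h
  refine ⟨l + ⌊x⌋ - ⌊x⌋ * d ^ n, ?_⟩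
  rw [h]
  have := Int.fract_add_floor x
  push_cast
  linarith

/-- Points that almost return within bounded time are not contracted. -/
lemma exists_one_le_iterDeriv_of_close (hH : ExpandingLift d H) (N : ℕ) :
    ∃ δ > 0, ∀ n, 1 ≤ n → n < N → ∀ (x : ℝ) (l : ℤ), |H^[n] x - x - l| < δ →
      1 ≤ iterDeriv H n x := by
  have hone : ∀ n, ∃ δ > 0, 1 ≤ n → ∀ (x : ℝ) (l : ℤ), |H^[n] x - x - l| < δ →
      1 ≤ iterDeriv H n x := by
    intro n
    by_cases hn : 1 ≤ n
    swap
    · exact ⟨1, one_pos, fun h => absurd h hn⟩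
    -- by weak expansion no point of the closure of `{x | iterDeriv H n x < 1}` returns exactly
    have hK : IsCompact (Icc (0 : ℝ) 1 ∩ closure {x | iterDeriv H n x < 1}) :=
      isCompact_Icc.inter_right isClosed_closure
    obtain ⟨μ, hμ, h⟩ := hH.exists_pos_le_of_close n hK (g := fun _ => -1) continuous_const
      (by
        rintro x ⟨-, hx⟩ l hl
        exfalso
        have h1 : ∀ᶠ y in 𝓝 x, 1 ≤ iterDeriv H n y := by
          have := eventually_nhdsWithin_iff.1 (hH.expanding n hn x l hl)
          filter_upwards [this] with y hy
          by_cases hyx : y = x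
          · rw [hyx]; exact hH.one_le_iterDeriv_of_periodic hn hl
          · exact (hy hyx).le
        obtain ⟨y, hy1, hy2⟩ := (mem_closure_iff_frequently.1 hx).and_eventually h1 |>.exists
        exact absurd hy2 (not_le.2 hy1))
    refine ⟨μ, hμ, fun _ x l hl => ?_⟩
    obtain ⟨l', hl'⟩ := hH.iterate_sub_add_int n x l
    rw [hl'] at hl
    by_contra! hcon
    have h3 := hH.iterDeriv_add_int n (Int.fract x) ⌊x⌋
    rw [Int.fract_add_floor] at h3
    have h4 := h (Int.fract x) ⟨⟨Int.fract_nonneg x, (Int.fract_lt_one x).le⟩,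
      subset_closure (by rw [mem_ofPred_eq, ← h3]; exact hcon)⟩ l' hl
    linarith
  choose δ hδ h using hone
  obtain ⟨η, hη, hle⟩ := exists_pos_le_of_lt hδ N
  exact ⟨η, hη, fun n hn1 hnN x l hl => h n hn1 x l (hl.trans_le (hle n hnN))⟩

lemma _root_.CircleExpanding.Parabolic.add_int (hH : ExpandingLift d H) {q : ℝ}
    (hq : Parabolic H q) (z : ℤ) : Parabolic H (q + z) := by
  obtain ⟨s, hs, l, hl, h1⟩ := hq
  refine ⟨s, hs, l + z * d ^ s - z, ?_, by rw [hH.iterDeriv_add_int, h1]⟩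
  rw [hH.iterate_add_int, hl]
  push_cast; ring

/-- Points that almost return within bounded time and stay away from the parabolic points are
expanded. -/
lemma exists_lt_iterDeriv_of_close (hH : ExpandingLift d H) (N : ℕ) {r : ℝ} (hr : 0 < r) :
    ∃ μ > 0, ∀ n, 1 ≤ n → n < N → ∀ (x : ℝ) (l : ℤ), (∀ q, Parabolic H q → r ≤ |x - q|) →
      |H^[n] x - x - l| < μ → 1 + μ ≤ iterDeriv H n x := by
  have hone : ∀ n, ∃ μ > 0, 1 ≤ n → ∀ (x : ℝ) (l : ℤ), (∀ q, Parabolic H q → r ≤ |x - q|) →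
      |H^[n] x - x - l| < μ → 1 + μ ≤ iterDeriv H n x := by
    intro n
    by_cases hn : 1 ≤ n
    swap
    · exact ⟨1, one_pos, fun h => absurd h hn⟩
    have hK : IsCompact (Icc (0 : ℝ) 1 ∩ {x | ∀ q, Parabolic H q → r ≤ |x - q|}) := by
      refine isCompact_Icc.inter_right ?_
      simp only [ofPred_forall]
      exact isClosed_iInter fun q => isClosed_iInter fun _ =>
        isClosed_le continuous_const (continuous_id.sub continuous_const).abs
    obtain ⟨μ, hμ, h⟩ := hH.exists_pos_le_of_close n hK (g := fun x => iterDeriv H n x - 1)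
      ((hH.continuous_iterDeriv n).sub continuous_const) (by
        rintro x ⟨-, hx⟩ l hl
        have h1 := hH.one_le_iterDeriv_of_periodic hn hl
        rcases h1.lt_or_eq with h2 | h2
        · linarith
        · have := hx x ⟨n, hn, l, hl, h2.symm⟩
          simp at this
          linarith)
    refine ⟨μ, hμ, fun _ x l hx hl => ?_⟩
    obtain ⟨l', hl'⟩ := hH.iterate_sub_add_int n x l
    rw [hl'] at hl
    have h3 := hH.iterDeriv_add_int n (Int.fract x) ⌊x⌋
    rw [Int.fract_add_floor] at h3
    have h4 := h (Int.fract x) ⟨⟨Int.fract_nonneg x, (Int.fract_lt_one x).le⟩, fun q hq => by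
      have := hx (q + ⌊x⌋) (hq.add_int hH _)
      rwa [show x - (q + ⌊x⌋) = Int.fract x - q by rw [Int.fract]; ring] at this⟩ l' hl
    linarith
  choose δ hδ h using hone
  obtain ⟨η, hη, hle⟩ := exists_pos_le_of_lt hδ N
  refine ⟨η, hη, fun n hn1 hnN x l hx hl => ?_⟩
  have := h n hn1 x l hx (hl.trans_le (hle n hnN))
  linarith [hle n hnN]

/-- Decomposition of an orbit segment at its last visits: if returns to cylinders of level `L` do
not contract and the first `n` points of the orbit lie in the cylinders with index in `S`, then the
derivative of `H^[n]` is at least `m ^ #S`, with `m` a lower bound for the derivative of `H`. -/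
lemma pow_card_le_iterDeriv (hH : ExpandingLift d H) {m : ℝ} (hm0 : 0 < m) (hm1 : m ≤ 1)
    (hm : ∀ x, m ≤ deriv H x) {L : ℕ} {Q : ℝ → Prop}
    (hret : ∀ (n : ℕ) (x : ℝ), 1 ≤ n → SameCylMod d H L (H^[n] x) x → (∀ t ≤ n, Q (H^[t] x)) →
      1 ≤ iterDeriv H n x) (S : Finset (ZMod (d ^ L))) (n : ℕ) (x : ℝ)
    (hS : ∀ t < n, ((⌊H^[L] (H^[t] x)⌋ : ℤ) : ZMod (d ^ L)) ∈ S) (hQ : ∀ t < n, Q (H^[t] x)) :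
    m ^ S.card ≤ iterDeriv H n x := by
  classical
  induction hk : S.card generalizing S n x with
  | zero =>
    rw [Finset.card_eq_zero] at hk
    rcases Nat.eq_zero_or_pos n with rfl | hn
    · simp
    · exact absurd (hS 0 hn) (by simp [hk])
  | succ k ih =>
    rcases Nat.eq_zero_or_pos n with rfl | hn
    · simpa using pow_le_one₀ hm0.le hm1
    set code : ℝ → ZMod (d ^ L) := fun y => ((⌊H^[L] y⌋ : ℤ) : ZMod (d ^ L)) with hcode
    obtain ⟨t, ht, htmax⟩ := Finset.exists_max_image
      ((Finset.range n).filter fun t => code (H^[t] x) = code x) id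
      ⟨0, by simp [hn]⟩
    rw [Finset.mem_filter, Finset.mem_range] at ht
    obtain ⟨htn, hte⟩ := ht
    have h1 : 1 ≤ iterDeriv H t x := by
      rcases Nat.eq_zero_or_pos t with rfl | ht0
      · simp
      · refine hret t x ht0 ?_ fun s hs => hQ s (by omega)
        have := (ZMod.intCast_eq_intCast_iff _ _ _).1 hte
        push_cast at this
        exact this
    have h2 := ih (S.erase (code x)) (n - (t + 1)) (H^[t + 1] x) (fun s hs => by
        rw [← Function.iterate_add_apply H s (t + 1) x]
        refine Finset.mem_erase.2 ⟨fun h => ?_, hS _ (by omega)⟩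
        have := htmax (s + (t + 1)) (by
          rw [Finset.mem_filter, Finset.mem_range]; exact ⟨by omega, h⟩)
        simp only [id] at this
        omega) (fun s hs => by
        rw [← Function.iterate_add_apply]
        exact hQ _ (by omega)) (by
        rw [Finset.card_erase_of_mem (show code x ∈ S from hS 0 hn), hk, Nat.add_sub_cancel])
    rw [hH.iterDeriv_split (show t + 1 ≤ n by omega), hH.iterDeriv_succ, pow_succ]
    have h3 := hm (H^[t] x)
    have hk0 : 0 < m ^ k := by positivity
    have h4 : m ≤ deriv H (H^[t] x) * iterDeriv H t x := by nlinarith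
    exact mul_le_mul h2 h4 hm0.le (hk0.le.trans h2)

/-- If almost returns that start in the cylinder of `x₀` and take less than `n₁` steps expand by a
factor `μ ∈ [1, 2]`, then so do all returns to that cylinder, provided that it is small and that the
orbit avoids the fixed cylinder of `u`. -/
lemma le_iterDeriv_of_return (hH : ExpandingLift d H) {M : ℕ} {u : ℝ} {n₁ : ℕ}
    (hlong : ∀ L ≥ M, ∀ n ≥ n₁, ∀ x : ℝ, (∀ t ≤ n, ¬ SameCylMod d H M (H^[t] x) u) →
      SameCylMod d H L (H^[n] x) x →
      (∀ t, 0 < t → t < n → ¬ SameCylMod d H L (H^[t] x) (H^[n] x)) → 2 ≤ iterDeriv H n x)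
    {μ δ : ℝ} (hμ1 : 1 ≤ μ) (hμ2 : μ ≤ 2) {L : ℕ} (hL : M ≤ L) (hlen : ∀ x, cylLen H L x < δ)
    {x₀ : ℝ} (hshort : ∀ n, 1 ≤ n → n < n₁ → ∀ (x : ℝ) (l : ℤ), SameCylMod d H L x x₀ →
      |H^[n] x - x - l| < δ → μ ≤ iterDeriv H n x)
    (n : ℕ) (x : ℝ) (hn : 1 ≤ n) (hx : SameCylMod d H L x x₀) (hnx : SameCylMod d H L (H^[n] x) x₀)
    (havoid : ∀ t ≤ n, ¬ SameCylMod d H M (H^[t] x) u) : μ ≤ iterDeriv H n x := by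
  refine hH.le_iterDeriv_of_first_return (P := fun y => SameCylMod d H L y x₀)
    (Q := fun y => ¬ SameCylMod d H M y u) hμ1 ?_ n x hn hx hnx havoid
  intro n x hn hx hnx hfirst hQ
  have hret := hnx.trans hx.symm
  rcases le_or_gt n₁ n with h | h
  · exact hμ2.trans (hlong L hL n h x hQ hret fun t ht htn h' => hfirst t ht htn (h'.trans hnx))
  · obtain ⟨l, hl⟩ := hH.sameCylMod_iff.1 hret
    refine hshort n hn h x l hx ?_
    rw [show H^[n] x - x - l = H^[n] x - (x + l) by ring]
    exact (hl.abs_sub_le hH).trans_lt (hlen _)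

/-- The derivatives of all iterates are bounded below by a positive constant. -/
theorem exists_pos_le_iterDeriv (hH : ExpandingLift d H) :
    ∃ c > 0, c ≤ 1 ∧ ∀ (n : ℕ) (x : ℝ), c ≤ iterDeriv H n x := by
  classical
  obtain ⟨M, u, hU⟩ := hH.exists_expanding_cylinder
  obtain ⟨n₁, -, -, hlong⟩ := hH.exists_two_le_of_long_return M u
  obtain ⟨δ, hδ, hshort⟩ := hH.exists_one_le_iterDeriv_of_close n₁
  obtain ⟨L₀, hL₀⟩ := hH.exists_cylLen_le (half_pos hδ)
  set L := max L₀ M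
  have hlen : ∀ x, cylLen H L x < δ := fun x =>
    (hL₀ L (le_max_left _ _) x).trans_lt (half_lt_self hδ)
  have hret : ∀ (n : ℕ) (x : ℝ), 1 ≤ n → SameCylMod d H L (H^[n] x) x →
      (∀ t ≤ n, ¬ SameCylMod d H M (H^[t] x) u) → 1 ≤ iterDeriv H n x := fun n x hn hx hQ =>
    hH.le_iterDeriv_of_return hlong le_rfl one_le_two (le_max_right _ _) hlen
      (fun n hn hn' x l _ hl => hshort n hn hn' x l hl) n x hn (SameCylMod.refl _ _ _ _) hx hQ
  obtain ⟨m, hm0, hm1, hm⟩ := hH.exists_deriv_ge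
  have : NeZero (d ^ L) := ⟨pow_ne_zero _ (by have := hH.two_le; omega)⟩
  set c := m ^ (Finset.univ : Finset (ZMod (d ^ L))).card with hc
  have hc0 : 0 < c := by positivity
  have hc1 : c ≤ 1 := pow_le_one₀ hm0.le hm1
  have havoid : ∀ (n : ℕ) (x : ℝ), (∀ t < n, ¬ SameCylMod d H M (H^[t] x) u) →
      c ≤ iterDeriv H n x := fun n x hQ =>
    hH.pow_card_le_iterDeriv hm0 hm1 hm (Q := fun y => ¬ SameCylMod d H M y u) hret Finset.univ n x
      (fun t _ => Finset.mem_univ _) hQ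
  have hcm1 : c * m ≤ 1 := by nlinarith
  refine ⟨c * (c * m), by positivity, by nlinarith [mul_pos hc0 hm0], fun n x => ?_⟩
  by_cases hex : ∃ t ≤ n, SameCylMod d H M (H^[t] x) u
  swap
  · push Not at hex
    have := havoid n x fun t ht => hex t ht.le
    nlinarith [mul_pos hc0 hm0]
  -- split at the first and at the last visit to the expanding cylinder
  have ht₀ := Nat.find_spec hex
  set t₀ := Nat.find hex
  have hfirst : ∀ t < t₀, ¬ SameCylMod d H M (H^[t] x) u := fun t ht h =>
    Nat.find_min hex ht ⟨ht.le.trans ht₀.1, h⟩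
  obtain ⟨t₁, ht₁, hmax⟩ := Finset.exists_max_image
    ((Finset.range (n + 1)).filter fun t => SameCylMod d H M (H^[t] x) u) id
    ⟨t₀, by simp only [Finset.mem_filter, Finset.mem_range]; exact ⟨by omega, ht₀.2⟩⟩
  rw [Finset.mem_filter, Finset.mem_range] at ht₁
  have h01 : t₀ ≤ t₁ := by
    by_contra! hcon
    exact hfirst t₁ hcon ht₁.2
  have hd1 := havoid t₀ x hfirst
  have hd2 : 1 ≤ iterDeriv H (t₁ - t₀) (H^[t₀] x) := by
    rcases h01.eq_or_lt with h | h
    · rw [← h, Nat.sub_self, iterDeriv_zero]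
    · have := hU (t₁ - t₀) (H^[t₀] x) (by omega) ht₀.2 (by rw [← iterate_split h01]; exact ht₁.2)
      linarith
  have hd3 : c * m ≤ iterDeriv H (n - t₁) (H^[t₁] x) := by
    rcases (Nat.lt_succ_iff.1 ht₁.1).eq_or_lt with h | h
    · rw [h, Nat.sub_self, iterDeriv_zero]
      nlinarith
    · rw [hH.iterDeriv_split (show 1 ≤ n - t₁ by omega), iterDeriv_one]
      refine mul_le_mul (havoid _ _ fun t ht h' => ?_) (hm _) hm0.le (hH.iterDeriv_pos _ _).le
      rw [← Function.iterate_add_apply, ← Function.iterate_add_apply] at h'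
      have := hmax (t + 1 + t₁) (by
        rw [Finset.mem_filter, Finset.mem_range]; exact ⟨by omega, h'⟩)
      simp only [id] at this
      omega
  rw [hH.iterDeriv_split (Nat.lt_succ_iff.1 ht₁.1), hH.iterDeriv_split h01]
  have h4 : c ≤ iterDeriv H (t₁ - t₀) (H^[t₀] x) * iterDeriv H t₀ x := by nlinarith
  calc c * (c * m) = (c * m) * c := by ring
    _ ≤ _ := mul_le_mul hd3 h4 hc0.le (hH.iterDeriv_pos _ _).le

lemma pow_le_iterDeriv_of_chain (hH : ExpandingLift d H) {μ : ℝ} (hμ : 0 ≤ μ) (x : ℝ) (t : ℕ → ℕ)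
    (v : ℕ) (ht : ∀ k < v, t k ≤ t (k + 1))
    (h : ∀ k < v, μ ≤ iterDeriv H (t (k + 1) - t k) (H^[t k] x)) :
    t 0 ≤ t v ∧ μ ^ v ≤ iterDeriv H (t v - t 0) (H^[t 0] x) := by
  induction v with
  | zero => simp
  | succ v ih =>
    obtain ⟨h1, h2⟩ := ih (fun k hk => ht k (by omega)) fun k hk => h k (by omega)
    have h3 := ht v (Nat.lt_succ_self v)
    refine ⟨h1.trans h3, ?_⟩
    rw [hH.iterDeriv_split (show t v - t 0 ≤ t (v + 1) - t 0 by omega), pow_succ, mul_comm]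
    rw [← Function.iterate_add_apply, Nat.sub_add_cancel h1,
      show t (v + 1) - t 0 - (t v - t 0) = t (v + 1) - t v by omega]
    exact mul_le_mul (h v (Nat.lt_succ_self v)) h2 (pow_nonneg hμ _) (hH.iterDeriv_pos _ _).le

/-- Long iterates have large derivative at the points whose image is away from the parabolic points.
An orbit segment of length `(a + 1) (v + 1) G` either visits the expanding cylinder `a + 1` times;
or it contains a stretch of length `(v + 1) G` that avoids it. In the latter case it either visits
the small cylinder of the endpoint `v + 1` times during the stretch, each time gaining a definite
factor, or takes longer than `G` to return there, which gives a large derivative by bounded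
distortion. -/
theorem exists_le_iterDeriv_of_far (hH : ExpandingLift d H) {r : ℝ} (hr : 0 < r) (B : ℝ) :
    ∃ N₀ : ℕ, ∀ N ≥ N₀, ∀ x : ℝ, (∀ q, Parabolic H q → r ≤ |H^[N] x - q|) →
      B ≤ iterDeriv H N x := by
  classical
  obtain ⟨M, u, hU⟩ := hH.exists_expanding_cylinder
  obtain ⟨n₁, -, -, hlong⟩ := hH.exists_two_le_of_long_return M u
  obtain ⟨c, hc0, hc1, hc⟩ := hH.exists_pos_le_iterDeriv
  obtain ⟨C, hC⟩ := hH.exists_distortionBound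
  have hC0 : 0 < C := zero_lt_one.trans_le hC.1
  obtain ⟨δ, hδ, hshort⟩ := hH.exists_lt_iterDeriv_of_close n₁ (half_pos hr)
  set μ := min (1 + δ) 2 with hμ
  have hμ1 : 1 < μ := lt_min (by linarith) one_lt_two
  have hδr : 0 < min (δ / 2) (r / 2) := lt_min (half_pos hδ) (half_pos hr)
  obtain ⟨L₀, hL₀⟩ := hH.exists_cylLen_le hδr
  set L := max L₀ M
  have hlenr : ∀ x, cylLen H L x ≤ r / 2 := fun x =>
    (hL₀ L (le_max_left _ _) x).trans (min_le_right _ _)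
  have hlenδ : ∀ x, cylLen H L x < δ := fun x =>
    ((hL₀ L (le_max_left _ _) x).trans (min_le_left _ _)).trans_lt (half_lt_self hδ)
  obtain ⟨cL, hcL0, hcL⟩ := hH.exists_pos_le_cylLen L
  obtain ⟨a, ha⟩ := pow_unbounded_of_one_lt (B / c ^ 2) one_lt_two
  obtain ⟨v, hv⟩ := pow_unbounded_of_one_lt (B / c ^ 2) hμ1
  obtain ⟨G₀, hG₀⟩ := hH.exists_cylLen_le (ε := c ^ 2 * cL / (C * (|B| + 1))) (by positivity)
  set G := max G₀ 1
  have hG1 : 1 ≤ G := le_max_right _ _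
  set T := (v + 1) * G with hT
  refine ⟨(a + 1) * T, fun N hN x hx => ?_⟩
  by_contra! hB
  have hseg : ∀ s n, s ≤ n → n ≤ N → c ^ 2 * iterDeriv H (n - s) (H^[s] x) < B := by
    intro s n hsn hnN
    refine lt_of_le_of_lt ?_ hB
    rw [hH.iterDeriv_split hnN, hH.iterDeriv_split hsn]
    have h1 := hc (N - n) (H^[n] x)
    have h2 := hc s x
    have h3 := hH.iterDeriv_pos (n - s) (H^[s] x)
    calc c ^ 2 * iterDeriv H (n - s) (H^[s] x) =
          c * (iterDeriv H (n - s) (H^[s] x) * c) := by ring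
      _ ≤ _ := mul_le_mul h1 (mul_le_mul_of_nonneg_left h2 h3.le) (by positivity)
          (hH.iterDeriv_pos _ _).le
  set x₀ := H^[N] x with hx₀
  -- the cylinder of the endpoint is visited in every window of length `G`
  have step1 : ∀ s, s + G ≤ N → ∃ t, s ≤ t ∧ t < s + G ∧ SameCylMod d H L (H^[t] x) x₀ := by
    intro s hs
    have hex : ∃ t, s ≤ t ∧ SameCylMod d H L (H^[t] x) x₀ :=
      ⟨N, by omega, SameCylMod.refl _ _ _ _⟩
    refine ⟨Nat.find hex, (Nat.find_spec hex).1, ?_, (Nat.find_spec hex).2⟩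
    by_contra! hcon
    obtain ⟨hsn, hn⟩ := Nat.find_spec hex
    have hfind : ∀ t, s ≤ t → t < Nat.find hex → ¬ SameCylMod d H L (H^[t] x) x₀ :=
      fun t h1 h2 h3 => Nat.find_min hex h2 ⟨h1, h3⟩
    have hnN : Nat.find hex ≤ N := Nat.find_min' hex ⟨by omega, SameCylMod.refl _ _ _ _⟩
    generalize Nat.find hex = n at *
    have h1 := hH.cylLen_le_of_first_visit hC (n - s) L (H^[s] x) (fun t ht0 ht h => by
      rw [← Function.iterate_add_apply, ← iterate_split hsn] at h
      exact hfind (t + s) (by omega) (by omega) (h.trans hn))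
      ⟨hH.cylLo_le _ _, (hH.lt_cylHi _ _).le⟩
    have h2 := hG₀ (n - s + L) (by have := le_max_left G₀ 1; omega) (H^[s] x)
    have h3 := hseg s n hsn hnN
    have h4 := hcL (H^[n - s] (H^[s] x))
    have hD := hH.iterDeriv_pos (n - s) (H^[s] x)
    rw [le_div_iff₀ (by positivity)] at h2
    set D := iterDeriv H (n - s) (H^[s] x)
    have hB1 : B < |B| + 1 := (le_abs_self B).trans_lt (lt_add_one _)
    have h6 : cL * (|B| + 1) ≤ D * (c ^ 2 * cL) := by
      calc cL * (|B| + 1) ≤ (C * D * cylLen H (n - s + L) (H^[s] x)) * (|B| + 1) :=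
            mul_le_mul_of_nonneg_right (h4.trans h1) (by positivity)
        _ = D * (cylLen H (n - s + L) (H^[s] x) * (C * (|B| + 1))) := by ring
        _ ≤ _ := mul_le_mul_of_nonneg_left h2 hD.le
    nlinarith
  have hret : ∀ (n : ℕ) (y : ℝ), 1 ≤ n → SameCylMod d H L y x₀ → SameCylMod d H L (H^[n] y) x₀ →
      (∀ t ≤ n, ¬ SameCylMod d H M (H^[t] y) u) → μ ≤ iterDeriv H n y := by
    refine hH.le_iterDeriv_of_return hlong hμ1.le (min_le_right _ _) (le_max_right _ _) hlenδ ?_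
    intro n hn hn' y l hy hl
    refine (min_le_left _ _).trans (hshort n hn hn' y l (fun q hq => ?_) hl)
    obtain ⟨z, hz⟩ := hH.sameCylMod_iff.1 hy
    have h1 := (hz.abs_sub_le hH).trans (hlenr _)
    have h2 := hx (q + ((-z : ℤ) : ℝ)) (hq.add_int hH _)
    have h3 : x₀ - (q + ((-z : ℤ) : ℝ)) = -(y - (x₀ + z)) + (y - q) := by push_cast; ring
    rw [h3] at h2
    have h4 := abs_add_le (-(y - (x₀ + z))) (y - q)
    rw [abs_neg] at h4
    linarith
  -- the expanding cylinder is visited in every window of length `T`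
  have step2 : ∀ s, s + T ≤ N → ∃ t, s ≤ t ∧ t < s + T ∧ SameCylMod d H M (H^[t] x) u := by
    intro s hs
    by_contra! hcon
    have hk : ∀ k, ∃ t, k ≤ v → s + k * G ≤ t ∧ t < s + (k + 1) * G ∧
        SameCylMod d H L (H^[t] x) x₀ := by
      intro k
      by_cases hkv : k ≤ v
      · have h1 : (k + 1) * G ≤ T := Nat.mul_le_mul_right G (by omega)
        obtain ⟨t, h2, h3, h4⟩ := step1 (s + k * G) (by linarith)
        exact ⟨t, fun _ => ⟨h2, by linarith, h4⟩⟩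
      · exact ⟨0, fun h => absurd h hkv⟩
    choose t ht using hk
    have htT : ∀ k ≤ v, t k < s + T := fun k hkv => by
      have h1 : (k + 1) * G ≤ T := Nat.mul_le_mul_right G (by omega)
      linarith [(ht k hkv).2.1]
    have hlt : ∀ k < v, t k < t (k + 1) := fun k hkv =>
      (ht k hkv.le).2.1.trans_le (ht (k + 1) hkv).1
    obtain ⟨h1, h2⟩ := hH.pow_le_iterDeriv_of_chain (zero_le_one.trans hμ1.le) x t v
      (fun k hk => (hlt k hk).le) fun k hk => by
        have hlt' := hlt k hk
        refine hret _ _ (by omega) (ht k hk.le).2.2 ?_ fun j hj => ?_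
        · rw [← iterate_split hlt'.le]
          exact (ht (k + 1) hk).2.2
        · rw [← Function.iterate_add_apply]
          have := (ht k hk.le).1
          have := htT (k + 1) hk
          exact hcon _ (by omega) (by omega)
    have h3 := hseg (t 0) (t v) h1 (by have := htT v le_rfl; omega)
    rw [div_lt_iff₀ (by positivity)] at hv
    nlinarith [pow_pos hc0 2]
  have hk : ∀ k, ∃ t, k ≤ a → k * T ≤ t ∧ t < (k + 1) * T ∧ SameCylMod d H M (H^[t] x) u := by
    intro k
    by_cases hka : k ≤ a
    · have h1 : (k + 1) * T ≤ (a + 1) * T := Nat.mul_le_mul_right T (by omega)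
      obtain ⟨t, h2, h3, h4⟩ := step2 (k * T) (by linarith)
      exact ⟨t, fun _ => ⟨h2, by linarith, h4⟩⟩
    · exact ⟨0, fun h => absurd h hka⟩
  choose t ht using hk
  have hlt : ∀ k < a, t k < t (k + 1) := fun k hka =>
    (ht k hka.le).2.1.trans_le (ht (k + 1) hka).1
  obtain ⟨h1, h2⟩ := hH.pow_le_iterDeriv_of_chain zero_le_two x t a
    (fun k hk => (hlt k hk).le) fun k hk => by
      have hlt' := hlt k hk
      refine hU _ _ (by omega) (ht k hk.le).2.2 ?_
      rw [← iterate_split hlt'.le]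
      exact (ht (k + 1) hk).2.2
  have h3 := hseg (t 0) (t a) h1 (by have := (ht a le_rfl).2.1; omega)
  rw [div_lt_iff₀ (by positivity)] at ha
  nlinarith [pow_pos hc0 2]

/-- The periods of the parabolic points are bounded, so they have a common period. -/
theorem exists_common_period (hH : ExpandingLift d H) : ∃ P : ℕ, 1 ≤ P ∧
    ∀ q, Parabolic H q → ∃ l : ℤ, H^[P] q = q + l ∧ iterDeriv H P q = 1 := by
  classical
  obtain ⟨M, u, hU⟩ := hH.exists_expanding_cylinder
  obtain ⟨n₁, hn₁, hper, -⟩ := hH.exists_two_le_of_long_return M u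
  refine ⟨n₁.factorial, Nat.factorial_pos _, fun q hq => ?_⟩
  obtain ⟨s, hs, l, hl, h1⟩ := hq
  have hex : ∃ n, 1 ≤ n ∧ ∃ l : ℤ, H^[n] q = q + l := ⟨s, hs, l, hl⟩
  obtain ⟨hn1, l', hl'⟩ := Nat.find_spec hex
  have hmin : ∀ k, 0 < k → k < Nat.find hex → ∀ z : ℤ, H^[k] q ≠ q + z := fun k hk hkn z hz =>
    Nat.find_min hex hkn ⟨hk, z, hz⟩
  generalize Nat.find hex = n at *
  obtain ⟨j, rfl⟩ : n ∣ s := by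
    obtain ⟨z, hz⟩ := hH.iterate_eq_iterate_mod_add hl' s
    by_contra hdvd
    refine hmin (s % n) (Nat.pos_of_ne_zero fun h => hdvd (Nat.dvd_of_mod_eq_zero h))
      (Nat.mod_lt _ hn1) (l - z) ?_
    push_cast
    linarith
  have hD : iterDeriv H n q = 1 := by
    rw [hH.iterDeriv_mul_of_periodic hl'] at h1
    exact (pow_eq_one_iff_of_nonneg (hH.iterDeriv_pos n q).le (by rintro rfl; omega)).1 h1
  have hlt : n < n₁ := by
    by_contra! hcon
    have h2 : ∀ k < n, ¬ SameCylMod d H M (H^[k] q) u := by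
      intro k hk h
      have h3 := hU n (H^[k] q) hn1 h (by
        rw [← Function.iterate_add_apply, add_comm, Function.iterate_add_apply, hl',
          hH.iterate_add_int]
        exact SameCylMod.trans (hH.sameCylMod_iff.2 ⟨_, rfl⟩) h)
      rw [hH.iterDeriv_iterate_of_periodic hl', hD] at h3
      norm_num at h3
    have := hper n q l' hcon hl' hmin h2
    rw [hD] at this
    norm_num at this
  obtain ⟨j, hj⟩ : n ∣ n₁.factorial := Nat.dvd_factorial hn1 hlt.le
  rw [hj]
  obtain ⟨z, hz⟩ := hH.iterate_mul_eq_add hl' j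
  exact ⟨z, hz, by rw [hH.iterDeriv_mul_of_periodic hl', hD, one_pow]⟩

theorem finite_parabolic (hH : ExpandingLift d H) :
    {q ∈ Ico (0 : ℝ) 1 | Parabolic H q}.Finite := by
  obtain ⟨P, hP, h⟩ := hH.exists_common_period
  refine (hH.finite_periodic hP).subset fun q hq => ⟨hq.1, ?_⟩
  obtain ⟨l, hl, -⟩ := h q hq.2
  exact ⟨l, hl⟩

end ExpandingLift

/-! ### An analytic density adapted to the parabolic points -/

/-- A nonnegative trigonometric polynomial that vanishes exactly at the integer translates of the
points of `F`. -/
noncomputable def sinSqProd (F : Finset ℝ) (x : ℝ) : ℝ :=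
  (∏ q ∈ F, Real.sin (Real.pi * (x - q))) ^ 2

namespace sinSqProd

variable {F : Finset ℝ}

lemma continuous : Continuous (sinSqProd F) := by
  unfold sinSqProd
  fun_prop

lemma nonneg (x : ℝ) : 0 ≤ sinSqProd F x := sq_nonneg _

lemma le_one (x : ℝ) : sinSqProd F x ≤ 1 := by
  rw [sinSqProd, ← Finset.prod_pow]
  exact Finset.prod_le_one (fun _ _ => sq_nonneg _) fun q _ => Real.sin_sq_le_one _

lemma add_int (x : ℝ) (z : ℤ) : sinSqProd F (x + z) = sinSqProd F x := by
  rw [sinSqProd, sinSqProd, ← Finset.prod_pow, ← Finset.prod_pow]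
  refine Finset.prod_congr rfl fun q _ => ?_
  rw [show Real.pi * (x + z - q) = Real.pi * (x - q) + z * Real.pi by ring, Real.sin_add_int_mul_pi,
    mul_pow, ← zpow_natCast ((-1 : ℝ) ^ z), ← zpow_mul, mul_comm z, zpow_mul]
  simp

lemma eq_zero_iff (x : ℝ) : sinSqProd F x = 0 ↔ ∃ q ∈ F, ∃ z : ℤ, x = q + z := by
  rw [sinSqProd, pow_eq_zero_iff two_ne_zero, Finset.prod_eq_zero_iff]
  refine exists_congr fun q => and_congr_right fun _ => ?_
  rw [Real.sin_eq_zero_iff]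
  refine exists_congr fun z => ?_
  rw [mul_comm Real.pi, mul_right_cancel_iff_of_pos Real.pi_pos]
  constructor <;> intro h <;> linarith

lemma apply_self {q : ℝ} (hq : q ∈ F) : sinSqProd F q = 0 :=
  (eq_zero_iff q).2 ⟨q, hq, 0, by simp⟩

/-- The product is bounded below away from its zeros. -/
lemma exists_pos_le {r : ℝ} (hr : 0 < r) :
    ∃ t > 0, ∀ x, (∀ q ∈ F, ∀ z : ℤ, r ≤ |x - (q + z)|) → t ≤ sinSqProd F x := by
  set K : Set ℝ := Icc 0 1 ∩ {x | ∀ q ∈ F, ∀ z : ℤ, r ≤ |x - (q + z)|} with hK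
  have hKc : IsCompact K := by
    refine isCompact_Icc.inter_right ?_
    simp only [ofPred_forall]
    exact isClosed_iInter fun q => isClosed_iInter fun _ => isClosed_iInter fun z =>
      isClosed_le continuous_const (continuous_id.sub continuous_const).abs
  have hfract : ∀ x, (∀ q ∈ F, ∀ z : ℤ, r ≤ |x - (q + z)|) → Int.fract x ∈ K := by
    intro x hx
    refine ⟨⟨Int.fract_nonneg x, (Int.fract_lt_one x).le⟩, fun q hq z => ?_⟩
    have := hx q hq (z + ⌊x⌋)
    rwa [show x - (q + ((z + ⌊x⌋ : ℤ) : ℝ)) = Int.fract x - (q + z) by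
      rw [Int.fract]; push_cast; ring] at this
  have hper : ∀ x, sinSqProd F (Int.fract x) = sinSqProd F x := fun x => by
    rw [← add_int (Int.fract x) ⌊x⌋, Int.fract_add_floor]
  rcases K.eq_empty_or_nonempty with he | hne
  · refine ⟨1, one_pos, fun x hx => ?_⟩
    have := hfract x hx
    rw [he] at this
    exact this.elim
  · obtain ⟨x₀, hx₀, hmin⟩ := hKc.exists_isMinOn hne continuous.continuousOn
    refine ⟨sinSqProd F x₀, (nonneg x₀).lt_of_ne' fun h => ?_, fun x hx => ?_⟩
    · obtain ⟨q, hq, z, hz⟩ := (eq_zero_iff x₀).1 h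
      have := hx₀.2 q hq z
      rw [hz, sub_self, abs_zero] at this
      linarith
    · rw [← hper x]
      exact hmin (hfract x hx)

/-- Near each of its zeros, which are double, the product increases with the distance to the zero.
-/
lemma exists_monotone {q : ℝ} (hq : q ∈ F) (hF : ∀ p ∈ F, p ∈ Ico (0 : ℝ) 1) :
    ∃ η > 0, (∀ x y, q ≤ x → x ≤ y → y ≤ q + η → sinSqProd F x ≤ sinSqProd F y) ∧
      ∀ x y, q - η ≤ y → y ≤ x → x ≤ q → sinSqProd F x ≤ sinSqProd F y := by
  set g : ℝ → ℝ := fun x => ∏ p ∈ F, Real.sin (Real.pi * (x - p)) with hg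
  set R : ℝ → ℝ := fun x => ∏ p ∈ F.erase q, Real.sin (Real.pi * (x - p)) with hR
  have hgR : g = fun x => Real.sin (Real.pi * (x - q)) * R x :=
    funext fun x => (Finset.mul_prod_erase F _ hq).symm
  have hgc : ContDiff ℝ 1 g := by
    refine contDiff_prod fun p _ => ?_
    fun_prop
  have hRd : Differentiable ℝ R := by
    have : ContDiff ℝ 1 R := contDiff_prod fun p _ => by fun_prop
    exact this.differentiable one_ne_zero
  have hRq : R q ≠ 0 := by
    rw [hR]
    simp only
    rw [Finset.prod_ne_zero_iff]
    intro p hp hsin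
    rw [Finset.mem_erase] at hp
    obtain ⟨z, hz⟩ := Real.sin_eq_zero_iff.1 hsin
    rw [mul_comm Real.pi, mul_right_cancel_iff_of_pos Real.pi_pos] at hz
    have h1 := hF p hp.2
    have h2 := hF q hq
    have h3 : (z : ℝ) < 1 := by linarith [h1.1, h2.2]
    have h4 : (-1 : ℝ) < z := by linarith [h1.2, h2.1]
    have h5 : z < 1 := by exact_mod_cast h3
    have h6 : -1 < z := by exact_mod_cast h4
    have h7 : z = 0 := by omega
    rw [h7] at hz
    exact hp.1 (by push_cast at hz; linarith)
  have hgq : g q = 0 := by rw [hgR]; simp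
  have hdg : deriv g q = Real.pi * R q := by
    have h1 : HasDerivAt (fun x : ℝ => Real.sin (Real.pi * (x - q))) Real.pi q := by
      have h := (((hasDerivAt_id q).sub_const q).const_mul Real.pi).sin
      simpa using h
    have h2 := h1.mul (hRd q).hasDerivAt
    simp only [sub_self, mul_zero, Real.sin_zero, zero_mul, add_zero] at h2
    rw [hgR]
    exact h2.deriv
  set c := deriv g q with hc
  have hc0 : c ≠ 0 := by rw [hdg]; exact mul_ne_zero Real.pi_pos.ne' hRq
  have hev : ∀ᶠ x in 𝓝 q, 0 < c * deriv g x := by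
    have hcont : Continuous fun x => c * deriv g x :=
      continuous_const.mul (hgc.continuous_deriv le_rfl)
    exact hcont.continuousAt.eventually_const_lt (mul_self_pos.2 hc0)
  obtain ⟨η, hη, hball⟩ := Metric.eventually_nhds_iff.1 hev
  have hmono : MonotoneOn (fun x => c * g x) (Icc (q - η / 2) (q + η / 2)) := by
    refine monotoneOn_of_deriv_nonneg (convex_Icc _ _)
      (continuous_const.mul hgc.continuous).continuousOn
      ((hgc.differentiable one_ne_zero).const_mul c).differentiableOn fun x hx => ?_
    rw [interior_Icc] at hx
    rw [deriv_const_mul c ((hgc.differentiable one_ne_zero) x)]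
    refine (hball ?_).le
    rw [Real.dist_eq, abs_lt]
    constructor <;> linarith [hx.1, hx.2]
  have hsq : ∀ x y, (c * g x) ^ 2 ≤ (c * g y) ^ 2 → sinSqProd F x ≤ sinSqProd F y := by
    intro x y h
    rw [mul_pow, mul_pow] at h
    exact le_of_mul_le_mul_left h (by positivity)
  refine ⟨η / 2, half_pos hη, fun x y hqx hxy hy => hsq x y ?_, fun x y hy hyx hxq => hsq x y ?_⟩
  · have h1 := hmono (a := q) ⟨by linarith, by linarith⟩ (b := x)
      ⟨by linarith, by linarith⟩ hqx
    have h2 := hmono (a := x) ⟨by linarith, by linarith⟩ (b := y)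
      ⟨by linarith, by linarith⟩ hxy
    simp only [hgq, mul_zero] at h1
    exact pow_le_pow_left₀ h1 h2 2
  · have h1 := hmono (a := x) ⟨by linarith, by linarith⟩ (b := q)
      ⟨by linarith, by linarith⟩ hxq
    have h2 := hmono (a := y) ⟨by linarith, by linarith⟩ (b := x)
      ⟨by linarith, by linarith⟩ hyx
    simp only [hgq, mul_zero] at h1 h2
    nlinarith

end sinSqProd

lemma one_add_two_mul_mul_exp_neg_le_two (s : ℝ) :
    (1 + 2 * s) * Real.exp (-s) ≤ 2 := by
  rw [Real.exp_neg, ← div_eq_mul_inv, div_le_iff₀ (Real.exp_pos s)]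
  linarith [Real.add_one_le_exp s]

lemma one_add_two_mul_mul_exp_neg_le_div {s : ℝ} (hs : 0 < s) :
    (1 + 2 * s) * Real.exp (-s) ≤ 8 / s := by
  rw [Real.exp_neg, ← div_eq_mul_inv, div_le_div_iff₀ (Real.exp_pos s) hs]
  have h1 := Real.add_one_le_exp (s / 2)
  have h2 : Real.exp s = Real.exp (s / 2) ^ 2 := by
    rw [← Real.exp_nat_mul]; congr 1; push_cast; ring
  rw [h2]
  have h3 : (s / 2 + 1) ^ 2 ≤ Real.exp (s / 2) ^ 2 := pow_le_pow_left₀ (by positivity) h1 2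
  nlinarith

lemma one_add_two_mul_mul_exp_neg_mono {s t : ℝ} (hs : 0 ≤ s) (hst : s ≤ t) (ht : t ≤ 1 / 2) :
    (1 + 2 * s) * Real.exp (-s) ≤ (1 + 2 * t) * Real.exp (-t) := by
  have h1 := Real.add_one_le_exp (-(t - s))
  have h2 : Real.exp (-t) = Real.exp (-s) * Real.exp (-(t - s)) := by
    rw [← Real.exp_add]; congr 1; ring
  rw [h2, mul_left_comm, mul_comm]
  refine mul_le_mul_of_nonneg_left ?_ (Real.exp_pos _).le
  calc 1 + 2 * s ≤ (1 + 2 * t) * (-(t - s) + 1) := by nlinarith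
    _ ≤ _ := mul_le_mul_of_nonneg_left h1 (by linarith)

/-- The density `(1 + 2 b S) exp (- b S)`, where `S` is `sinSqProd F`. It has strict local minima
with value `1` at the zeros of `S`, and for large `b` it is small away from them. -/
noncomputable def bumpDensity (F : Finset ℝ) (b x : ℝ) : ℝ :=
  (1 + 2 * (b * sinSqProd F x)) * Real.exp (-(b * sinSqProd F x))

/-- The density extends to an entire function, so it has an analytic primitive. -/
lemma exists_primitive_bumpDensity (F : Finset ℝ) (b : ℝ) :
    ∃ p : ℝ → ℝ, ContDiff ℝ ω p ∧ ∀ x, HasDerivAt p (bumpDensity F b x) x := by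
  set S : ℂ → ℂ := fun w => (∏ q ∈ F, Complex.sin (Real.pi * (w - q))) ^ 2 with hS
  set f : ℂ → ℂ := fun w => (1 + 2 * (b * S w)) * Complex.exp (-(b * S w)) with hf
  have hSd : Differentiable ℂ S := by
    have : ContDiff ℂ 1 fun w : ℂ => ∏ q ∈ F, Complex.sin (Real.pi * (w - q)) :=
      contDiff_prod fun q _ => by fun_prop
    exact (this.differentiable one_ne_zero).pow 2
  have hfd : Differentiable ℂ f := by
    rw [hf]
    fun_prop
  obtain ⟨g, hg⟩ := hfd.isExactOn_univ
  have hgd : Differentiable ℂ g := fun w => (hg w (mem_univ w)).differentiableAt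
  refine ⟨fun x => (g x).re, (hgd.contDiff).real_of_complex, fun x => ?_⟩
  have hre : f x = ((bumpDensity F b x : ℝ) : ℂ) := by
    rw [hf, hS, bumpDensity, sinSqProd]
    push_cast
    rfl
  have := (hg x (mem_univ _)).real_of_complex
  rwa [hre, Complex.ofReal_re] at this

namespace ExpandingLift

variable {d : ℕ} {H : ℝ → ℝ}

lemma exists_iterate_lipschitz (hH : ExpandingLift d H) (n : ℕ) :
    ∃ Λ : ℝ, 1 ≤ Λ ∧ ∀ x y, |H^[n] x - H^[n] y| ≤ Λ * |x - y| := by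
  obtain ⟨S, hS, hle⟩ := hH.exists_deriv_le
  have hb : ∀ t, iterDeriv H n t ≤ S ^ n := fun t => by
    rw [hH.iterDeriv_eq_prod]
    refine (Finset.prod_le_prod (fun k _ => (hH.deriv_pos _).le) fun k _ => hle _).trans ?_
    simp
  refine ⟨S ^ n, one_le_pow₀ hS, fun x y => ?_⟩
  wlog hxy : y ≤ x generalizing x y
  · rw [abs_sub_comm, abs_sub_comm x]
    exact this y x (not_le.1 hxy).le
  rw [abs_of_nonneg (sub_nonneg.2 ((hH.strictMono_iterate n).monotone hxy)),
    abs_of_nonneg (sub_nonneg.2 hxy)]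
  exact hH.sub_le_mul_of_iterDeriv_le n hxy fun t _ => hb t

/-- While the orbits of `x` and of a parabolic point `q` stay close, `x` is repelled from `q`. -/
lemma repelled_of_close (hH : ExpandingLift d H) {P : ℕ} {r : ℝ}
    (hper : ∀ q, Parabolic H q → ∃ l : ℤ, H^[P] q = q + l ∧ iterDeriv H P q = 1)
    (hexp : ∀ q, Parabolic H q → ∀ y, y ≠ q → |y - q| < r → 1 < iterDeriv H P y)
    {q x : ℝ} (hq : Parabolic H q) (hxq : x ≠ q) (k : ℕ)
    (hclose : ∀ i < k, |H^[P * i] x - H^[P * i] q| < r) :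
    |x - q| ≤ |H^[P * k] x - H^[P * k] q| ∧ 1 ≤ iterDeriv H (P * k) x ∧
      (1 ≤ k → 1 < iterDeriv H (P * k) x) := by
  induction k with
  | zero => simp
  | succ k ih =>
    obtain ⟨h1, h2, -⟩ := ih fun i hi => hclose i (by omega)
    obtain ⟨l, hl, -⟩ := hper q hq
    obtain ⟨z, hz⟩ := hH.iterate_mul_eq_add hl k
    have hq' : Parabolic H (H^[P * k] q) := by rw [hz]; exact hq.add_int hH z
    have hne : H^[P * k] x ≠ H^[P * k] q := fun h => hxq ((hH.strictMono_iterate _).injective h)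
    have hck := hclose k (Nat.lt_succ_self k)
    have h3 := hexp _ hq' _ hne hck
    rw [Nat.mul_succ, Nat.add_comm (P * k) P, hH.iterDeriv_add, Function.iterate_add_apply,
      Function.iterate_add_apply]
    set y := H^[P * k] x
    set p := H^[P * k] q
    have hD : ∀ t, |t - p| < r → 1 ≤ iterDeriv H P t := fun t ht => by
      by_cases htp : t = p
      · obtain ⟨-, -, h⟩ := hper p hq'
        rw [htp, h]
      · exact (hexp p hq' t htp ht).le
    refine ⟨h1.trans ?_, by nlinarith, fun _ => by nlinarith⟩
    rw [abs_lt] at hck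
    rcases le_total p y with hpy | hpy
    · have := hH.mul_le_sub_of_le_iterDeriv P (S := 1) hpy fun t ht =>
        hD t (by rw [abs_lt]; constructor <;> linarith [ht.1, ht.2])
      rw [abs_of_nonneg (sub_nonneg.2 hpy),
        abs_of_nonneg (sub_nonneg.2 ((hH.strictMono_iterate P).monotone hpy))]
      linarith
    · have := hH.mul_le_sub_of_le_iterDeriv P (S := 1) hpy fun t ht =>
        hD t (by rw [abs_lt]; constructor <;> linarith [ht.1, ht.2])
      rw [abs_of_nonpos (sub_nonpos.2 hpy),
        abs_of_nonpos (sub_nonpos.2 ((hH.strictMono_iterate P).monotone hpy))]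
      linarith

/-- A density that some iterate of `H` expands everywhere except at the parabolic points. Near the
parabolic points the expansion may be arbitrarily weak, so there the density has to increase with
the distance to them; at their other preimages the derivatives of the iterates may stay smaller than
one, so there the density has to be small. -/
theorem exists_density (hH : ExpandingLift d H) : ∃ (N : ℕ) (ψ p : ℝ → ℝ), 1 ≤ N ∧
    ContDiff ℝ ω p ∧ (∀ x, HasDerivAt p (ψ x) x) ∧ (∀ x, 0 < ψ x) ∧ (∀ x, ψ (x + 1) = ψ x) ∧
    ∀ x, ¬ Parabolic H x → ψ x < ψ (H^[N] x) * iterDeriv H N x := by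
  classical
  obtain ⟨P, hP, hper⟩ := hH.exists_common_period
  obtain ⟨c, hc0, hc1, hc⟩ := hH.exists_pos_le_iterDeriv
  obtain ⟨Λ, hΛ1, hΛ⟩ := hH.exists_iterate_lipschitz P
  set F : Finset ℝ := hH.finite_parabolic.toFinset with hF
  have hFmem : ∀ q, q ∈ F ↔ q ∈ Ico (0 : ℝ) 1 ∧ Parabolic H q := fun q => by
    rw [hF, Set.Finite.mem_toFinset, mem_ofPred_eq]
  have hrep : ∀ q, Parabolic H q → ∃ q₀ ∈ F, ∃ z : ℤ, q = q₀ + z := fun q hq => by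
    refine ⟨Int.fract q, (hFmem _).2 ⟨⟨Int.fract_nonneg q, Int.fract_lt_one q⟩, ?_⟩, ⌊q⌋,
      (Int.fract_add_floor q).symm⟩
    have := hq.add_int hH (-⌊q⌋)
    rwa [Int.cast_neg, ← sub_eq_add_neg] at this
  have hpar : ∀ q ∈ F, ∀ z : ℤ, Parabolic H (q + z) := fun q hq z =>
    ((hFmem q).1 hq).2.add_int hH z
  -- distinct parabolic points are at distance at least `1 / (Λ + 1)`
  set σ := 1 / (Λ + 1) with hσ
  have hσ0 : 0 < σ := by positivity
  have hsep : ∀ q q', Parabolic H q → Parabolic H q' → |q - q'| < σ → q = q' := by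
    intro q q' hq hq' hlt
    obtain ⟨l, hl, -⟩ := hper q hq
    obtain ⟨l', hl', -⟩ := hper q' hq'
    have h1 := hΛ q q'
    rw [hl, hl'] at h1
    rw [hσ, lt_div_iff₀ (by linarith)] at hlt
    have h2 : |(l : ℝ) - l'| < 1 := by
      have h3 := abs_sub (q + l - (q' + l')) (q - q')
      rw [show q + l - (q' + l') - (q - q') = (l : ℝ) - l' by ring] at h3
      linarith
    have h4 : |l - l'| < 1 := by exact_mod_cast h2
    have h5 : l = l' := by
      have := Int.abs_lt_one_iff.1 h4
      omega
    rw [h5] at hl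
    exact hH.eq_of_iterate_eq_add hP hl hl'
  -- a uniform radius on which the parabolic points repel
  obtain ⟨r₁', hr₁', hexp'⟩ : ∃ r > 0, ∀ q ∈ F, ∀ y, y ≠ q → |y - q| < r →
      1 < iterDeriv H P y := by
    have : ∀ q ∈ F, ∀ᶠ r in 𝓝[>] (0 : ℝ), ∀ y, y ≠ q → |y - q| < r → 1 < iterDeriv H P y := by
      intro q hq
      obtain ⟨l, hl, -⟩ := hper q ((hFmem q).1 hq).2
      obtain ⟨δ, hδ, h⟩ := Metric.eventually_nhds_iff.1
        (eventually_nhdsWithin_iff.1 (hH.expanding P hP q l hl))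
      filter_upwards [Ioo_mem_nhdsGT hδ] with r hr y hyq hyr
      exact h (by rw [Real.dist_eq]; exact hyr.trans hr.2) hyq
    obtain ⟨r, hr, hr0⟩ := (((Filter.eventually_all_finset F).2 this).and
      self_mem_nhdsWithin).exists
    exact ⟨r, hr0, hr⟩
  set r₁ := min r₁' (σ / (Λ + 1)) with hr₁
  have hr₁0 : 0 < r₁ := lt_min hr₁' (by positivity)
  have hr₁σ : (Λ + 1) * r₁ ≤ σ := by
    have := min_le_right r₁' (σ / (Λ + 1))
    rw [← hr₁, le_div_iff₀ (by linarith)] at this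
    linarith
  have hexp : ∀ q, Parabolic H q → ∀ y, y ≠ q → |y - q| < r₁ → 1 < iterDeriv H P y := by
    intro q hq y hyq hy
    obtain ⟨q₀, hq₀, z, rfl⟩ := hrep q hq
    have h1 := hexp' q₀ hq₀ (y - z) (fun h => hyq (by linarith))
      (by rw [show y - z - q₀ = y - (q₀ + z) by ring]; exact hy.trans_le (min_le_left _ _))
    have h2 := hH.iterDeriv_add_int P (y - z) z
    rw [sub_add_cancel] at h2
    rwa [h2]
  -- points that start `r₀`-close to a parabolic point expand by `3 / c` when leaving it
  obtain ⟨N₁, hN₁⟩ := hH.exists_le_iterDeriv_of_far hr₁0 (3 / c)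
  set r₀ := r₁ / Λ ^ N₁ with hr₀
  have hΛN : 1 ≤ Λ ^ N₁ := one_le_pow₀ hΛ1
  have hr₀0 : 0 < r₀ := by positivity
  have hr₀1 : r₀ ≤ r₁ := div_le_self hr₁0.le hΛN
  have hexit : ∀ q x k, Parabolic H q → |x - q| < r₀ →
      (∃ i < k, r₁ ≤ |H^[P * i] x - H^[P * i] q|) → 3 ≤ iterDeriv H (P * k) x := by
    intro q x k hq hxq hex
    obtain ⟨hik, hi⟩ := Nat.find_spec hex
    have hmin : ∀ j < Nat.find hex, |H^[P * j] x - H^[P * j] q| < r₁ := fun j hj => by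
      by_contra! hcon
      exact Nat.find_min hex hj ⟨hj.trans hik, hcon⟩
    generalize Nat.find hex = i at *
    have hlip : ∀ j, |H^[P * j] x - H^[P * j] q| ≤ Λ ^ j * |x - q| := by
      intro j
      induction j with
      | zero => simp
      | succ j ih =>
        rw [Nat.mul_succ, Nat.add_comm (P * j) P, Function.iterate_add_apply,
          Function.iterate_add_apply, pow_succ', mul_assoc]
        exact (hΛ _ _).trans (mul_le_mul_of_nonneg_left ih (by linarith))
    have hiN : N₁ ≤ i := by
      by_contra! hcon
      have h1 : Λ ^ i * |x - q| < Λ ^ N₁ * r₀ :=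
        mul_lt_mul' (pow_le_pow_right₀ hΛ1 hcon.le) hxq (abs_nonneg _) (by positivity)
      rw [hr₀, mul_div_cancel₀ _ (by positivity)] at h1
      linarith [hlip i]
    have hi0 : i ≠ 0 := by
      rintro rfl
      simp only [mul_zero, Function.iterate_zero, id] at hi
      linarith
    obtain ⟨j, rfl⟩ := Nat.exists_eq_succ_of_ne_zero hi0
    obtain ⟨l, hl, -⟩ := hper q hq
    obtain ⟨z, hz⟩ := hH.iterate_mul_eq_add hl (j + 1)
    have hq' : Parabolic H (H^[P * (j + 1)] q) := by rw [hz]; exact hq.add_int hH z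
    have hup : |H^[P * (j + 1)] x - H^[P * (j + 1)] q| ≤ Λ * r₁ := by
      rw [Nat.mul_succ, Nat.add_comm (P * j) P, Function.iterate_add_apply,
        Function.iterate_add_apply]
      exact (hΛ _ _).trans (mul_le_mul_of_nonneg_left (hmin j (Nat.lt_succ_self j)).le
        (by linarith))
    have hfar : ∀ q'', Parabolic H q'' → r₁ ≤ |H^[P * (j + 1)] x - q''| := by
      intro q'' hq''
      by_contra! hcon
      have h1 : |H^[P * (j + 1)] q - q''| < σ := by
        have := abs_sub_le (H^[P * (j + 1)] q) (H^[P * (j + 1)] x) q''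
        rw [abs_sub_comm (H^[P * (j + 1)] q) (H^[P * (j + 1)] x)] at this
        linarith
      rw [← hsep _ _ hq' hq'' h1] at hcon
      exact absurd hi (not_le.2 hcon)
    have h1 := hN₁ (P * (j + 1)) (hiN.trans (Nat.le_mul_of_pos_left _ hP)) x hfar
    rw [hH.iterDeriv_split (Nat.mul_le_mul_left P hik.le)]
    calc (3 : ℝ) = c * (3 / c) := by field_simp
      _ ≤ _ := mul_le_mul (hc _ _) h1 (by positivity) (hH.iterDeriv_pos _ _).le
  -- the parameter `b` makes the density smaller than `c / 2` at distance `r₀`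
  obtain ⟨t₀, ht₀, hfar₀⟩ := sinSqProd.exists_pos_le (F := F) hr₀0
  -- through the bound `8 / s` for `(1 + 2 s) exp (- s)`
  set b := 16 / (c * t₀) with hb
  have hb0 : 0 < b := by positivity
  obtain ⟨η, hη, hmono⟩ : ∃ η > 0, ∀ q ∈ F, (∀ e e', 0 ≤ e → e ≤ e' → e' ≤ η →
      sinSqProd F (q + e) ≤ sinSqProd F (q + e')) ∧ (∀ e e', 0 ≤ e → e ≤ e' → e' ≤ η →
      sinSqProd F (q - e) ≤ sinSqProd F (q - e')) ∧
      ∀ y, |y - q| < η → b * sinSqProd F y ≤ 1 / 2 := by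
    have : ∀ q ∈ F, ∀ᶠ η in 𝓝[>] (0 : ℝ), (∀ e e', 0 ≤ e → e ≤ e' → e' ≤ η →
        sinSqProd F (q + e) ≤ sinSqProd F (q + e')) ∧ (∀ e e', 0 ≤ e → e ≤ e' → e' ≤ η →
        sinSqProd F (q - e) ≤ sinSqProd F (q - e')) ∧
        ∀ y, |y - q| < η → b * sinSqProd F y ≤ 1 / 2 := by
      intro q hq
      obtain ⟨η, hη, h1, h2⟩ := sinSqProd.exists_monotone hq fun p hp => ((hFmem p).1 hp).1
      have hcont : Continuous fun y => b * sinSqProd F y :=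
        continuous_const.mul sinSqProd.continuous
      have hlt : b * sinSqProd F q < 1 / 2 := by
        rw [sinSqProd.apply_self hq]; norm_num
      obtain ⟨δ, hδ, h3⟩ := Metric.eventually_nhds_iff.1
        (hcont.continuousAt.eventually_lt_const hlt)
      filter_upwards [Ioo_mem_nhdsGT hη, Ioo_mem_nhdsGT hδ] with r hr hr'
      refine ⟨fun e e' he hee he' => h1 _ _ ?_ ?_ ?_, fun e e' he hee he' => h2 _ _ ?_ ?_ ?_,
        fun y hy => (h3 (by rw [Real.dist_eq]; exact hy.trans hr'.2)).le⟩
      all_goals linarith [hr.2]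
    obtain ⟨r, hr, hr0⟩ := (((Filter.eventually_all_finset F).2 this).and
      self_mem_nhdsWithin).exists
    exact ⟨r, hr0, hr⟩
  set r₂ := min η r₁ with hr₂
  have hr₂0 : 0 < r₂ := lt_min hη hr₁0
  obtain ⟨N₂, hN₂⟩ := hH.exists_le_iterDeriv_of_far hr₂0 (3 * Real.exp b)
  obtain ⟨p, hp, hpd⟩ := exists_primitive_bumpDensity F b
  set ψ := bumpDensity F b with hψ
  have hbS : ∀ x, 0 ≤ b * sinSqProd F x := fun x => mul_nonneg hb0.le (sinSqProd.nonneg x)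
  have hψadd : ∀ (x : ℝ) (z : ℤ), ψ (x + z) = ψ x := fun x z => by
    rw [hψ, bumpDensity, bumpDensity, sinSqProd.add_int]
  have hψ2 : ∀ x, ψ x ≤ 2 := fun x => one_add_two_mul_mul_exp_neg_le_two _
  have hψpos : ∀ x, 0 < ψ x := fun x =>
    mul_pos (by linarith [hbS x]) (Real.exp_pos _)
  have hψlow : ∀ x, 1 ≤ ψ x * Real.exp b := fun x => by
    have h1 : b * sinSqProd F x ≤ b := by nlinarith [sinSqProd.le_one (F := F) x]
    have h2 : Real.exp (-b) ≤ ψ x := by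
      rw [hψ, bumpDensity]
      have h3 : Real.exp (-b) ≤ Real.exp (-(b * sinSqProd F x)) :=
        Real.exp_le_exp.2 (by linarith)
      nlinarith [hbS x, Real.exp_pos (-(b * sinSqProd F x))]
    calc (1 : ℝ) = Real.exp (-b) * Real.exp b := by rw [← Real.exp_add]; simp
      _ ≤ _ := mul_le_mul_of_nonneg_right h2 (Real.exp_pos b).le
  have hψsmall : ∀ x, (∀ q, Parabolic H q → r₀ ≤ |x - q|) → ψ x ≤ c / 2 := fun x hx => by
    have h1 := hfar₀ x fun q hq z => hx _ (hpar q hq z)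
    have h2 : 16 / c ≤ b * sinSqProd F x := by
      calc 16 / c = b * t₀ := by rw [hb]; field_simp
        _ ≤ _ := mul_le_mul_of_nonneg_left h1 hb0.le
    have h16 : 0 < 16 / c := by positivity
    refine (one_add_two_mul_mul_exp_neg_le_div (h16.trans_le h2)).trans ?_
    calc 8 / (b * sinSqProd F x) ≤ 8 / (16 / c) :=
          div_le_div_of_nonneg_left (by norm_num) h16 h2
      _ = c / 2 := by field_simp; norm_num
  have hbS2 : ∀ q, Parabolic H q → ∀ y, |y - q| < r₂ → b * sinSqProd F y ≤ 1 / 2 := by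
    intro q hq y hy
    obtain ⟨q₀, hq₀, z, rfl⟩ := hrep q hq
    have h1 := (hmono q₀ hq₀).2.2 (y - z) (by
      rw [show y - z - q₀ = y - (q₀ + z) by ring]; exact hy.trans_le (min_le_left _ _))
    rwa [← sinSqProd.add_int (y - z) z, sub_add_cancel] at h1
  have hψone : ∀ q, Parabolic H q → ∀ y, |y - q| < r₂ → 1 ≤ ψ y := by
    intro q hq y hy
    have := one_add_two_mul_mul_exp_neg_mono le_rfl (hbS y) (hbS2 q hq y hy)
    rw [mul_zero, add_zero, neg_zero, Real.exp_zero, one_mul] at this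
    exact this
  -- the iterate is a multiple of the common period of the parabolic points
  set k := N₂ + 1 with hk
  refine ⟨P * k, ψ, p, Nat.mul_pos hP (Nat.succ_pos _), hp, hpd, hψpos, fun x => ?_, ?_⟩
  · exact_mod_cast hψadd x 1
  intro x hx
  have hDpos := hH.iterDeriv_pos (P * k) x
  -- the image is away from the parabolic points: the derivative of the iterate is huge
  by_cases hA : ∀ q, Parabolic H q → r₂ ≤ |H^[P * k] x - q|
  · have h1 := hN₂ (P * k) ((Nat.le_succ N₂).trans (Nat.le_mul_of_pos_left _ hP)) x hA
    have h2 := hψpos (H^[P * k] x)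
    have h3 := hψlow (H^[P * k] x)
    calc ψ x ≤ 2 := hψ2 x
      _ < 3 * (ψ (H^[P * k] x) * Real.exp b) := by linarith
      _ = ψ (H^[P * k] x) * (3 * Real.exp b) := by ring
      _ ≤ _ := mul_le_mul_of_nonneg_left h1 h2.le
  push Not at hA
  obtain ⟨q', hq', hxq'⟩ := hA
  have hone := hψone q' hq' _ hxq'
  -- only `x` is away from the parabolic points: the density is small at `x`, compared with the
  -- uniform lower bound `c` for the derivatives of the iterates
  by_cases hB : ∀ q, Parabolic H q → r₀ ≤ |x - q|
  · have h1 := hψsmall x hB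
    have h2 := hc (P * k) x
    nlinarith
  push Not at hB
  obtain ⟨q, hq, hxq⟩ := hB
  -- `x` starts near a parabolic point and leaves its neighbourhood, which yields a factor three
  by_cases hex : ∃ i < k, r₁ ≤ |H^[P * i] x - H^[P * i] q|
  · have h1 := hexit q x k hq hxq hex
    have h2 := hψ2 x
    nlinarith
  push Not at hex
  -- `x` follows the orbit of `q` throughout: it is repelled, so the density increases as well
  have hne : x ≠ q := fun h => hx (h ▸ hq)
  obtain ⟨hfarther, -, hgt⟩ := hH.repelled_of_close hper hexp hq hne k hex
  have hgt := hgt (Nat.succ_pos _)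
  obtain ⟨l, hl, -⟩ := hper q hq
  obtain ⟨z, hz⟩ := hH.iterate_mul_eq_add hl k
  have hqk : Parabolic H (H^[P * k] q) := by rw [hz]; exact hq.add_int hH z
  -- the parabolic point near `H^[P * k] x` is the image of `q`
  have hq'eq : H^[P * k] q = q' := by
    refine hsep _ _ hqk hq' ?_
    have h1 : |H^[P * k] x - H^[P * k] q| ≤ Λ * r₁ := by
      rw [hk, Nat.mul_succ, Nat.add_comm (P * N₂) P, Function.iterate_add_apply,
        Function.iterate_add_apply]
      exact (hΛ _ _).trans (mul_le_mul_of_nonneg_left (hex N₂ (Nat.lt_succ_self _)).le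
        (by linarith))
    have h2 := abs_sub_le (H^[P * k] q) (H^[P * k] x) q'
    rw [abs_sub_comm (H^[P * k] q) (H^[P * k] x)] at h2
    have h3 : r₂ ≤ r₁ := min_le_right _ _
    linarith
  rw [← hq'eq] at hxq'
  have hψle : ψ x ≤ ψ (H^[P * k] x) := by
    refine one_add_two_mul_mul_exp_neg_mono (hbS x) (mul_le_mul_of_nonneg_left ?_ hb0.le)
      (hbS2 _ hqk _ hxq')
    obtain ⟨q₀, hq₀, z₀, hq₀z⟩ := hrep q hq
    have hr₂η : r₂ ≤ η := min_le_left _ _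
    have e1 : ∀ e, sinSqProd F (q + e) = sinSqProd F (q₀ + e) := fun e => by
      rw [hq₀z, show q₀ + z₀ + e = q₀ + e + z₀ by ring, sinSqProd.add_int]
    have e2 : sinSqProd F (H^[P * k] x) =
        sinSqProd F (q₀ + (H^[P * k] x - H^[P * k] q)) := by
      rw [← e1, hz, ← sinSqProd.add_int (q + (H^[P * k] x - (q + z))) z]
      congr 1; ring
    have e3 : sinSqProd F x = sinSqProd F (q₀ + (x - q)) := by rw [← e1]; congr 1; ring
    rw [e2, e3]
    rcases hne.lt_or_gt with h | h
    · have h' := hH.strictMono_iterate (P * k) h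
      rw [abs_of_neg (sub_neg.2 h')] at hxq' hfarther
      rw [abs_of_neg (sub_neg.2 h)] at hfarther
      have := (hmono q₀ hq₀).2.1 (-(x - q)) (-(H^[P * k] x - H^[P * k] q)) (by linarith) hfarther
        (by linarith)
      rwa [sub_neg_eq_add, sub_neg_eq_add] at this
    · have h' := hH.strictMono_iterate (P * k) h
      rw [abs_of_pos (sub_pos.2 h')] at hxq' hfarther
      rw [abs_of_pos (sub_pos.2 h)] at hfarther
      exact (hmono q₀ hq₀).1 _ _ (by linarith) hfarther (by linarith)
  calc ψ x ≤ ψ (H^[P * k] x) := hψle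
    _ = ψ (H^[P * k] x) * 1 := (mul_one _).symm
    _ < _ := mul_lt_mul_of_pos_left hgt (hψpos _)

end ExpandingLift

/-! ### Regularity classes of periodic functions -/

lemma exists_abs_le_of_periodic {f : ℝ → ℝ} (hf : Function.Periodic f 1) (hc : Continuous f) :
    ∃ M : ℝ, ∀ x, |f x| ≤ M := by
  obtain ⟨M, hM⟩ := (hf.compact_of_continuous one_ne_zero hc).isBounded.exists_norm_le
  exact ⟨M, fun x => hM _ (mem_range_self x)⟩

lemma exists_pos_le_of_periodic {f : ℝ → ℝ} (hf : Function.Periodic f 1) (hc : Continuous f)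
    (hpos : ∀ x, 0 < f x) : ∃ m > 0, ∀ x, m ≤ f x := by
  obtain ⟨_, ⟨x₀, rfl⟩, h⟩ :=
    (hf.compact_of_continuous one_ne_zero hc).exists_isLeast (range_nonempty f)
  exact ⟨f x₀, hpos x₀, fun x => h (mem_range_self x)⟩

/-- A function with a periodic continuous derivative is Lipschitz. -/
lemma exists_lipschitzWith {G : ℝ → ℝ} (hG : ContDiff ℝ 1 G)
    (hp : Function.Periodic (deriv G) 1) : ∃ K, LipschitzWith K G := by
  obtain ⟨M, hM⟩ := exists_abs_le_of_periodic hp (hG.continuous_deriv le_rfl)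
  refine ⟨M.toNNReal, lipschitzWith_of_nnnorm_deriv_le (hG.differentiable one_ne_zero) fun x => ?_⟩
  rw [← NNReal.coe_le_coe, coe_nnnorm]
  exact (hM x).trans (Real.le_coe_toNNReal M)

lemma periodic_deriv_of_add_one {G : ℝ → ℝ} {m : ℝ} (hG : ∀ x, G (x + 1) = G x + m) :
    Function.Periodic (deriv G) 1 := fun x => by
  rw [← deriv_comp_add_const, funext hG, deriv_add_const]

/-- The properties of a class `B` of continuous `1`-periodic functions that make "`f` has `n`
derivatives, the last one in `B`" a regularity stable under the operations needed for circle
diffeomorphisms. Both Hölder continuity and bounded variation are such classes. -/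
structure PeriodicClass (B : (ℝ → ℝ) → Prop) : Prop where
  periodic {f : ℝ → ℝ} : B f → Function.Periodic f 1
  continuous {f : ℝ → ℝ} : B f → Continuous f
  of_lipschitz {f : ℝ → ℝ} {K : ℝ≥0} : Function.Periodic f 1 → LipschitzWith K f → B f
  add {f g : ℝ → ℝ} : B f → B g → B (fun x => f x + g x)
  lipschitz_comp {f F : ℝ → ℝ} {K : ℝ≥0} {s : Set ℝ} : B f → LipschitzOnWith K F s →
    (∀ x, f x ∈ s) → B (fun x => F (f x))
  comp {f G : ℝ → ℝ} {K : ℝ≥0} {m : ℤ} : B f → Monotone G → LipschitzWith K G →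
    (∀ x, G (x + 1) = G x + m) → B (fun x => f (G x))

namespace PeriodicClass

variable {B : (ℝ → ℝ) → Prop} {f g : ℝ → ℝ}

lemma of_contDiff (hB : PeriodicClass B) (hp : Function.Periodic f 1) (hf : ContDiff ℝ 1 f) :
    B f := by
  obtain ⟨K, hK⟩ := exists_lipschitzWith hf
    (periodic_deriv_of_add_one (m := 0) fun x => by rw [hp x, add_zero])
  exact hB.of_lipschitz hp hK

lemma contDiff_comp (hB : PeriodicClass B) {F : ℝ → ℝ} {a b : ℝ} (hf : B f)
    (hF : ContDiffOn ℝ 1 F (Icc a b)) (hab : ∀ x, f x ∈ Icc a b) : B (fun x => F (f x)) := by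
  obtain ⟨K, hK⟩ := hF.exists_lipschitzOnWith one_ne_zero (convex_Icc a b) isCompact_Icc
  exact hB.lipschitz_comp hf hK hab

lemma const_mul (hB : PeriodicClass B) (c : ℝ) (hf : B f) : B (fun x => c * f x) := by
  obtain ⟨M, hM⟩ := exists_abs_le_of_periodic (hB.periodic hf) (hB.continuous hf)
  exact hB.contDiff_comp (F := fun y => c * y) hf (by fun_prop) fun x => abs_le.1 (hM x)

/-- Products are controlled through `f * g = ((f + g) ^ 2 - (f - g) ^ 2) / 4`. -/
lemma mul (hB : PeriodicClass B) (hf : B f) (hg : B g) : B (fun x => f x * g x) := by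
  have hsq : ∀ {u : ℝ → ℝ}, B u → B (fun x => u x ^ 2) := fun {u} hu => by
    obtain ⟨M, hM⟩ := exists_abs_le_of_periodic (hB.periodic hu) (hB.continuous hu)
    exact hB.contDiff_comp (F := fun y => y ^ 2) hu (by fun_prop) fun x => abs_le.1 (hM x)
  have h := hB.add (hB.const_mul (1 / 4) (hsq (hB.add hf hg)))
    (hB.const_mul (-1 / 4) (hsq (hB.add hf (hB.const_mul (-1) hg))))
  convert h using 2
  ring

lemma inv (hB : PeriodicClass B) (hf : B f) (hpos : ∀ x, 0 < f x) : B (fun x => (f x)⁻¹) := by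
  obtain ⟨M, hM⟩ := exists_abs_le_of_periodic (hB.periodic hf) (hB.continuous hf)
  obtain ⟨m, hm, hmf⟩ := exists_pos_le_of_periodic (hB.periodic hf) (hB.continuous hf) hpos
  exact hB.contDiff_comp (F := fun y => y⁻¹) (a := m) (b := M) hf
    (contDiffOn_id.inv fun x hx => (hm.trans_le hx.1).ne')
    fun x => ⟨hmf x, (le_abs_self _).trans (hM x)⟩

end PeriodicClass

/-- `f` is `1`-periodic and has `n` derivatives, the last of which belongs to the class `B`. -/
def IterClass (B : (ℝ → ℝ) → Prop) : ℕ → (ℝ → ℝ) → Prop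
  | 0, f => B f
  | n + 1, f => Function.Periodic f 1 ∧ Differentiable ℝ f ∧ IterClass B n (deriv f)

namespace IterClass

variable {B : (ℝ → ℝ) → Prop} {f g G : ℝ → ℝ} {n : ℕ}

lemma periodic (hB : PeriodicClass B) (hf : IterClass B n f) : Function.Periodic f 1 := by
  cases n with
  | zero => exact hB.periodic hf
  | succ n => exact hf.1

lemma iff_iteratedDeriv (hB : PeriodicClass B) (hp : Function.Periodic f 1) :
    IterClass B n f ↔ ContDiff ℝ n f ∧ B (iteratedDeriv n f) := by
  induction n generalizing f with
  | zero =>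
    rw [iteratedDeriv_zero, Nat.cast_zero, contDiff_zero]
    exact ⟨fun h => ⟨hB.continuous h, h⟩, fun h => h.2⟩
  | succ n ih =>
    have hp' := periodic_deriv_of_add_one (G := f) (m := 0) fun x => by rw [hp x, add_zero]
    rw [IterClass, ih hp', iteratedDeriv_succ', Nat.cast_succ, contDiff_succ_iff_deriv]
    have : ((n : ℕ∞ω) = ω → AnalyticOn ℝ f univ) := fun h => absurd h (by simp)
    tauto

lemma contDiff (hB : PeriodicClass B) (hf : IterClass B n f) : ContDiff ℝ n f :=
  ((iff_iteratedDeriv hB (periodic hB hf)).1 hf).1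

lemma of_contDiff (hB : PeriodicClass B) (hp : Function.Periodic f 1) (hf : ContDiff ℝ ω f) :
    IterClass B n f := by
  rw [iff_iteratedDeriv hB hp]
  refine ⟨hf.of_le le_top, hB.of_contDiff ?_ ?_⟩
  · intro x
    have h := congrFun (iteratedDeriv_comp_add_const (n := n) (f := f) (s := 1)) x
    rw [← h, funext hp]
  · have := hf.of_le (m := (1 + n : ℕ)) le_top
    rw [iteratedDeriv_eq_iterate]
    exact_mod_cast ContDiff.iterate_deriv' 1 n this

lemma of_succ (hB : PeriodicClass B) (hf : IterClass B (n + 1) f) : IterClass B n f := by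
  induction n generalizing f with
  | zero => exact hB.of_contDiff hf.1 (contDiff hB hf)
  | succ n ih => exact ⟨hf.1, hf.2.1, ih hf.2.2⟩

lemma of_le (hB : PeriodicClass B) {k : ℕ} (hk : k ≤ n) (hf : IterClass B n f) :
    IterClass B k f := by
  induction hk with
  | refl => exact hf
  | step _ ih => exact ih (hf.of_succ hB)

lemma add (hB : PeriodicClass B) (hf : IterClass B n f) (hg : IterClass B n g) :
    IterClass B n (fun x => f x + g x) := by
  induction n generalizing f g with
  | zero => exact hB.add hf hg
  | succ n ih =>
    refine ⟨hf.1.add hg.1, hf.2.1.add hg.2.1, ?_⟩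
    rw [show deriv (fun x => f x + g x) = fun x => deriv f x + deriv g x from
      funext fun x => deriv_fun_add (hf.2.1 x) (hg.2.1 x)]
    exact ih hf.2.2 hg.2.2

lemma mul (hB : PeriodicClass B) (hf : IterClass B n f) (hg : IterClass B n g) :
    IterClass B n (fun x => f x * g x) := by
  induction n generalizing f g with
  | zero => exact hB.mul hf hg
  | succ n ih =>
    refine ⟨hf.1.mul hg.1, hf.2.1.mul hg.2.1, ?_⟩
    rw [show deriv (fun x => f x * g x) = fun x => deriv f x * g x + f x * deriv g x from
      funext fun x => deriv_fun_mul (hf.2.1 x) (hg.2.1 x)]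
    exact (ih hf.2.2 (hg.of_succ hB)).add hB (ih (hf.of_succ hB) hg.2.2)

lemma const (hB : PeriodicClass B) (c : ℝ) : IterClass B n (fun _ => c) :=
  of_contDiff hB (fun _ => rfl) contDiff_const

lemma inv (hB : PeriodicClass B) (hf : IterClass B n f) (hpos : ∀ x, 0 < f x) :
    IterClass B n (fun x => (f x)⁻¹) := by
  induction n generalizing f with
  | zero => exact hB.inv hf hpos
  | succ n ih =>
    refine ⟨fun x => congrArg _ (hf.1 x), hf.2.1.inv fun x => (hpos x).ne', ?_⟩
    have hi := ih (hf.of_succ hB) hpos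
    rw [show deriv (fun x => (f x)⁻¹) = fun x => (-1 * deriv f x) * ((f x)⁻¹ * (f x)⁻¹) from
      funext fun x => by
        rw [deriv_fun_inv'' (hf.2.1 x) (hpos x).ne']
        field_simp]
    exact ((const hB (-1)).mul hB hf.2.2).mul hB (hi.mul hB hi)

lemma comp (hB : PeriodicClass B) {m : ℤ} (hf : IterClass B n f) (hG : ContDiff ℝ 1 G)
    (hmono : Monotone G) (hGm : ∀ x, G (x + 1) = G x + m)
    (hd : ∀ k < n, IterClass B k (deriv G)) : IterClass B n (fun x => f (G x)) := by
  induction n generalizing f with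
  | zero =>
    obtain ⟨K, hK⟩ := exists_lipschitzWith hG (periodic_deriv_of_add_one hGm)
    exact hB.comp hf hmono hK hGm
  | succ n ih =>
    refine ⟨fun x => ?_, hf.2.1.comp (hG.differentiable one_ne_zero), ?_⟩
    · show f (G (x + 1)) = f (G x)
      rw [hGm, show (m : ℝ) = m * 1 by ring, hf.1.int_mul m (G x)]
    · rw [show deriv (fun x => f (G x)) = fun x => deriv f (G x) * deriv G x from
        funext fun x => deriv_comp x (hf.2.1 _) (hG.differentiable one_ne_zero x)]
      exact (ih hf.2.2 fun k hk => hd k (hk.trans (Nat.lt_succ_self n))).mul hB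
        (hd n (Nat.lt_succ_self n))

/-- Regularity of the inverse `G` of a function `Φ`, through the equation `G' = F ∘ G` with
`F = 1 / Φ'`. -/
lemma deriv_of_eq_comp (hB : PeriodicClass B) {F : ℝ → ℝ} {m : ℤ} (hF : IterClass B n F)
    (hG : ContDiff ℝ 1 G) (hmono : Monotone G) (hGm : ∀ x, G (x + 1) = G x + m)
    (h : ∀ x, deriv G x = F (G x)) : IterClass B n (deriv G) := by
  have h' : deriv G = fun x => F (G x) := funext h
  have key : ∀ k ≤ n, IterClass B k (deriv G) := by
    intro k
    induction k using Nat.strong_induction_on with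
    | _ k ih =>
      intro hk
      rw [h']
      exact (hF.of_le hB hk).comp hB hG hmono hGm fun j hj => ih j hj (hj.le.trans hk)
  exact key n le_rfl

end IterClass

/-- Continuous `1`-periodic functions that are `ε`-Hölder. -/
def PeriodicHolder (ε : ℝ≥0) (f : ℝ → ℝ) : Prop :=
  Function.Periodic f 1 ∧ Continuous f ∧ ∃ K : ℝ≥0, HolderWith K ε f

lemma periodicClass_periodicHolder {ε : ℝ≥0} (hε : ε ≤ 1) :
    PeriodicClass (PeriodicHolder ε) where
  periodic h := h.1
  continuous h := h.2.1
  of_lipschitz {f K} hp hK := by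
    refine ⟨hp, hK.continuous, ?_⟩
    obtain ⟨M, hM⟩ := exists_abs_le_of_periodic hp hK.continuous
    have h0 : HolderWith (2 * M.toNNReal) 0 f := fun x y => by
      rw [NNReal.coe_zero, ENNReal.rpow_zero, mul_one, edist_nndist, ENNReal.coe_le_coe,
        ← NNReal.coe_le_coe, coe_nndist, Real.dist_eq]
      have h1 := abs_sub (f x) (f y)
      have h2 := Real.le_coe_toNNReal M
      push_cast
      linarith [hM x, hM y]
    exact ⟨_, h0.of_le_of_le (holderWith_one.2 hK) zero_le hε⟩
  add hf hg := by
    obtain ⟨K, hK⟩ := hf.2.2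
    obtain ⟨L, hL⟩ := hg.2.2
    exact ⟨hf.1.add hg.1, hf.2.1.add hg.2.1, _, hK.add hL⟩
  lipschitz_comp {f F K s} hf hF hs := by
    obtain ⟨L, hL⟩ := hf.2.2
    refine ⟨fun x => congrArg F (hf.1 x), hF.continuousOn.comp_continuous hf.2.1 hs,
      K * L ^ ((1 : ℝ≥0) : ℝ), ?_⟩
    have := (holderOnWith_one.2 hF).comp_holderWith hL hs
    rwa [one_mul] at this
  comp {f G K m} hf hmono hG hGm := by
    obtain ⟨L, hL⟩ := hf.2.2
    refine ⟨fun x => ?_, hf.2.1.comp hG.continuous, L * K ^ (ε : ℝ), ?_⟩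
    · show f (G (x + 1)) = f (G x)
      rw [hGm, show (m : ℝ) = m * 1 by ring, hf.1.int_mul m (G x)]
    · have := hL.comp (holderWith_one.2 hG)
      rwa [mul_one] at this

/-- Continuous `1`-periodic functions that have bounded variation on bounded intervals. -/
def PeriodicBV (f : ℝ → ℝ) : Prop :=
  Function.Periodic f 1 ∧ Continuous f ∧ ∀ a b, BoundedVariationOn f (Icc a b)

lemma periodicBV_of_Icc {f : ℝ → ℝ} (hp : Function.Periodic f 1) (hc : Continuous f)
    (h : BoundedVariationOn f (Icc 0 1)) : PeriodicBV f := by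
  have htr : ∀ (a b : ℝ) (z : ℤ),
      eVariationOn f (Icc a b) ≤ eVariationOn f (Icc (a + z) (b + z)) := by
    intro a b z
    have h1 := eVariationOn.comp_le_of_monotoneOn f (s := Icc (a + z) (b + z)) (t := Icc a b)
      (fun x => x + z) (fun x _ y _ hxy => by simpa using hxy)
      fun x hx => ⟨by linarith [hx.1], by linarith [hx.2]⟩
    have h2 : f ∘ (fun x => x + (z : ℝ)) = f := funext fun x => by
      simp only [Function.comp]
      rw [show (z : ℝ) = z * 1 by ring, hp.int_mul z x]
    rwa [h2] at h1
  have hn : ∀ n : ℕ, BoundedVariationOn f (Icc 0 (n : ℝ)) := by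
    intro n
    induction n with
    | zero => exact BoundedVariationOn.of_subsingleton (by simp)
    | succ n ih =>
      have hu : Icc (0 : ℝ) (n + 1 : ℕ) = Icc 0 (n : ℝ) ∪ Icc (n : ℝ) (n + 1) := by
        rw [Icc_union_Icc_eq_Icc n.cast_nonneg (by linarith)]
        push_cast; rfl
      rw [hu, BoundedVariationOn, eVariationOn.union f (isGreatest_Icc n.cast_nonneg)
        (isLeast_Icc (by linarith))]
      refine ENNReal.add_ne_top.2 ⟨ih, ne_top_of_le_ne_top h ?_⟩
      have := htr n (n + 1) (-n)
      simpa using this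
  refine ⟨hp, hc, fun a b => ?_⟩
  obtain ⟨N, hN⟩ := exists_nat_ge (max (-a) b)
  have h1 := (max_le_iff.1 hN).1
  have h2 := (max_le_iff.1 hN).2
  refine ne_top_of_le_ne_top (hn (2 * N)) ((htr a b N).trans (eVariationOn.mono f ?_))
  push_cast
  exact Icc_subset_Icc (by linarith) (by linarith)

lemma boundedVariationOn_add {f g : ℝ → ℝ} {s : Set ℝ} (hf : BoundedVariationOn f s)
    (hg : BoundedVariationOn g s) : BoundedVariationOn (fun x => f x + g x) s := by
  refine ne_top_of_le_ne_top (ENNReal.add_ne_top.2 ⟨hf, hg⟩) (iSup_le ?_)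
  rintro ⟨n, u, hu, us⟩
  calc ∑ i ∈ Finset.range n, edist (f (u (i + 1)) + g (u (i + 1))) (f (u i) + g (u i))
      ≤ ∑ i ∈ Finset.range n, (edist (f (u (i + 1))) (f (u i)) +
          edist (g (u (i + 1))) (g (u i))) :=
        Finset.sum_le_sum fun i _ => edist_add_add_le _ _ _ _
    _ = _ := Finset.sum_add_distrib
    _ ≤ _ := add_le_add (eVariationOn.sum_le hu us) (eVariationOn.sum_le hu us)

lemma periodicClass_periodicBV : PeriodicClass PeriodicBV where
  periodic h := h.1
  continuous h := h.2.1
  of_lipschitz hp hK := ⟨hp, hK.continuous, fun a b =>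
    hK.comp_boundedVariationOn (BoundedVariationOn.id_Icc a b)⟩
  add hf hg := ⟨hf.1.add hg.1, hf.2.1.add hg.2.1, fun a b =>
    boundedVariationOn_add (hf.2.2 a b) (hg.2.2 a b)⟩
  lipschitz_comp hf hF hs := ⟨fun x => congrArg _ (hf.1 x),
    hF.continuousOn.comp_continuous hf.2.1 hs, fun a b =>
    hF.comp_boundedVariationOn (fun x _ => hs x) (hf.2.2 a b)⟩
  comp {f G K m} hf hmono hG hGm := by
    refine ⟨fun x => ?_, hf.2.1.comp hG.continuous, fun a b => ?_⟩
    · show f (G (x + 1)) = f (G x)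
      rw [hGm, show (m : ℝ) = m * 1 by ring, hf.1.int_mul m (G x)]
    · exact ne_top_of_le_ne_top (hf.2.2 (G a) (G b)) (eVariationOn.comp_le_of_monotoneOn f G
        (hmono.monotoneOn _) fun x hx => ⟨hmono hx.1, hmono hx.2⟩)

/-! ### The conjugacy on the line -/

/-- `Φ` is a lift of a circle diffeomorphism, with derivative `ρ`, which is as smooth as `H` and for
which the metric `ρ |dx|` is expanded by `H` away from the parabolic points. -/
structure ExpandingChart (H Φ ρ : ℝ → ℝ) : Prop where
  hasDerivAt : ∀ x, HasDerivAt Φ (ρ x) x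
  pos : ∀ x, 0 < ρ x
  continuous : Continuous ρ
  add_one : ∀ x, Φ (x + 1) = Φ x + 1
  expanding : ∀ x, ¬ Parabolic H x → ρ x < ρ (H x) * deriv H x
  contDiff : ∀ n : ℕ∞ω, ContDiff ℝ n H → ContDiff ℝ n Φ
  iterClass : ∀ B, PeriodicClass B → ∀ n, IterClass B n (deriv H) → IterClass B n ρ

namespace ExpandingLift

variable {d : ℕ} {H : ℝ → ℝ}

lemma iterClass_iterDeriv (hH : ExpandingLift d H) {B : (ℝ → ℝ) → Prop} (hB : PeriodicClass B)
    {n : ℕ} (hn : IterClass B n (deriv H)) (k : ℕ) : IterClass B n (iterDeriv H k) := by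
  induction k with
  | zero =>
    rw [show iterDeriv H 0 = fun _ => 1 from funext fun x => iterDeriv_zero x]
    exact IterClass.const hB 1
  | succ k ih =>
    rw [show iterDeriv H (k + 1) = fun x => deriv H (H^[k] x) * iterDeriv H k x from
      funext fun x => hH.iterDeriv_succ k x]
    refine IterClass.mul hB ?_ ih
    exact hn.comp hB (m := 1 * d ^ k) (hH.contDiff_iterate k) (hH.strictMono_iterate k).monotone
      (fun x => by simpa using hH.iterate_add_int k x 1) fun j hj => ih.of_le hB hj.le

/-- The sum `∑ ψ (H^[k] x) (H^[k])' x`, over `k < N`, turns the expansion of the metric `ψ |dx|` by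
`H^[N]` into expansion by `H` itself, since the two differences telescope to the same quantity. -/
theorem exists_expandingChart (hH : ExpandingLift d H) : ∃ Φ ρ, ExpandingChart H Φ ρ := by
  obtain ⟨N, ψ, p, hN, hp, hpψ, hψpos, hψper, hψ⟩ := hH.exists_density
  set Φ₀ : ℝ → ℝ := fun x => ∑ k ∈ Finset.range N, p (H^[k] x) with hΦ₀
  set ρ₀ : ℝ → ℝ := fun x => ∑ k ∈ Finset.range N, ψ (H^[k] x) * iterDeriv H k x with hρ₀
  have hψω : ContDiff ℝ ω ψ := by
    have : deriv p = ψ := funext fun x => (hpψ x).deriv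
    rw [← this]
    exact (contDiff_succ_iff_deriv.1 (show ContDiff ℝ (ω + 1) p from hp)).2.2
  have hψz : Function.Periodic ψ 1 := hψper
  have hder : ∀ x, HasDerivAt Φ₀ (ρ₀ x) x := fun x =>
    HasDerivAt.fun_sum fun k _ => (hpψ _).comp x (hH.hasDerivAt_iterate k x)
  have hρ₀pos : ∀ x, 0 < ρ₀ x := fun x =>
    Finset.sum_pos (fun k _ => mul_pos (hψpos _) (hH.iterDeriv_pos k x)) ⟨0, Finset.mem_range.2 hN⟩
  have hclass : ∀ B, PeriodicClass B → ∀ n, IterClass B n (deriv H) → IterClass B n ρ₀ := by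
    intro B hB n hn
    have : ∀ s : Finset ℕ,
        IterClass B n (fun x => ∑ k ∈ s, ψ (H^[k] x) * iterDeriv H k x) := by
      intro s
      induction s using Finset.cons_induction with
      | empty => simpa using IterClass.const hB 0
      | cons k s hk ih =>
        simp only [Finset.sum_cons]
        have hk := hH.iterClass_iterDeriv hB hn k
        refine IterClass.add hB (IterClass.mul hB ?_ hk) ih
        exact (IterClass.of_contDiff hB hψz hψω).comp hB (m := 1 * d ^ k) (hH.contDiff_iterate k)
          (hH.strictMono_iterate k).monotone
          (fun x => by simpa using hH.iterate_add_int k x 1) fun j hj => hk.of_le hB hj.le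
    exact this _
  have hBV : PeriodicBV ρ₀ := by
    refine hclass PeriodicBV periodicClass_periodicBV 0 (periodicBV_of_Icc (fun x => ?_)
      (hH.contDiff.continuous_deriv le_rfl) hH.boundedVariation)
    simpa using hH.deriv_add_int x 1
  -- the increment of `Φ₀` over a period is a constant, by which `Φ₀` is divided
  set c := Φ₀ 1 - Φ₀ 0 with hc
  have hc0 : 0 < c := by
    have : StrictMono Φ₀ := strictMono_of_deriv_pos fun x => by
      rw [(hder x).deriv]; exact hρ₀pos x
    exact sub_pos.2 (this one_pos)
  have hincr : ∀ x, Φ₀ (x + 1) = Φ₀ x + c := by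
    have hd : ∀ x, HasDerivAt (fun x => Φ₀ (x + 1) - Φ₀ x) 0 x := fun x => by
      have := ((hder (x + 1)).comp_add_const x 1).sub (hder x)
      rwa [hBV.1 x, sub_self] at this
    intro x
    have := is_const_of_deriv_eq_zero (fun x => (hd x).differentiableAt) (fun x => (hd x).deriv) x 0
    simp only [zero_add] at this
    linarith
  have htel : ∀ x, ρ₀ (H x) * deriv H x - ρ₀ x = ψ (H^[N] x) * iterDeriv H N x - ψ x := by
    intro x
    have h1 : ρ₀ (H x) * deriv H x =
        ∑ k ∈ Finset.range N, ψ (H^[k + 1] x) * iterDeriv H (k + 1) x := by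
      simp only [hρ₀, Finset.sum_mul]
      refine Finset.sum_congr rfl fun k _ => ?_
      rw [hH.iterDeriv_add k 1 x, iterDeriv_one, Function.iterate_succ_apply,
        Function.iterate_one, mul_assoc]
    rw [h1, hρ₀, ← Finset.sum_sub_distrib,
      Finset.sum_range_sub (fun k => ψ (H^[k] x) * iterDeriv H k x), iterDeriv_zero]
    simp
  refine ⟨fun x => c⁻¹ * Φ₀ x, fun x => c⁻¹ * ρ₀ x, ?_, ?_, ?_, ?_, ?_, ?_, ?_⟩
  · exact fun x => (hder x).const_mul _
  · exact fun x => mul_pos (inv_pos.2 hc0) (hρ₀pos x)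
  · exact continuous_const.mul hBV.2.1
  · intro x
    rw [hincr, mul_add, inv_mul_cancel₀ hc0.ne']
  · intro x hx
    rw [mul_assoc]
    exact mul_lt_mul_of_pos_left (by linarith [htel x, hψ x hx]) (inv_pos.2 hc0)
  · intro n hn
    have hiter : ∀ k, ContDiff ℝ n (H^[k]) := fun k => by
      induction k with
      | zero => exact contDiff_id
      | succ k ih => exact ih.comp hn
    exact contDiff_const.mul (ContDiff.sum fun k _ => (hp.of_le le_top).comp (hiter k))
  · exact fun B hB n hn => IterClass.mul hB (IterClass.const hB _) (hclass B hB n hn)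

end ExpandingLift

/-- The normalisation that moves the fixed point of the lift to the origin. -/
def shiftLift (H : ℝ → ℝ) (a : ℝ) (x : ℝ) : ℝ := H (x + a) - a

lemma iterate_shiftLift (H : ℝ → ℝ) (a : ℝ) (n : ℕ) (x : ℝ) :
    (shiftLift H a)^[n] x = H^[n] (x + a) - a := by
  induction n generalizing x with
  | zero => simp
  | succ n ih => rw [Function.iterate_succ_apply, ih, Function.iterate_succ_apply]; simp [shiftLift]

lemma iterDeriv_shiftLift (H : ℝ → ℝ) (a : ℝ) (n : ℕ) (x : ℝ) :
    iterDeriv (shiftLift H a) n x = iterDeriv H n (x + a) := by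
  rw [iterDeriv, iterDeriv, funext (iterate_shiftLift H a n), deriv_sub_const,
    deriv_comp_add_const]

lemma deriv_shiftLift (H : ℝ → ℝ) (a x : ℝ) : deriv (shiftLift H a) x = deriv H (x + a) := by
  rw [← ExpandingLift.iterDeriv_one, iterDeriv_shiftLift, ExpandingLift.iterDeriv_one]

lemma parabolic_shiftLift {H : ℝ → ℝ} {a x : ℝ} :
    Parabolic (shiftLift H a) x ↔ Parabolic H (x + a) := by
  simp only [Parabolic, iterate_shiftLift, iterDeriv_shiftLift, sub_eq_iff_eq_add,
    show ∀ l : ℤ, x + (l : ℝ) + a = x + a + l from fun l => by ring]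

lemma ExpandingChart.of_shiftLift {H Φ ρ : ℝ → ℝ} {a : ℝ}
    (h : ExpandingChart (shiftLift H a) Φ ρ) :
    ExpandingChart H (fun x => Φ (x - a)) (fun x => ρ (x - a)) where
  hasDerivAt x := by
    simpa using (h.hasDerivAt (x - a)).comp_sub_const x a
  pos x := h.pos _
  continuous := h.continuous.comp (continuous_sub_right a)
  add_one x := by rw [← h.add_one]; congr 1; ring
  expanding x hx := by
    have := h.expanding (x - a) (by rwa [parabolic_shiftLift, sub_add_cancel])
    rwa [deriv_shiftLift, shiftLift, sub_add_cancel] at this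
  contDiff n hn := by
    refine (h.contDiff n ?_).comp (contDiff_id.sub contDiff_const)
    exact (hn.comp (contDiff_id.add contDiff_const)).sub contDiff_const
  iterClass B hB n hn := by
    have htr : ∀ (b : ℝ) {f : ℝ → ℝ}, IterClass B n f → IterClass B n (fun x => f (x + b)) := by
      intro b f hf
      refine hf.comp hB (G := fun x => x + b) (m := 1) (by fun_prop)
        (fun x y hxy => by simpa using hxy) (fun x => by push_cast; ring) fun k _ => ?_
      rw [show deriv (fun x => x + b) = fun _ => 1 from funext fun x => by simp]
      exact IterClass.const hB 1
    have h1 := h.iterClass B hB n (by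
      rw [show deriv (shiftLift H a) = fun x => deriv H (x + a) from
        funext (deriv_shiftLift H a)]
      exact htr a hn)
    simpa only [sub_eq_add_neg] using htr (-a) h1

/-! ### Circle maps and their lifts -/

lemma coe_eq_coe_iff_exists_int {x y : ℝ} :
    (x : UnitAddCircle) = y ↔ ∃ l : ℤ, x = y + l := by
  rw [← sub_eq_zero, ← AddCircle.coe_sub, AddCircle.coe_eq_zero_iff]
  exact exists_congr fun l => by rw [zsmul_one]; constructor <;> intro h <;> linarith

lemma coe_add_int (x : ℝ) (l : ℤ) : ((x + l : ℝ) : UnitAddCircle) = x :=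
  coe_eq_coe_iff_exists_int.2 ⟨l, rfl⟩

namespace IsLift

variable {F G : ℝ → ℝ} {f g : UnitAddCircle → UnitAddCircle}

lemma comp (hF : IsLift F f) (hG : IsLift G g) : IsLift (F ∘ G) (f ∘ g) where
  continuous := hF.continuous.comp hG.continuous
  coe_eq x := by simp only [Function.comp, hF.coe_eq, hG.coe_eq]

lemma iterate (hF : IsLift F f) (n : ℕ) : IsLift (F^[n]) (f^[n]) := by
  induction n with
  | zero => exact ⟨continuous_id, fun _ => rfl⟩
  | succ n ih => exact ih.comp hF

lemma add_int (hF : IsLift F f) (z : ℤ) : IsLift (fun x => F x + z) f where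
  continuous := hF.continuous.add continuous_const
  coe_eq x := by rw [coe_add_int, hF.coe_eq]

lemma exists_eq_add_int (hF : IsLift F f) (hG : IsLift G f) : ∃ z : ℤ, ∀ x, G x = F x + z := by
  have h : ∀ x, ∃ z : ℤ, G x = F x + z := fun x =>
    coe_eq_coe_iff_exists_int.1 ((hG.coe_eq x).trans (hF.coe_eq x).symm)
  choose k hk using h
  have hkc : Continuous k := by
    refine Int.isClosedEmbedding_coe_real.isEmbedding.continuous_iff.2 ?_
    rw [show ((↑) : ℤ → ℝ) ∘ k = fun x => G x - F x from funext fun x => by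
      simp only [Function.comp, hk x]; ring]
    exact hG.continuous.sub hF.continuous
  refine ⟨k 0, fun x => ?_⟩
  rw [hk x, PreconnectedSpace.constant inferInstance hkc (x := x) (y := 0)]

lemma deriv_eq_of_coe_eq (hF : IsLift F f) {x y : ℝ} (h : (x : UnitAddCircle) = y) :
    deriv F x = deriv F y := by
  rw [← circleDeriv_coe hF, ← circleDeriv_coe hF, h]

lemma isPeriodicPt_iff (hF : IsLift F f) {n : ℕ} {x : ℝ} :
    Function.IsPeriodicPt f n (x : UnitAddCircle) ↔ ∃ l : ℤ, F^[n] x = x + l := by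
  rw [Function.IsPeriodicPt, Function.IsFixedPt, ← (hF.iterate n).coe_eq,
    coe_eq_coe_iff_exists_int]

/-- Weak expansion at a fixed point passes to the iterates. -/
lemma eventually_one_lt_deriv_iterate (hF : IsLift F f) (hd : Differentiable ℝ F)
    (hinj : Function.Injective F) {x : ℝ} {l : ℤ} (hx : F x = x + l)
    (hexp : ∀ᶠ y in 𝓝[≠] x, 1 < deriv F y) (t : ℕ) :
    ∀ᶠ y in 𝓝[≠] x, 1 < deriv (F^[t + 1]) y := by
  induction t with
  | zero => simpa using hexp
  | succ t ih =>
    have hlim : Tendsto (fun y => F y - l) (𝓝[≠] x) (𝓝[≠] x) := by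
      refine tendsto_nhdsWithin_iff.2 ⟨?_, ?_⟩
      · have : Tendsto (fun y => F y - l) (𝓝 x) (𝓝 (F x - l)) :=
          (hF.continuous.sub continuous_const).tendsto x
        rw [hx, add_sub_cancel_right] at this
        exact this.mono_left nhdsWithin_le_nhds
      · filter_upwards [self_mem_nhdsWithin] with y hy h
        refine hy (hinj ?_)
        rw [hx]
        linarith [show F y - l = x from h]
    filter_upwards [hexp, hlim.eventually ih] with y h1 h2
    have hdi : Differentiable ℝ (F^[t + 1]) := hd.iterate _
    have h3 : deriv (F^[t + 1]) (F y - l) = deriv (F^[t + 1]) (F y) :=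
      (hF.iterate _).deriv_eq_of_coe_eq (by
        rw [eq_comm, ← sub_add_cancel (F y) (l : ℝ), coe_add_int, add_sub_cancel_right])
    rw [Function.iterate_succ, deriv_comp y (hdi _) (hd y), ← h3]
    nlinarith

lemma isC1BV (hF : IsLift F f) (hc : ContDiff ℝ 1 F) (hb : PeriodicBV (deriv F)) : IsC1BV f :=
  ⟨⟨F, hF, hc⟩, by simpa only [circleDeriv_coe hF] using hb.2.2 0 1⟩

lemma isCrHolder (hF : IsLift F f) (hd : Differentiable ℝ F) {n : ℕ} {ε : ℝ≥0} (hε : ε ≤ 1)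
    (h : IterClass (PeriodicHolder ε) n (deriv F)) : IsCrHolder (n + 1) ε f := by
  have hB := periodicClass_periodicHolder hε
  obtain ⟨h1, h2⟩ := (IterClass.iff_iteratedDeriv hB (h.periodic hB)).1 h
  refine ⟨F, hF, ?_, ?_⟩
  · rw [Nat.cast_succ, contDiff_succ_iff_deriv]
    exact ⟨hd, fun h => absurd h (by simp), h1⟩
  · rw [iteratedDeriv_succ']
    exact h2.2.2

lemma contDiff_of_isCn (hF : IsLift F f) {n : ℕ∞ω} (h : IsCn n f) : ContDiff ℝ n F := by
  obtain ⟨G, hG, hGc⟩ := h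
  obtain ⟨z, hz⟩ := hG.exists_eq_add_int hF
  rw [funext hz]
  exact hGc.add contDiff_const

lemma periodic_deriv (hF : IsLift F f) : Function.Periodic (deriv F) 1 := fun x =>
  hF.deriv_eq_of_coe_eq (by simp)

lemma iterClass_of_isCrHolder (hF : IsLift F f) {n : ℕ} {ε : ℝ≥0} (hε : ε ≤ 1)
    (h : IsCrHolder (n + 1) ε f) : IterClass (PeriodicHolder ε) n (deriv F) := by
  obtain ⟨G, hG, hGc, K, hK⟩ := h
  obtain ⟨z, hz⟩ := hG.exists_eq_add_int hF
  rw [show deriv F = deriv G by rw [funext hz]; exact funext fun x => deriv_add_const _]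
  rw [iteratedDeriv_succ'] at hK
  rw [Nat.cast_succ, contDiff_succ_iff_deriv] at hGc
  rw [IterClass.iff_iteratedDeriv (periodicClass_periodicHolder hε) hG.periodic_deriv]
  refine ⟨hGc.2.2, fun x => ?_, hGc.2.2.continuous_iteratedDeriv n le_rfl, K, hK⟩
  have h := congrFun (iteratedDeriv_comp_add_const (n := n) (f := deriv G) (s := 1)) x
  rw [← h, funext hG.periodic_deriv]

end IsLift

/-- A homeomorphism of the line that commutes with the unit translation descends to the circle. -/
lemma exists_homeomorph_isLift (e : ℝ ≃ₜ ℝ) (he : ∀ x, e (x + 1) = e x + 1)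
    (he' : ∀ x, e.symm (x + 1) = e.symm x + 1) :
    ∃ φ : UnitAddCircle ≃ₜ UnitAddCircle, IsLift e φ ∧ IsLift e.symm φ.symm := by
  have h1 : Function.Periodic (fun x => ((e x : ℝ) : UnitAddCircle)) 1 := fun x => by
    have := coe_add_int (e x) 1
    rw [Int.cast_one] at this
    simp only [he, this]
  have h2 : Function.Periodic (fun x => ((e.symm x : ℝ) : UnitAddCircle)) 1 := fun x => by
    have := coe_add_int (e.symm x) 1
    rw [Int.cast_one] at this
    simp only [he', this]
  refine ⟨⟨⟨h1.lift, h2.lift, fun p => ?_, fun p => ?_⟩, ?_, ?_⟩, ⟨e.continuous, fun x => rfl⟩,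
    ⟨e.symm.continuous, fun x => rfl⟩⟩
  · induction p using QuotientAddGroup.induction_on with
    | H x => exact congrArg _ (e.symm_apply_apply x)
  · induction p using QuotientAddGroup.induction_on with
    | H x => exact congrArg _ (e.apply_symm_apply x)
  · exact continuous_quot_lift _ ((AddCircle.continuous_mk' 1).comp e.continuous)
  · exact continuous_quot_lift _ ((AddCircle.continuous_mk' 1).comp e.symm.continuous)

/-! ### The conjugacy on the circle -/

/-- A circle map of degree at least two has a fixed point, since `H x - x` increases by at least one
over a period. -/
lemma exists_eq_add_int_of_two_le {d : ℕ} (hd : 2 ≤ d) {H : ℝ → ℝ} (hc : Continuous H)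
    (hadd : ∀ x, H (x + 1) = H x + d) : ∃ (a : ℝ) (k : ℤ), H a = a + k := by
  have h1 : H 1 = H 0 + d := by simpa using hadd 0
  have hd' : (2 : ℝ) ≤ d := by exact_mod_cast hd
  obtain ⟨a, -, ha⟩ := intermediate_value_Icc (zero_le_one (α := ℝ))
    ((hc.sub continuous_id).continuousOn (s := Icc 0 1))
    (show ((⌈H 0⌉ : ℤ) : ℝ) ∈ Icc (H 0 - id 0) (H 1 - id 1) from
      ⟨by simpa using Int.le_ceil (H 0), by
        rw [h1, id]; linarith [(Int.ceil_lt_add_one (H 0)).le]⟩)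
  exact ⟨a, ⌈H 0⌉, by
    have : H a - a = ⌈H 0⌉ := ha
    linarith⟩

/-- `H` is a lift of the element `h` of `T_d^*` that fixes the point `a` of the line. Moving `a` to
the origin turns `H` into an `ExpandingLift`. -/
structure NormalLift (d : ℕ) (h : UnitAddCircle → UnitAddCircle) (H : ℝ → ℝ) (a : ℝ) : Prop where
  isLift : IsLift H h
  contDiff : ContDiff ℝ 1 H
  deriv_pos : ∀ x, 0 < deriv H x
  add_one : ∀ x, H (x + 1) = H x + d
  periodicBV : PeriodicBV (deriv H)
  expandingLift : ExpandingLift d (shiftLift H a)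

theorem exists_normalLift {d : ℕ} (hd : 2 ≤ d) {h : UnitAddCircle → UnitAddCircle}
    (hh : IsTStar d h) : ∃ H a, NormalLift d h H a := by
  obtain ⟨H₀, hH₀, hadd₀⟩ := hh.isCovering.hasDegree
  obtain ⟨a, k, hk⟩ := exists_eq_add_int_of_two_le hd hH₀.continuous hadd₀
  set H : ℝ → ℝ := fun x => H₀ x + (-k : ℤ) with hH
  have hL : IsLift H h := hH₀.add_int (-k)
  have hC : ContDiff ℝ 1 H := hL.contDiff_of_isCn hh.isCovering.isC1BV.1
  have hpos : ∀ x, 0 < deriv H x := fun x => by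
    rw [← circleDeriv_coe hL]; exact hh.isCovering.deriv_pos _
  have hadd : ∀ x, H (x + 1) = H x + d := fun x => by
    simp only [hH, hadd₀]; push_cast; ring
  have hBV : PeriodicBV (deriv H) := by
    refine periodicBV_of_Icc hL.periodic_deriv (hC.continuous_deriv le_rfl) ?_
    have := hh.isCovering.isC1BV.2
    simpa only [circleDeriv_coe hL] using this
  have hder : deriv (shiftLift H a) = fun x => deriv H (x + a) := funext (deriv_shiftLift H a)
  refine ⟨H, a, hL, hC, hpos, hadd, hBV, hd, ?_, ?_, ?_, ?_, ?_, ?_⟩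
  · simp only [shiftLift, hH, zero_add, hk]; push_cast; ring
  · exact (hC.comp (contDiff_id.add contDiff_const)).sub contDiff_const
  · intro x; rw [hder]; exact hpos _
  · intro x
    simp only [shiftLift, show x + 1 + a = x + a + 1 by ring, hadd]
    ring
  · rw [hder]
    exact ne_top_of_le_ne_top (hBV.2.2 a (1 + a)) (eVariationOn.comp_le_of_monotoneOn (deriv H)
      (fun x => x + a) (fun x _ y _ hxy => by simpa using hxy)
      fun x hx => ⟨by linarith [hx.1], by linarith [hx.2]⟩)
  · intro s hs x l hx
    rw [iterate_shiftLift, sub_eq_iff_eq_add] at hx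
    have hper : Function.IsPeriodicPt h s ((x + a : ℝ) : UnitAddCircle) :=
      hL.isPeriodicPt_iff.2 ⟨l, by rw [hx]; ring⟩
    obtain ⟨t, ht⟩ := hper.minimalPeriod_dvd
    set m := Function.minimalPeriod h ((x + a : ℝ) : UnitAddCircle) with hm
    obtain ⟨l', hl'⟩ := hL.isPeriodicPt_iff.1
      (Function.isPeriodicPt_minimalPeriod h ((x + a : ℝ) : UnitAddCircle))
    obtain ⟨U, hU, hexp⟩ := hh.weaklyExpanding _ ⟨s, hs, hper⟩
    have hmL := hL.iterate m
    have hev : ∀ᶠ y in 𝓝[≠] (x + a), 1 < deriv (H^[m]) y := by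
      have h1 : ∀ᶠ y : ℝ in 𝓝 (x + a), (y : UnitAddCircle) ∈ U :=
        (AddCircle.continuous_mk' (1 : ℝ)).continuousAt.eventually_mem hU
      have h2 : ∀ᶠ y : ℝ in 𝓝 (x + a), |y - (x + a)| < 1 := by
        filter_upwards [Metric.ball_mem_nhds (x + a) one_pos] with y hy
        rwa [Metric.mem_ball, Real.dist_eq] at hy
      filter_upwards [h1.filter_mono nhdsWithin_le_nhds, h2.filter_mono nhdsWithin_le_nhds,
        self_mem_nhdsWithin] with y hy1 hy2 hy3
      rw [← circleDeriv_coe hmL]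
      refine hexp _ ⟨hy1, fun h => hy3 ?_⟩
      obtain ⟨z, hz⟩ := coe_eq_coe_iff_exists_int.1 h
      rw [hz, add_sub_cancel_left] at hy2
      have hz0 : z = 0 := Int.abs_lt_one_iff.1 (by exact_mod_cast hy2)
      rw [hz, hz0]; simp
    obtain ⟨t, rfl⟩ : ∃ t', t = t' + 1 := Nat.exists_eq_succ_of_ne_zero (by
      rintro rfl; omega)
    have hmono : StrictMono H := strictMono_of_deriv_pos hpos
    have := hmL.eventually_one_lt_deriv_iterate ((hC.differentiable one_ne_zero).iterate m)
      (hmono.iterate m).injective hl' hev t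
    rw [← Function.iterate_mul, ← ht] at this
    have hlim : Tendsto (fun y => y + a) (𝓝[≠] x) (𝓝[≠] (x + a)) :=
      tendsto_nhdsWithin_iff.2 ⟨((continuous_add_const a).tendsto x).mono_left
        nhdsWithin_le_nhds, by
          filter_upwards [self_mem_nhdsWithin] with y hy h
          exact hy (add_right_cancel h)⟩
    filter_upwards [hlim.eventually this] with y hy
    have h := iterDeriv_shiftLift H a s y
    rw [iterDeriv, iterDeriv] at h
    rwa [h]

namespace NormalLift

variable {d : ℕ} {h : UnitAddCircle → UnitAddCircle} {H : ℝ → ℝ} {a : ℝ}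

lemma coe_mem_par_iff (hH : NormalLift d h H a) {x : ℝ} :
    (x : UnitAddCircle) ∈ Par h ↔ Parabolic H x := by
  constructor
  · rintro ⟨hx, h1⟩
    obtain ⟨l, hl⟩ := hH.isLift.isPeriodicPt_iff.1
      (Function.isPeriodicPt_minimalPeriod h (x : UnitAddCircle))
    refine ⟨_, Function.minimalPeriod_pos_of_mem_periodicPts hx, l, hl, ?_⟩
    rwa [circleDeriv_coe (hH.isLift.iterate _)] at h1
  · rintro ⟨s, hs, l, hl, h1⟩
    have hper := hH.isLift.isPeriodicPt_iff.2 ⟨l, hl⟩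
    refine ⟨⟨s, hs, hper⟩, ?_⟩
    rw [circleDeriv_coe (hH.isLift.iterate _)]
    obtain ⟨t, ht⟩ := hper.minimalPeriod_dvd
    set m := Function.minimalPeriod h (x : UnitAddCircle) with hm
    obtain ⟨l', hl'⟩ := hH.isLift.isPeriodicPt_iff.1
      (Function.isPeriodicPt_minimalPeriod h (x : UnitAddCircle))
    have ht0 : t ≠ 0 := by rintro rfl; omega
    have h2 := hH.expandingLift.iterDeriv_mul_of_periodic (n := m) (q := x - a) (l := l')
      (by rw [iterate_shiftLift, sub_add_cancel, hl']; ring) t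
    rw [iterDeriv_shiftLift, iterDeriv_shiftLift, sub_add_cancel, ← ht, h1, eq_comm] at h2
    refine (pow_eq_one_iff_of_nonneg ?_ ht0).1 h2
    have := hH.expandingLift.iterDeriv_pos m (x - a)
    rw [iterDeriv_shiftLift, sub_add_cancel] at this
    exact this.le

theorem finite_par (hH : NormalLift d h H a) : (Par h).Finite := by
  refine (hH.expandingLift.finite_parabolic.image
    fun q : ℝ => ((q + a : ℝ) : UnitAddCircle)).subset fun p hp => ?_
  induction p using QuotientAddGroup.induction_on with
  | H x =>
    have hx : Parabolic (shiftLift H a) (x - a) := by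
      rw [parabolic_shiftLift, sub_add_cancel]
      exact hH.coe_mem_par_iff.1 hp
    refine ⟨Int.fract (x - a), ⟨⟨Int.fract_nonneg _, Int.fract_lt_one _⟩, ?_⟩, ?_⟩
    · have := hx.add_int hH.expandingLift (-⌊x - a⌋)
      rwa [Int.cast_neg, ← sub_eq_add_neg] at this
    · refine coe_eq_coe_iff_exists_int.2 ⟨-⌊x - a⌋, ?_⟩
      rw [Int.fract]; push_cast; ring

theorem exists_expandingChart (hH : NormalLift d h H a) : ∃ Φ ρ, ExpandingChart H Φ ρ := by
  obtain ⟨Φ, ρ, hc⟩ := hH.expandingLift.exists_expandingChart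
  exact ⟨_, _, hc.of_shiftLift⟩

end NormalLift

namespace ExpandingChart

variable {H ρ : ℝ → ℝ}

lemma exists_homeomorph {Φ : ℝ → ℝ} (hc : ExpandingChart H Φ ρ) : ∃ e : ℝ ≃ₜ ℝ, ⇑e = Φ := by
  have hmono : StrictMono Φ := strictMono_of_deriv_pos fun x => by
    rw [(hc.hasDerivAt x).deriv]; exact hc.pos x
  have hcont : Continuous Φ :=
    continuous_iff_continuousAt.2 fun x => (hc.hasDerivAt x).continuousAt
  have hint : ∀ z : ℤ, Φ z = Φ 0 + z := fun z => by
    induction z using Int.induction_on with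
    | zero => simp
    | succ i ih => push_cast at ih ⊢; rw [hc.add_one, ih]; ring
    | pred i ih =>
      have := hc.add_one (-(i : ℝ) - 1)
      push_cast at ih ⊢
      rw [sub_add_cancel, ih] at this
      linarith
  have hsurj : Function.Surjective Φ := fun y => by
    have h1 := hint ⌊y - Φ 0⌋
    have h2 := hint (⌊y - Φ 0⌋ + 1)
    push_cast at h2
    obtain ⟨x, -, hx⟩ := intermediate_value_Icc (show ((⌊y - Φ 0⌋ : ℤ) : ℝ) ≤ ⌊y - Φ 0⌋ + 1 by
      linarith) (hcont.continuousOn) (show y ∈ Icc _ _ by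
        rw [h1, h2]
        constructor <;> linarith [Int.floor_le (y - Φ 0), Int.lt_floor_add_one (y - Φ 0)])
    exact ⟨x, hx⟩
  exact ⟨(hmono.orderIsoOfSurjective Φ hsurj).toHomeomorph, rfl⟩

variable {e : ℝ ≃ₜ ℝ}

lemma symm_add_one (hc : ExpandingChart H e ρ) (x : ℝ) : e.symm (x + 1) = e.symm x + 1 := by
  rw [Homeomorph.symm_apply_eq, hc.add_one, e.apply_symm_apply]

lemma hasDerivAt_symm (hc : ExpandingChart H e ρ) (x : ℝ) :
    HasDerivAt e.symm (ρ (e.symm x))⁻¹ x :=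
  HasDerivAt.of_local_left_inverse e.symm.continuous.continuousAt (hc.hasDerivAt _)
    (hc.pos _).ne' (Eventually.of_forall e.apply_symm_apply)

lemma contDiff_symm (hc : ExpandingChart H e ρ) {n : ℕ∞ω} (he : ContDiff ℝ n e) :
    ContDiff ℝ n e.symm :=
  e.contDiff_symm_deriv (fun x => (hc.pos x).ne') hc.hasDerivAt he

lemma deriv_eq (hc : ExpandingChart H e ρ) : deriv e = ρ :=
  funext fun x => (hc.hasDerivAt x).deriv

lemma periodic (hc : ExpandingChart H e ρ) : Function.Periodic ρ 1 := by
  rw [← hc.deriv_eq]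
  exact periodic_deriv_of_add_one hc.add_one

lemma contDiff_one (hc : ExpandingChart H e ρ) : ContDiff ℝ 1 e := by
  rw [contDiff_one_iff_deriv, hc.deriv_eq]
  exact ⟨fun x => (hc.hasDerivAt x).differentiableAt, hc.continuous⟩

lemma strictMono (hc : ExpandingChart H e ρ) : StrictMono e :=
  strictMono_of_deriv_pos fun x => by rw [hc.deriv_eq]; exact hc.pos x

lemma strictMono_symm (hc : ExpandingChart H e ρ) : StrictMono e.symm := fun x y hxy => by
  rw [← hc.strictMono.lt_iff_lt, e.apply_symm_apply, e.apply_symm_apply]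
  exact hxy

lemma iterClass_deriv_symm (hc : ExpandingChart H e ρ) {B : (ℝ → ℝ) → Prop}
    (hB : PeriodicClass B) {n : ℕ} (hn : IterClass B n ρ) : IterClass B n (deriv e.symm) :=
  (hn.inv hB hc.pos).deriv_of_eq_comp hB (m := 1) (hc.contDiff_symm hc.contDiff_one)
    hc.strictMono_symm.monotone (fun x => by rw [hc.symm_add_one, Int.cast_one])
    fun x => (hc.hasDerivAt_symm x).deriv

end ExpandingChart

/-- The derivative of the conjugate map at `e x` is `ρ (H x) * H' x / ρ x`, which exceeds one unless
`x` is parabolic; and parabolic points are preserved by the conjugacy. -/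
theorem isMetricallyExpanding_conj {d : ℕ} {h : UnitAddCircle → UnitAddCircle} {H : ℝ → ℝ} {a : ℝ}
    (hh : IsCovering d h) (hH : NormalLift d h H a) {e : ℝ ≃ₜ ℝ} {ρ : ℝ → ℝ}
    (hc : ExpandingChart H e ρ) {φ : UnitAddCircle ≃ₜ UnitAddCircle} (hφ : IsLift e φ)
    (hφ' : IsLift e.symm φ.symm) : IsMetricallyExpanding d (φ ∘ h ∘ φ.symm) := by
  set g := φ ∘ h ∘ φ.symm with hg
  set K : ℝ → ℝ := e ∘ H ∘ e.symm with hK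
  have hKL : IsLift K g := hφ.comp (hH.isLift.comp hφ')
  have hHd := hH.contDiff.differentiable one_ne_zero
  have hKd : ∀ y, HasDerivAt K
      (ρ (H (e.symm y)) * (deriv H (e.symm y) * (ρ (e.symm y))⁻¹)) y := fun y =>
    (hc.hasDerivAt _).comp y ((hHd _).hasDerivAt.comp y (hc.hasDerivAt_symm y))
  have hKderiv : deriv K = fun y => ρ (H (e.symm y)) * (deriv H (e.symm y) * (ρ (e.symm y))⁻¹) :=
    funext fun y => (hKd y).deriv
  have hmonoH : StrictMono H := strictMono_of_deriv_pos hH.deriv_pos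
  have heC := hc.contDiff_symm hc.contDiff_one
  have hadd : ∀ y, H (e.symm (y + 1)) = H (e.symm y) + (d : ℤ) := fun y => by
    rw [hc.symm_add_one, hH.add_one, Int.cast_natCast]
  have headd : ∀ (n : ℕ) y, e (y + n) = e y + n := by
    intro n y
    induction n with
    | zero => simp
    | succ n ih => push_cast; rw [← add_assoc, hc.add_one, ih, add_assoc]
  have hρBV : PeriodicBV ρ := hc.iterClass _ periodicClass_periodicBV 0 hH.periodicBV
  have hBV : PeriodicBV (deriv K) := by
    have hB := periodicClass_periodicBV
    obtain ⟨L₁, hL₁⟩ := exists_lipschitzWith heC (periodic_deriv_of_add_one hc.symm_add_one)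
    have hHe := hH.contDiff.comp heC
    obtain ⟨L₂, hL₂⟩ := exists_lipschitzWith hHe (periodic_deriv_of_add_one hadd)
    have hs : ∀ x, e.symm (x + 1) = e.symm x + (1 : ℤ) := fun x => by
      rw [hc.symm_add_one, Int.cast_one]
    rw [hKderiv]
    exact hB.mul (hB.comp hρBV (hmonoH.comp hc.strictMono_symm).monotone hL₂ hadd)
      (hB.mul (hB.comp hH.periodicBV hc.strictMono_symm.monotone hL₁ hs)
        (hB.comp (f := fun x => (ρ x)⁻¹) (hB.inv hρBV hc.pos) hc.strictMono_symm.monotone hL₁ hs))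
  have hcoe : ∀ y : ℝ, circleDeriv g y = deriv K y := circleDeriv_coe hKL
  refine ⟨⟨?_, ⟨K, hKL, fun y => ?_⟩, hKL.isC1BV ?_ hBV, fun p => ?_⟩, fun p hp => ?_⟩
  · exact (hh.isCoveringMap.comp_homeomorph φ.symm).homeomorph_comp φ
  · simp only [hK, Function.comp, hadd, Int.cast_natCast, headd]
  · exact hc.contDiff_one.comp (hH.contDiff.comp heC)
  · induction p using QuotientAddGroup.induction_on with
    | H y =>
      rw [hcoe, hKderiv]
      exact mul_pos (hc.pos _) (mul_pos (hH.deriv_pos _) (inv_pos.2 (hc.pos _)))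
  · induction p using QuotientAddGroup.induction_on with
    | H y =>
      set x := e.symm y with hx
      have hpx : (y : UnitAddCircle) = φ x := by rw [← hφ.coe_eq, hx, e.apply_symm_apply]
      -- parabolic points of `h` are mapped to parabolic points of the conjugate map
      have hnp : ¬ Parabolic H x := fun hpar => hp <| by
        obtain ⟨hx1, hx2⟩ := hH.coe_mem_par_iff.2 hpar
        have hsemi : Function.Semiconj φ h g := fun q => by simp [hg]
        have hiter : ∀ n, Function.IsPeriodicPt h n (x : UnitAddCircle) ↔
            Function.IsPeriodicPt g n (φ x) := fun n => by
          rw [Function.IsPeriodicPt, Function.IsFixedPt, Function.IsPeriodicPt,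
            Function.IsFixedPt, ← (hsemi.iterate_right n).eq, φ.injective.eq_iff]
        have hmin := Function.minimalPeriod_eq_minimalPeriod_iff.2 hiter
        obtain ⟨s, hs, hs'⟩ := hx1
        rw [show ((y : ℝ) : UnitAddCircle) = φ x from hpx]
        refine ⟨⟨s, hs, (hiter s).1 hs'⟩, ?_⟩
        rw [← hmin, ← hpx]
        set m := Function.minimalPeriod h (x : UnitAddCircle) with hm
        obtain ⟨l, hl⟩ := hH.isLift.isPeriodicPt_iff.1
          (Function.isPeriodicPt_minimalPeriod h (x : UnitAddCircle))
        rw [circleDeriv_coe (hH.isLift.iterate m)] at hx2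
        have hKm : K^[m] = e ∘ H^[m] ∘ e.symm := by
          have hse : Function.Semiconj e H K := fun q => by simp [hK]
          funext z
          have := (hse.iterate_right m).eq (e.symm z)
          rw [e.apply_symm_apply] at this
          exact this.symm
        have hd : HasDerivAt (K^[m]) (ρ (H^[m] x) * (deriv (H^[m]) x * (ρ x)⁻¹)) y := by
          rw [hKm]
          exact (hc.hasDerivAt _).comp y
            (((hHd.iterate m) _).hasDerivAt.comp y (hc.hasDerivAt_symm y))
        rw [circleDeriv_coe (hKL.iterate m), hd.deriv, hx2, one_mul, hl,
          show (l : ℝ) = l * 1 by ring, hc.periodic.int_mul l x, mul_inv_cancel₀ (hc.pos x).ne']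
      have h1 := hc.expanding x hnp
      rw [show circleDeriv g (QuotientAddGroup.mk y) = deriv K y from hcoe y, hKderiv]
      show 1 < ρ (H x) * (deriv H x * (ρ x)⁻¹)
      rw [← mul_assoc, ← div_eq_mul_inv, lt_div_iff₀ (hc.pos x), one_mul]
      exact h1

end CircleExpanding

open CircleExpanding

theorem mainTheorem1 (d : ℕ) (hd : 2 ≤ d) (h : UnitAddCircle → UnitAddCircle) (hh : IsTStar d h) :
    (Par h).Finite ∧
    (∃ φ : UnitAddCircle ≃ₜ UnitAddCircle,
      IsDiffeoOfClass IsC1BV φ ∧ IsMetricallyExpanding d (φ ∘ h ∘ φ.symm)) ∧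
    (∀ (r : ℕ) (ε : ℝ≥0), 2 ≤ r → 0 < ε → ε ≤ 1 → IsCrHolder r ε h →
      ∃ φ : UnitAddCircle ≃ₜ UnitAddCircle,
        IsDiffeoOfClass (IsCrHolder r ε) φ ∧ IsMetricallyExpanding d (φ ∘ h ∘ φ.symm)) ∧
    (IsCn ∞ h → ∃ φ : UnitAddCircle ≃ₜ UnitAddCircle,
      IsDiffeoOfClass (IsCn ∞) φ ∧ IsMetricallyExpanding d (φ ∘ h ∘ φ.symm)) ∧
    (IsCn ω h → ∃ φ : UnitAddCircle ≃ₜ UnitAddCircle,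
      IsDiffeoOfClass (IsCn ω) φ ∧ IsMetricallyExpanding d (φ ∘ h ∘ φ.symm)) := by
  obtain ⟨H, a, hH⟩ := exists_normalLift hd hh
  obtain ⟨Φ, ρ, hc⟩ := hH.exists_expandingChart
  obtain ⟨e, rfl⟩ := hc.exists_homeomorph
  obtain ⟨φ, hφ, hφ'⟩ := exists_homeomorph_isLift e hc.add_one hc.symm_add_one
  have hexp := isMetricallyExpanding_conj hh.isCovering hH hc hφ hφ'
  have hCn : ∀ n : ℕ∞ω, IsCn n h → IsDiffeoOfClass (IsCn n) φ := fun n hn =>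
    have he := hc.contDiff n (hH.isLift.contDiff_of_isCn hn)
    ⟨⟨e, hφ, he⟩, ⟨e.symm, hφ', hc.contDiff_symm he⟩⟩
  have hder : ∀ {B : (ℝ → ℝ) → Prop} {n : ℕ}, IterClass B n ρ → IterClass B n (deriv e) :=
    fun hn => by rwa [hc.deriv_eq]
  refine ⟨hH.finite_par, ⟨φ, ⟨?_, ?_⟩, hexp⟩, fun r ε hr _ hε hr' => ⟨φ, ?_, hexp⟩,
    fun hn => ⟨φ, hCn _ hn, hexp⟩, fun hn => ⟨φ, hCn _ hn, hexp⟩⟩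
  · exact hφ.isC1BV hc.contDiff_one
      (hder (hc.iterClass _ periodicClass_periodicBV 0 hH.periodicBV))
  · exact hφ'.isC1BV (hc.contDiff_symm hc.contDiff_one) (hc.iterClass_deriv_symm
      periodicClass_periodicBV (n := 0) (hc.iterClass _ periodicClass_periodicBV 0 hH.periodicBV))
  · obtain ⟨n, rfl⟩ : ∃ n, r = n + 1 := ⟨r - 1, by omega⟩
    have hB := periodicClass_periodicHolder hε
    have hn := hc.iterClass _ hB n (hH.isLift.iterClass_of_isCrHolder hε hr')
    exact ⟨hφ.isCrHolder (hc.contDiff_one.differentiable one_ne_zero) hε (hder hn),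
      hφ'.isCrHolder ((hc.contDiff_symm hc.contDiff_one).differentiable one_ne_zero) hε
        (hc.iterClass_deriv_symm hB hn)⟩
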